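/- For $n\ge 3$ let $\Gamma_n$ be the quotient of the braid group $B_n$ on $n$ strands (with Artin generators $s_1,\dots,s_{n-1}$) by the relations $s_i^3=1$. Let $Q\subset\Gamma_3$ be the kernel of the morphism $\Gamma_3\to\mathbb{Z}/3\mathbb{Z}$, $s_i\mapsto 1$ (it is the quaternion group of order $8$), and let $C_3=\langle s_1\rangle\subset\Gamma_3$, so that $\Gamma_3=Q\rtimes C_3$. For a field $k$, put $$\mathbf q=1+s_1s_2^2+s_2s_1^2+s_1^2s_2+s_2^2s_1+s_1s_2s_1+s_1^2s_2^2s_1^2+s_1s_2^2s_1s_2^2\in k\Gamma_n,\qquad \mathbf b=s_1s_2^{-1}+s_2^{-1}s_1+s_1^{-1}s_2+s_2s_1^{-1}\in k\Gamma_n$$ (for $n=3$, $\mathbf q$ is the sum of the elements of $Q$), and let $kK_n=k\Gamma_n/(\mathbf q)$ be the quotient by the two-sided ideal generated by $\mathbf q$. Let $J(A)$ denote the Jacobson radical of a ring $A$. If $C_3$ acts on an algebra $A$ by automorphisms, $A\rtimes C_3=\bigoplus_{g\in C_3}Ag$ with product $(ag)(a'g')=a\,(g.a')\,gg'$; here $C_3$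 acts on $kQ/J(kQ)^4$ through conjugation on $Q$. Theorem. Let $k$ be a field of characteristic $2$. 1. In $k\Gamma_3$ one has $J(k\Gamma_3)^4=(\mathbf q)\subsetneq(\mathbf b)=J(k\Gamma_3)^3$. 2. There are isomorphisms of $k$-algebras $kK_3\simeq k\Gamma_3/J(k\Gamma_3)^4\simeq\big(kQ/J(kQ)^4\big)\rtimes C_3$. 3. Suppose $k$ contains $\mathbb F_4$. Then there is a two-sided ideal $M_0$ of $\mathbb F_4Q$ with the following properties. Let $\overline{M_0}$ be the image of $M_0$ under $\sum_x a_x x\mapsto\sum_x a_x^2x$, and let $M_q$, $\overline M_q$ be the $k$-spans of $M_0$, $\overline{M_0}$ in $kQ$. Then $M_q$ and $\overline M_q$ are two-sided ideals of $kQ$, $\dim_kM_q=4$, $J(kQ)^3\subsetneq M_q\subsetneq J(kQ)^2$ and $M_q+\overline M_q=J(kQ)^2$; the subspaces $I_q=M_qC_3$ and $\overline I_q=\overline M_qC_3$ (spanned by the products $mc$ with $c\in C_3$ and $m$ in $M_q$, respectively $\overline M_q$) are two-sided ideals of $k\Gamma_3$; and there is an isomorphism of $k$-algebras $$kK_4\simeq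 kK_3\oplus\mathrm{Mat}_3(k\Gamma_3/I_q)\oplus\mathrm{Mat}_3(k\Gamma_3/\overline I_q).$$ -/

import Mathlib

noncomputable section

namespace CubicBraid

/-! ### The groups `Γ n` -/

/-- The defining relators of `Γ n`; the Artin generators `s₁, …, s_{n-1}` of the braid group
on `n` strands are indexed from `0` by `Fin (n - 1)`. They are the braid relators, the commutation
relators and the cubes of the generators. -/
def rels (n : ℕ) : Set (FreeGroup (Fin (n - 1))) :=
  {r | ∃ i j : Fin (n - 1), (i : ℕ) + 1 = (j : ℕ) ∧
      r = (FreeGroup.of i * FreeGroup.of j * FreeGroup.of i) *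
        (FreeGroup.of j * FreeGroup.of i * FreeGroup.of j)⁻¹} ∪
  {r | ∃ i j : Fin (n - 1), (i : ℕ) + 2 ≤ (j : ℕ) ∧
      r = (FreeGroup.of i * FreeGroup.of j) * (FreeGroup.of j * FreeGroup.of i)⁻¹} ∪
  {r | ∃ i : Fin (n - 1), r = FreeGroup.of i ^ 3}

/-- The quotient of the braid group on `n` strands by the relations `s_i ^ 3 = 1`. -/
abbrev Γ (n : ℕ) : Type := PresentedGroup (rels n)

/-- The generator `s₁` of `Γ n`, for `n ≥ 3`. -/
def s₁ (n : ℕ) (hn : 3 ≤ n) : Γ n := PresentedGroup.of ⟨0, by omega⟩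

/-- The generator `s₂` of `Γ n`, for `n ≥ 3`. -/
def s₂ (n : ℕ) (hn : 3 ≤ n) : Γ n := PresentedGroup.of ⟨1, by omega⟩

/-- The morphism from `Γ n` to the cyclic group of order `3` which sends every `s_i` to the
same generator. -/
def len (n : ℕ) : Γ n →* Multiplicative (ZMod 3) :=
  PresentedGroup.toGroup (f := fun _ => Multiplicative.ofAdd (1 : ZMod 3)) (by
    rintro r ((⟨i, j, -, rfl⟩ | ⟨i, j, -, rfl⟩) | ⟨i, rfl⟩)
    · simp
    · simp
    · simp only [map_pow, FreeGroup.lift_apply_of]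
      decide)

/-- The subgroup `Q` of `Γ 3`, the kernel of `Γ 3 → C₃`. -/
abbrev Q : Subgroup (Γ 3) := (len 3).ker

/-- The subgroup `C₃ = ⟨s₁⟩` of `Γ 3`. -/
abbrev C₃ : Subgroup (Γ 3) := Subgroup.zpowers (s₁ 3 le_rfl)

/-! ### Group algebras, the elements `q` and `b`, and the algebras `K n` -/

variable (k : Type*) [Field k]

/-- The element `q = 1 + s₁s₂² + s₂s₁² + s₁²s₂ + s₂²s₁ + s₁s₂s₁ + s₁²s₂²s₁² + s₁s₂²s₁s₂²`
of the group algebra of `Γ n`; for `n = 3` it is the sum of the elements of `Q`. -/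
def q (n : ℕ) (hn : 3 ≤ n) : MonoidAlgebra k (Γ n) :=
  let g := MonoidAlgebra.of k (Γ n)
  let s := s₁ n hn
  let t := s₂ n hn
  g 1 + g (s * t ^ 2) + g (t * s ^ 2) + g (s ^ 2 * t) + g (t ^ 2 * s) + g (s * t * s) +
    g (s ^ 2 * t ^ 2 * s ^ 2) + g (s * t ^ 2 * s * t ^ 2)

/-- The element `b = s₁s₂⁻¹ + s₂⁻¹s₁ + s₁⁻¹s₂ + s₂s₁⁻¹` of the group algebra of `Γ n`. -/
def b (n : ℕ) (hn : 3 ≤ n) : MonoidAlgebra k (Γ n) :=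
  let g := MonoidAlgebra.of k (Γ n)
  let s := s₁ n hn
  let t := s₂ n hn
  g (s * t⁻¹) + g (t⁻¹ * s) + g (s⁻¹ * t) + g (t * s⁻¹)

/-- The two-sided ideal generated by an element. -/
abbrev gen {A : Type*} [Ring A] (x : A) : Ideal A := (TwoSidedIdeal.span {x}).asIdeal

/-- The algebra `k K_n`, the quotient of the group algebra of `Γ n` by the two-sided ideal
generated by `q`. -/
abbrev K (n : ℕ) (hn : 3 ≤ n) : Type _ := MonoidAlgebra k (Γ n) ⧸ gen (q k n hn)

/-! ### The semidirect product `(kQ / J(kQ)^4) ⋊ C₃` -/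

/-- The `r`-th power of the Jacobson radical of a ring. -/
abbrev J (A : Type*) [Ring A] (r : ℕ) : Ideal A := Ring.jacobson A ^ r

theorem J_le_comap {A : Type*} [Ring A] [Algebra k A] (σ : A ≃ₐ[k] A) (r : ℕ) :
    J A r ≤ (J A r).comap (σ : A →ₐ[k] A) := by
  have h1 : ∀ x ∈ Ring.jacobson A, σ x ∈ Ring.jacobson A := fun x hx => by
    have : RingHomSurjective (σ : A →+* A) := ⟨σ.surjective⟩
    exact Ring.le_comap_jacobson (σ : A →+* A) hx
  change ∀ x ∈ Ring.jacobson A ^ r, σ x ∈ Ring.jacobson A ^ r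
  induction r with
  | zero =>
    intro x _
    rw [Submodule.pow_zero, Ideal.one_eq_top]
    trivial
  | succ r ih =>
    intro x hx
    rw [Submodule.pow_succ] at hx ⊢
    refine Submodule.mul_induction_on hx (fun a ha c hc => ?_) (fun a c ha hc => ?_)
    · rw [map_mul]
      exact Ideal.mul_mem_mul (ih a ha) (h1 c hc)
    · rw [map_add]
      exact add_mem ha hc

/-- The action of `C₃` on `kQ` induced by conjugation in `Γ 3`. -/
def conjAut : C₃ →* (MonoidAlgebra k Q ≃ₐ[k] MonoidAlgebra k Q) :=
  (MonoidAlgebra.domCongrAut (R := k) (A := k)).comp (MulAut.conjNormal.comp C₃.subtype)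

/-- The quotient algebra `kQ / J(kQ)^4`. -/
abbrev kQJ4 : Type _ := MonoidAlgebra k Q ⧸ J (MonoidAlgebra k Q) 4

/-- The action of an element of `C₃` on `kQ / J(kQ)^4`, induced by its action on `kQ`. -/
def actHom (c : C₃) : kQJ4 k →ₐ[k] kQJ4 k :=
  Ideal.quotientMapₐ _ (conjAut k c : MonoidAlgebra k Q →ₐ[k] MonoidAlgebra k Q)
    (J_le_comap k (conjAut k c) 4)

theorem actHom_mk (c : C₃) (x : MonoidAlgebra k Q) :
    actHom k c (Ideal.Quotient.mk _ x) = Ideal.Quotient.mk _ (conjAut k c x) := rfl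

instance : MulSemiringAction C₃ (kQJ4 k) where
  smul c x := actHom k c x
  one_smul x := by
    obtain ⟨x, rfl⟩ := Ideal.Quotient.mk_surjective x
    change actHom k 1 _ = _
    rw [actHom_mk, map_one]
    rfl
  mul_smul c d x := by
    obtain ⟨x, rfl⟩ := Ideal.Quotient.mk_surjective x
    change actHom k (c * d) _ = actHom k c (actHom k d _)
    rw [actHom_mk, actHom_mk, actHom_mk, map_mul]
    rfl
  smul_zero c := map_zero (actHom k c)
  smul_add c := map_add (actHom k c)
  smul_one c := map_one (actHom k c)
  smul_mul c := map_mul (actHom k c)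

instance : SMulCommClass C₃ k (kQJ4 k) where
  smul_comm c r x := map_smul (actHom k c) r x

/-! ### Subspaces of `kQ` and of `kΓ₃` -/

/-- The field with four elements. -/
abbrev F₄ : Type := GaloisField 2 2

variable {k}

/-- The `k`-subspace of `kQ` spanned by a set of elements of `F₄Q`, where the coefficients are
mapped to `k` by `ι`. -/
def scalarExt (ι : F₄ →+* k) (S : Set (MonoidAlgebra F₄ Q)) : Submodule k (MonoidAlgebra k Q) :=
  Submodule.span k (MonoidAlgebra.mapRingHom Q ι '' S)

/-- The image of `S ⊆ F₄Q` under the Galois conjugation `∑ a_x x ↦ ∑ a_x² x`. -/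
def galoisConj (S : Set (MonoidAlgebra F₄ Q)) : Set (MonoidAlgebra F₄ Q) :=
  MonoidAlgebra.mapRingHom Q (frobenius F₄ 2) '' S

/-- For `M ⊆ kQ`, the `k`-subspace `M C₃` of `kΓ₃` spanned by the products `m c`
with `m ∈ M` and `c ∈ C₃`. -/
def mulC₃ (M : Set (MonoidAlgebra k Q)) : Submodule k (MonoidAlgebra k (Γ 3)) :=
  Submodule.span k {x | ∃ m ∈ M, ∃ c ∈ C₃,
    x = MonoidAlgebra.mapDomainRingHom k Q.subtype m * MonoidAlgebra.of k (Γ 3) c}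

end CubicBraid

end

open CubicBraid

/-! In characteristic 2 put X = 1 - i, Y = 1 - j, Z = 1 - i², where i = s₁s₂⁻¹ and j = s₁⁻¹s₂
generate Q. The quaternion relations give the powers of the ideal (X, Y): they are (XY, Z), (XZ,
YZ), (XYZ) and 0. This nilpotent ideal is the kernel of kΓ₃ → kC₃, whose target is semisimple
because 3 ≠ 0 in k, so it is the radical (`jacobson_eq_span`); the same computation applies to kQ.
Since q = XYZ and b = XZ + YZ, this yields the chain of ideals in kΓ₃, and the splitting Γ₃ = Q ⋊ C₃
yields the skew group algebra.

For kK₄, the projection s₁, s₂, s₃ ↦ s₁, s₂, s₁ splits Γ₄ as E ⋊ Γ₃, where E is generated by `ea` =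
s₁s₃⁻¹ and its conjugate `eb` by s₂; their commutator `ez` is central with cube 1. For a primitive
cube root of unity ω, the element 1 is the sum of three central idempotents, one for each eigenvalue
of `ez`.

On the component of a nontrivial eigenvalue, E acts through a three-dimensional representation that
extends to Γ₄ (`rho`). Tensoring it with the projection to Γ₃ identifies the component with
Mat₃(kΓ₃) (`Phi_surjective`, `sum_coeffLift_Phi`). The entries of the image of q generate I_q
(`Phi_q`, `iIdeal_le_entryIdeal`).

On the component where `ez` acts as 1, E acts through 𝔽₃², and nontrivial elements of Q fix no
nonzero vector there. Summing suitable two-sided translates of q shows that modulo q only the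
trivial character of E survives (`idem_one_sub_idemE_mem`); what is left is kΓ₃/(q) = kK₃.
`nonempty_algEquiv_prod` glues the three components. -/

namespace CubicBraid

/-! ### Powers of the augmentation ideal in terms of quaternion relations -/

/-- Relations satisfied by `X = 1 + i`, `Y = 1 + j`, `Z = 1 + i²` in a ring of characteristic two
containing units `i`, `j` which generate a quaternion group. -/
structure QuatRel {R : Type*} [Ring R] (X Y Z : R) : Prop where
  two : (2 : R) = 0
  xx : X * X = Z
  yy : Y * Y = Z
  zz : Z * Z = 0
  -- The relation ji = ij·i², expanded in X, Y, Z; it moves every X to the left of every Y.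
  yx : Y * X = X * Y + Z + X * Z + Y * Z + X * Y * Z

namespace QuatRel

variable {R : Type*} [Ring R] {X Y Z : R} (h : QuatRel X Y Z)

theorem zx (h : QuatRel X Y Z) : Z * X = X * Z := by rw [← h.xx, mul_assoc]

theorem zy (h : QuatRel X Y Z) : Z * Y = Y * Z := by rw [← h.yy, mul_assoc]

theorem add_self (h : QuatRel X Y Z) (r : R) : r + r = 0 := by rw [← two_mul, h.two, zero_mul]

theorem neg_eq (h : QuatRel X Y Z) (r : R) : -r = r := by
  rw [neg_eq_iff_add_eq_zero, h.add_self]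

theorem xx' (h : QuatRel X Y Z) (r : R) : X * (X * r) = Z * r := by rw [← h.xx, mul_assoc]

theorem yy' (h : QuatRel X Y Z) (r : R) : Y * (Y * r) = Z * r := by rw [← h.yy, mul_assoc]

theorem zx' (h : QuatRel X Y Z) (r : R) : Z * (X * r) = X * (Z * r) := by
  rw [← mul_assoc, h.zx, mul_assoc]

theorem zy' (h : QuatRel X Y Z) (r : R) : Z * (Y * r) = Y * (Z * r) := by
  rw [← mul_assoc, h.zy, mul_assoc]

theorem yx' (h : QuatRel X Y Z) (r : R) :
    Y * (X * r) = X * (Y * r) + Z * r + X * (Z * r) + Y * (Z * r) + X * (Y * (Z * r)) := by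
  rw [← mul_assoc, h.yx]; simp only [add_mul, mul_assoc]

theorem yxz (h : QuatRel X Y Z) : Y * (X * Z) = X * (Y * Z) := by
  simp only [h.yx', h.zz, mul_zero, add_zero]

theorem xyx (h : QuatRel X Y Z) : X * (Y * X) = X * Z + Y * Z + X * (Y * Z) := by
  simp only [h.yx, mul_add, mul_assoc, h.xx', h.zz, h.zy, mul_zero, add_zero, h.zy']
  abel

/-- The left ideal generated by `X` and `Y` absorbs multiplication by `X` and `Y` on the right. -/
theorem span_mul_le {L : Ideal R} {S : Set R} (hN : (Ideal.span {X, Y}).IsTwoSided)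
    (hX : ∀ v ∈ S, X * v ∈ L) (hY : ∀ v ∈ S, Y * v ∈ L) :
    Ideal.span {X, Y} * Ideal.span S ≤ L := by
  have key : ∀ d ∈ Ideal.span {X, Y}, ∀ v ∈ S, d * v ∈ L := by
    intro d hd v hv
    obtain ⟨α, β, rfl⟩ := Ideal.mem_span_pair.1 hd
    rw [add_mul, mul_assoc, mul_assoc]
    exact add_mem (L.mul_mem_left _ (hX v hv)) (L.mul_mem_left _ (hY v hv))
  rw [Submodule.mul_le]
  intro d hd w hw
  induction hw using Submodule.span_induction generalizing d with
  | mem v hv => exact key d hd v hv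
  | zero => simp
  | add v w _ _ hv hw => rw [mul_add]; exact add_mem (hv d hd) (hw d hd)
  | smul c v _ hv =>
    rw [smul_eq_mul, ← mul_assoc]
    exact hv _ (Ideal.mul_mem_right c _ hd)

theorem X_mem : X ∈ Ideal.span {X, Y} := Ideal.subset_span (by simp)

theorem Y_mem : Y ∈ Ideal.span {X, Y} := Ideal.subset_span (by simp)

/-- This and the next three lemmas rest on one mechanism: by `span_mul_le` the next power is reached
by multiplying the generators of the previous one on the left by X and Y, and the relations rewrite
the products. -/
theorem span_sq (h : QuatRel X Y Z) (hN : (Ideal.span {X, Y}).IsTwoSided) :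
    Ideal.span {X, Y} ^ 2 = Ideal.span {X * Y, Z} := by
  have hXY : X * Y ∈ Ideal.span {X * Y, Z} := Ideal.subset_span (by simp)
  have hZ : Z ∈ Ideal.span {X * Y, Z} := Ideal.subset_span (by simp)
  rw [Submodule.pow_succ, Submodule.pow_one]
  apply le_antisymm
  · refine span_mul_le hN ?_ ?_
    · rintro v (rfl | rfl)
      · rwa [h.xx]
      · exact hXY
    · rintro v (rfl | rfl)
      · rw [h.yx]
        exact add_mem (add_mem (add_mem (add_mem hXY hZ) (Ideal.mul_mem_left _ _ hZ))
          (Ideal.mul_mem_left _ _ hZ)) (Ideal.mul_mem_left _ _ hZ)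
      · rwa [h.yy]
  · rw [Ideal.span_le]
    rintro v (rfl | rfl)
    · exact Ideal.mul_mem_mul X_mem Y_mem
    · rw [← h.xx]
      exact Ideal.mul_mem_mul X_mem X_mem

theorem span_cube (h : QuatRel X Y Z) (hN : (Ideal.span {X, Y}).IsTwoSided) :
    Ideal.span {X, Y} ^ 3 = Ideal.span {X * Z, Y * Z} := by
  have hXZ : X * Z ∈ Ideal.span {X * Z, Y * Z} := Ideal.subset_span (by simp)
  have hYZ : Y * Z ∈ Ideal.span {X * Z, Y * Z} := Ideal.subset_span (by simp)
  rw [Submodule.pow_succ' _ two_ne_zero, h.span_sq hN]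
  apply le_antisymm
  · refine span_mul_le hN ?_ ?_
    · rintro v (rfl | rfl)
      · rwa [h.xx', h.zy]
      · exact hXZ
    · rintro v (rfl | rfl)
      · rw [h.yx', h.yy, h.zy, h.yy', h.zz, mul_zero, add_zero, add_zero]
        exact add_mem (add_mem hXZ hYZ) (Ideal.mul_mem_left _ _ hYZ)
      · exact hYZ
  · rw [Ideal.span_le]
    rintro v (rfl | rfl)
    · exact Ideal.mul_mem_mul X_mem (Ideal.subset_span (by simp))
    · exact Ideal.mul_mem_mul Y_mem (Ideal.subset_span (by simp))

theorem span_fourth (h : QuatRel X Y Z) (hN : (Ideal.span {X, Y}).IsTwoSided) :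
    Ideal.span {X, Y} ^ 4 = Ideal.span {X * (Y * Z)} := by
  have hXYZ : X * (Y * Z) ∈ Ideal.span {X * (Y * Z)} := Ideal.subset_span (by simp)
  rw [Submodule.pow_succ' _ three_ne_zero, h.span_cube hN]
  apply le_antisymm
  · refine span_mul_le hN ?_ ?_
    · rintro v (rfl | rfl)
      · rw [h.xx', h.zz]; exact zero_mem _
      · exact hXYZ
    · rintro v (rfl | rfl)
      · rwa [h.yxz]
      · rw [h.yy', h.zz]; exact zero_mem _
  · rw [Ideal.span_le]
    rintro v rfl
    exact Ideal.mul_mem_mul X_mem (Ideal.subset_span (by simp))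

theorem span_fifth (h : QuatRel X Y Z) (hN : (Ideal.span {X, Y}).IsTwoSided) :
    Ideal.span {X, Y} ^ 5 = ⊥ := by
  rw [Submodule.pow_succ' _ four_ne_zero, h.span_fourth hN, eq_bot_iff]
  refine span_mul_le hN ?_ ?_
  · rintro v rfl
    rw [h.xx', h.zy', h.zz, mul_zero]; exact zero_mem _
  · rintro v rfl
    rw [h.yx', h.yy', h.zz]; simp [h.zz, h.zy']

end QuatRel

/-- If x lies in a nilpotent left ideal, every y * x is nilpotent, so 1 + y * x is a unit. -/
theorem le_jacobson_of_pow_eq_bot {R : Type*} [Ring R] {N : Ideal R} {n : ℕ} (hn : N ^ n = ⊥) :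
    N ≤ Ring.jacobson R := by
  intro x hx
  rw [← Ideal.jacobson_bot, Ideal.mem_jacobson_iff]
  intro y
  have hyx : IsNilpotent (y * x) := by
    have key : ∀ m, (y * x) ^ m ∈ N ^ m := by
      intro m
      induction m with
      | zero => rw [Submodule.pow_zero, pow_zero, Ideal.one_eq_top]; trivial
      | succ m ih =>
        rw [Submodule.pow_succ, pow_succ]
        exact Ideal.mul_mem_mul ih (N.mul_mem_left _ hx)
    refine ⟨n, ?_⟩
    have := key n
    rwa [hn] at this
  obtain ⟨u, hu⟩ := hyx.isUnit_one_add
  refine ⟨(u⁻¹ : Rˣ), ?_⟩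
  have : (u⁻¹ : Rˣ) * (1 + y * x) = 1 := by rw [← hu]; simp
  rw [mul_add, mul_one, ← mul_assoc] at this
  rw [add_comm, this, sub_self]
  exact zero_mem _

/-! ### The Jacobson radical of the group algebra of a split extension -/

section GroupAlgebra

variable (k : Type*) [Field k] {G C : Type*} [Group G] [Group C]

theorem mapDomainRingHom_of (f : G →* C) (g : G) :
    MonoidAlgebra.mapDomainRingHom k f (MonoidAlgebra.of k G g) = MonoidAlgebra.of k C (f g) := by
  simp

/-- The kernel of the algebra map induced by a split group morphism whose kernel is generated
by `i` and `j`, as a left ideal. -/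
theorem ker_mapDomain_eq_span (r : G →* C) (σ : C →* G) (hσ : ∀ c, r (σ c) = c) {i j : G}
    (hi : r i = 1) (hj : r j = 1) (hker : ∀ g, r g = 1 → g ∈ Subgroup.closure {i, j}) :
    RingHom.ker (MonoidAlgebra.mapDomainRingHom k r) =
      Ideal.span {1 - MonoidAlgebra.of k G i, 1 - MonoidAlgebra.of k G j} := by
  set L := Ideal.span {1 - MonoidAlgebra.of k G i, 1 - MonoidAlgebra.of k G j} with hL
  apply le_antisymm
  · have h1 : ∀ g, r g = 1 → 1 - MonoidAlgebra.of k G g ∈ L := by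
      intro g hg
      replace hg := hker g hg
      induction hg using Subgroup.closure_induction with
      | mem x hx =>
        rcases hx with rfl | rfl
        · exact Ideal.subset_span (by simp)
        · exact Ideal.subset_span (by simp)
      | one => rw [map_one, sub_self]; exact zero_mem _
      | mul x y _ _ hx hy =>
        have : 1 - MonoidAlgebra.of k G (x * y) = MonoidAlgebra.of k G x *
            (1 - MonoidAlgebra.of k G y) + (1 - MonoidAlgebra.of k G x) := by
          rw [map_mul]; noncomm_ring
        rw [this]
        exact add_mem (L.mul_mem_left _ hy) hx
      | inv x _ hx =>
        have : 1 - MonoidAlgebra.of k G x⁻¹ = -(MonoidAlgebra.of k G x⁻¹ *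
            (1 - MonoidAlgebra.of k G x)) := by
          rw [mul_sub, ← map_mul, inv_mul_cancel, map_one, mul_one, neg_sub]
        rw [this]
        exact neg_mem (L.mul_mem_left _ hx)
    -- Modulo L every element agrees with its image under g ↦ σ (r g); for an element of the kernel
    -- that image is zero.
    have h2 : ∀ x, x - MonoidAlgebra.mapDomainRingHom k σ (MonoidAlgebra.mapDomainRingHom k r x)
        ∈ L := by
      intro x
      induction x using MonoidAlgebra.induction_linear with
      | zero => simp
      | add f g hf hg =>
        rw [map_add, map_add, add_sub_add_comm]
        exact add_mem hf hg
      | single g a =>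
        rw [MonoidAlgebra.mapDomainRingHom_apply, MonoidAlgebra.mapDomainRingHom_apply,
          MonoidAlgebra.mapDomain_single, MonoidAlgebra.mapDomain_single]
        -- The factorisation g = σ(r g) · h with h in the kernel of r gives g - σ(r g) = -σ(r g)(1 -
        -- h).
        have := L.mul_mem_left (MonoidAlgebra.single (σ (r g)) (-a)) (h1 ((σ (r g))⁻¹ * g) (by simp [hσ]))
        rwa [mul_sub, mul_one, MonoidAlgebra.of_apply, MonoidAlgebra.single_mul_single, mul_one,
          mul_inv_cancel_left, MonoidAlgebra.single_neg, MonoidAlgebra.single_neg,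
          neg_sub_neg] at this
    intro x hx
    have := h2 x
    rwa [RingHom.mem_ker.1 hx, map_zero, sub_zero] at this
  · rw [Ideal.span_le]
    rintro _ (rfl | rfl) <;>
      simp only [SetLike.mem_coe, RingHom.mem_ker, map_sub, map_one, mapDomainRingHom_of, hi, hj,
        sub_self]

/-- The span is the kernel of kG → kC. The radical maps to zero because kC is semisimple by Maschke;
conversely the kernel is two-sided with fifth power zero. -/
theorem jacobson_eq_span (r : G →* C) (σ : C →* G) (hσ : ∀ c, r (σ c) = c) {i j : G}
    (hi : r i = 1) (hj : r j = 1) (hker : ∀ g, r g = 1 → g ∈ Subgroup.closure {i, j})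
    [Finite C] (hC : (Nat.card C : k) ≠ 0) {Z : MonoidAlgebra k G}
    (h : QuatRel (1 - MonoidAlgebra.of k G i) (1 - MonoidAlgebra.of k G j) Z) :
    Ring.jacobson (MonoidAlgebra k G) =
      Ideal.span {1 - MonoidAlgebra.of k G i, 1 - MonoidAlgebra.of k G j} := by
  have hker := ker_mapDomain_eq_span k r σ hσ hi hj hker
  have : NeZero (Nat.card C : k) := ⟨hC⟩
  apply le_antisymm
  · rw [← hker]
    have hs : Function.Surjective (MonoidAlgebra.mapDomainRingHom k r) := fun x =>
      ⟨MonoidAlgebra.mapDomainRingHom k σ x, by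
        rw [← RingHom.comp_apply, ← MonoidAlgebra.mapDomainRingHom_comp]
        have : r.comp σ = MonoidHom.id C := by ext; simp [hσ]
        simp [this]⟩
    have : RingHomSurjective (MonoidAlgebra.mapDomainRingHom k r) := ⟨hs⟩
    intro x hx
    have := Ring.le_comap_jacobson (MonoidAlgebra.mapDomainRingHom k r) hx
    rwa [IsSemisimpleRing.jacobson_eq_bot] at this
  · refine le_jacobson_of_pow_eq_bot (h.span_fifth ?_)
    rw [← hker]
    infer_instance

end GroupAlgebra

end CubicBraid

namespace CubicBraid

/-! ### The group `Γ 3` -/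

theorem QuatRel.of_units {R : Type*} [Ring R] (h2 : (2 : R) = 0) {I J z : R} (hI : I * I = z)
    (hJ : J * J = z) (hJI : J * I = I * J * z) (hz : z * z = 1) :
    QuatRel (1 - I) (1 - J) (1 - z) := by
  have hn : ∀ r : R, -r = r := fun r => by
    rw [neg_eq_iff_add_eq_zero, ← two_mul, h2, zero_mul]
  have h3 : (3 : R) = 1 := by rw [show (3 : R) = 2 + 1 by norm_num, h2, zero_add]
  have h4 : (4 : R) = 0 := by rw [show (4 : R) = 2 * 2 by norm_num, h2, zero_mul]
  have h5 : (5 : R) = 1 := by rw [show (5 : R) = 4 + 1 by norm_num, h4, zero_add]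
  have hz' : ∀ r, z * (z * r) = r := fun r => by rw [← mul_assoc, hz, one_mul]
  have hzJ : z * J = J * z := by rw [← hJ, mul_assoc]
  refine ⟨h2, ?_, ?_, ?_, ?_⟩
  · simp only [sub_eq_add_neg, hn, mul_add, add_mul, one_mul, mul_one, hI]
    abel_nf; simp [h2]
  · simp only [sub_eq_add_neg, hn, mul_add, add_mul, one_mul, mul_one, hJ]
    abel_nf; simp [h2]
  · simp only [sub_eq_add_neg, hn, mul_add, add_mul, one_mul, mul_one, hz]
    abel_nf; simp [h2]
  · simp only [sub_eq_add_neg, hn, mul_add, add_mul, one_mul, mul_one, hJI, mul_assoc]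
    abel_nf; simp [h2, h3, h4, h5]

theorem expand_q {R : Type*} [Ring R] (h2 : ∀ r : R, -r = r) (I J z : R) :
    (1 - I) * ((1 - J) * (1 - z)) =
      1 + I + I * z + J + J * z + I * J * z + I * J + z := by
  simp only [sub_eq_add_neg, h2, mul_add, add_mul, one_mul, mul_one, mul_assoc]
  abel

theorem expand_b {R : Type*} [Ring R] (h2 : ∀ r : R, -r = r) (I J z : R) :
    (1 - I) * (1 - z) + (1 - J) * (1 - z) = I + J * z + J + I * z := by
  have h : (1 - I) * (1 - z) + (1 - J) * (1 - z) =
      -I + J * z - J + I * z + (1 - z) + -(-1 + z) := by noncomm_ring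
  rw [h, h2 I, sub_eq_add_neg, h2 J, h2 (-1 + z), add_assoc _ (1 - z), add_comm (-1 : R),
    ← sub_eq_add_neg, sub_add_sub_cancel, sub_self, add_zero]

section Group

variable {G : Type*} [Group G] {s t : G}

theorem conj_j (s t : G) : s * (s⁻¹ * t) * s⁻¹ = (s * t⁻¹)⁻¹ := by group

theorem conj_i (h : s * t * s = t * s * t) :
    s * (s * t⁻¹) * s⁻¹ = (s * t⁻¹) * (s⁻¹ * t) := by
  rw [← mul_inv_eq_one]
  have : s * (s * t⁻¹) * s⁻¹ * (s * t⁻¹ * (s⁻¹ * t))⁻¹ =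
      s * s * t⁻¹ * s⁻¹ * t⁻¹ * (s * t * s) * s⁻¹ * s⁻¹ := by group
  rw [this, h]
  group

theorem conj_conj_conj (h3 : s ^ 3 = 1) (x : G) : s * (s * (s * x * s⁻¹) * s⁻¹) * s⁻¹ = x := by
  have : s * (s * (s * x * s⁻¹) * s⁻¹) * s⁻¹ = s ^ 3 * x * (s ^ 3)⁻¹ := by
    simp only [pow_succ, pow_zero]; group
  rw [this, h3]
  group

variable {i j : G}

/-- Since s³ = 1, conjugating three times by s fixes i and j. Computing the threefold conjugates
from the two hypotheses gives i = jij and j = iji, and these imply all the quaternion relations. -/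
theorem quat_of_conj (h3 : s ^ 3 = 1) (hi : s * i * s⁻¹ = i * j) (hj : s * j * s⁻¹ = i⁻¹) :
    i * i = j * j ∧ j * i = i * j * (i * i) ∧ i * i * (i * i) = 1 := by
  have conj_mul : ∀ x y, s * (x * y) * s⁻¹ = (s * x * s⁻¹) * (s * y * s⁻¹) := fun x y => by group
  have conj_inv : ∀ x, s * x⁻¹ * s⁻¹ = (s * x * s⁻¹)⁻¹ := fun x => by group
  have h1 := conj_conj_conj h3 j
  have h2 := conj_conj_conj h3 i
  simp only [hi, hj, conj_mul, conj_inv] at h1 h2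
  have e1 : i = j * i * j := by
    have : (i * j * i⁻¹)⁻¹ = i * j⁻¹ * i⁻¹ := by group
    rw [this, mul_inv_eq_iff_eq_mul] at h1
    rwa [← mul_inv_eq_iff_eq_mul]
  have e2 : j = i * j * i := by
    rw [mul_inv_eq_iff_eq_mul, mul_inv_eq_iff_eq_mul, mul_assoc] at h2
    exact mul_left_cancel h2
  have e3 : i * i = j * j := by
    calc i * i = i * (j * i * j) := by rw [← e1]
      _ = (i * j * i) * j := by group
      _ = j * j := by rw [← e2]
  have e4 : j * i = i * j⁻¹ := by nth_rw 2 [e1]; group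
  have e4' : j * i * j⁻¹ = i⁻¹ := by
    calc j * i * j⁻¹ = i * (j * j)⁻¹ := by rw [e4]; group
      _ = i⁻¹ := by rw [← e3]; group
  have e5 : i * i = (i * i)⁻¹ := by
    calc i * i = j * (j * j) * j⁻¹ := by rw [e3]; group
      _ = (j * i * j⁻¹) * (j * i * j⁻¹) := by rw [← e3]; group
      _ = (i * i)⁻¹ := by rw [e4']; group
  have e6 : i * i * (i * i) = 1 := by nth_rw 1 [e5]; group
  refine ⟨e3, ?_, e6⟩
  rw [e4, e5, e3]
  group

end Group

/-- The element `i = s₁ s₂⁻¹` of `Γ 3`. -/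
def qi : Γ 3 := s₁ 3 le_rfl * (s₂ 3 le_rfl)⁻¹

/-- The element `j = s₁⁻¹ s₂` of `Γ 3`. -/
def qj : Γ 3 := (s₁ 3 le_rfl)⁻¹ * s₂ 3 le_rfl

theorem s₁_cube (n : ℕ) (hn : 3 ≤ n) : s₁ n hn ^ 3 = 1 :=
  PresentedGroup.one_of_mem (rels := rels n) (Or.inr ⟨_, rfl⟩)

theorem s₂_cube (n : ℕ) (hn : 3 ≤ n) : s₂ n hn ^ 3 = 1 :=
  PresentedGroup.one_of_mem (rels := rels n) (Or.inr ⟨_, rfl⟩)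

theorem braid₁₂ (n : ℕ) (hn : 3 ≤ n) :
    s₁ n hn * s₂ n hn * s₁ n hn = s₂ n hn * s₁ n hn * s₂ n hn :=
  PresentedGroup.mk_eq_mk_of_mul_inv_mem (rels := rels n) (Or.inl (Or.inl ⟨_, _, rfl, rfl⟩))

theorem s₁_conj_qi : s₁ 3 le_rfl * qi * (s₁ 3 le_rfl)⁻¹ = qi * qj := conj_i (braid₁₂ 3 le_rfl)

theorem s₁_conj_qj : s₁ 3 le_rfl * qj * (s₁ 3 le_rfl)⁻¹ = qi⁻¹ := conj_j _ _

theorem qi_mul_qi : qi * qi = qj * qj :=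
  (quat_of_conj (s₁_cube 3 le_rfl) s₁_conj_qi s₁_conj_qj).1

theorem qj_mul_qi : qj * qi = qi * qj * (qi * qi) :=
  (quat_of_conj (s₁_cube 3 le_rfl) s₁_conj_qi s₁_conj_qj).2.1

theorem qi_fourth : qi * qi * (qi * qi) = 1 :=
  (quat_of_conj (s₁_cube 3 le_rfl) s₁_conj_qi s₁_conj_qj).2.2

theorem s₂_eq : s₂ 3 le_rfl = qi⁻¹ * s₁ 3 le_rfl := by rw [qi]; group

/-- The generators have order dividing 3, so their inverses are squares and need no separate case.
-/
theorem Γ₃_induction {P : Γ 3 → Prop} (h1 : P 1) (hs : ∀ g, P g → P (s₁ 3 le_rfl * g))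
    (ht : ∀ g, P g → P (s₂ 3 le_rfl * g)) (g : Γ 3) : P g := by
  have hg : g ∈ Subgroup.closure (Set.range (PresentedGroup.of (rels := rels 3))) := by
    rw [PresentedGroup.closure_range_of]; trivial
  induction hg using Subgroup.closure_induction_left with
  | one => exact h1
  | mul_left x hx y _ hy =>
    obtain ⟨a, rfl⟩ := hx
    fin_cases a
    · exact hs _ hy
    · exact ht _ hy
  | inv_mul_cancel x hx y _ hy =>
    obtain ⟨a, rfl⟩ := hx
    fin_cases a
    · have : (s₁ 3 le_rfl)⁻¹ = s₁ 3 le_rfl * s₁ 3 le_rfl := by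
        rw [inv_eq_iff_mul_eq_one, ← s₁_cube 3 le_rfl, pow_succ, pow_two, mul_assoc]
      change P ((s₁ 3 le_rfl)⁻¹ * y)
      rw [this, mul_assoc]
      exact hs _ (hs _ hy)
    · have : (s₂ 3 le_rfl)⁻¹ = s₂ 3 le_rfl * s₂ 3 le_rfl := by
        rw [inv_eq_iff_mul_eq_one, ← s₂_cube 3 le_rfl, pow_succ, pow_two, mul_assoc]
      change P ((s₂ 3 le_rfl)⁻¹ * y)
      rw [this, mul_assoc]
      exact ht _ (ht _ hy)

/-- The generator of `C₃`. -/
def c₁ : C₃ := ⟨s₁ 3 le_rfl, Subgroup.mem_zpowers _⟩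

theorem c₁_cube : c₁ ^ 3 = 1 := Subtype.ext (s₁_cube 3 le_rfl)

/-- The retraction of `Γ 3` onto `C₃` which sends both generators to `s₁`. -/
def retr : Γ 3 →* C₃ :=
  PresentedGroup.toGroup (f := fun _ => c₁) (by
    rintro r ((⟨i, j, -, rfl⟩ | ⟨i, j, -, rfl⟩) | ⟨i, rfl⟩)
    · simp
    · simp
    · simp only [map_pow, FreeGroup.lift_apply_of, c₁_cube])

theorem retr_s₁ : retr (s₁ 3 le_rfl) = c₁ := PresentedGroup.toGroup.of _

theorem retr_s₂ : retr (s₂ 3 le_rfl) = c₁ := PresentedGroup.toGroup.of _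

theorem retr_coe (c : C₃) : retr c = c := by
  obtain ⟨_, n, rfl⟩ := c
  simp only [map_zpow, retr_s₁]
  rfl

theorem retr_qi : retr qi = 1 := by simp [qi, retr_s₁, retr_s₂]

theorem retr_qj : retr qj = 1 := by simp [qj, retr_s₁, retr_s₂]

theorem len_s₁ : len 3 (s₁ 3 le_rfl) = Multiplicative.ofAdd 1 := PresentedGroup.toGroup.of _

theorem len_s₂ : len 3 (s₂ 3 le_rfl) = Multiplicative.ofAdd 1 := PresentedGroup.toGroup.of _

theorem qi_mem : qi ∈ Q := by simp [qi, len_s₁, len_s₂]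

theorem qj_mem : qj ∈ Q := by simp [qj, len_s₁, len_s₂]

theorem len_retr (g : Γ 3) : len 3 (retr g) = len 3 g := by
  induction g using Γ₃_induction with
  | h1 => simp
  | hs g hg => rw [map_mul, map_mul, retr_s₁, Subgroup.coe_mul, map_mul, hg]; rfl
  | ht g hg => rw [map_mul, map_mul, retr_s₂, Subgroup.coe_mul, map_mul, hg, len_s₂, ← len_s₁]; rfl

/-- Thus `retr` has the same kernel as `len`, but with values in the subgroup C₃ itself, which
provides the splitting Γ₃ = Q ⋊ C₃. -/
theorem retr_eq_one_iff (g : Γ 3) : retr g = 1 ↔ g ∈ Q := by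
  rw [MonoidHom.mem_ker, ← len_retr]
  refine ⟨fun h => by rw [h]; simp, fun h => ?_⟩
  obtain ⟨n, hn⟩ := Subgroup.mem_zpowers_iff.1 (retr g).2
  rw [← hn, map_zpow, len_s₁, ← ofAdd_zsmul, ofAdd_eq_one, zsmul_one, ZMod.intCast_zmod_eq_zero_iff_dvd] at h
  obtain ⟨m, rfl⟩ := h
  apply Subtype.ext
  rw [← hn, zpow_mul]
  have := s₁_cube 3 le_rfl
  rw [← zpow_natCast] at this
  exact (congrArg (· ^ m) this).trans (one_zpow m)

theorem s₁_conj_mem_closure {x : Γ 3} (hx : x ∈ Subgroup.closure {qi, qj}) :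
    s₁ 3 le_rfl * x * (s₁ 3 le_rfl)⁻¹ ∈ Subgroup.closure {qi, qj} := by
  have hi : qi ∈ Subgroup.closure {qi, qj} := Subgroup.subset_closure (by simp)
  have hj : qj ∈ Subgroup.closure {qi, qj} := Subgroup.subset_closure (by simp)
  induction hx using Subgroup.closure_induction with
  | mem x hx =>
    rcases hx with rfl | rfl
    · rw [s₁_conj_qi]; exact mul_mem hi hj
    · rw [s₁_conj_qj]; exact inv_mem hi
  | one => simp
  | mul x y _ _ hx hy =>
    have : s₁ 3 le_rfl * (x * y) * (s₁ 3 le_rfl)⁻¹ = (s₁ 3 le_rfl * x * (s₁ 3 le_rfl)⁻¹) *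
      (s₁ 3 le_rfl * y * (s₁ 3 le_rfl)⁻¹) := by group
    rw [this]; exact mul_mem hx hy
  | inv x _ hx =>
    have : s₁ 3 le_rfl * x⁻¹ * (s₁ 3 le_rfl)⁻¹ = (s₁ 3 le_rfl * x * (s₁ 3 le_rfl)⁻¹)⁻¹ := by group
    rw [this]; exact inv_mem hx

theorem mul_retr_inv_mem_closure (g : Γ 3) :
    g * (retr g : Γ 3)⁻¹ ∈ Subgroup.closure {qi, qj} := by
  have hi : qi ∈ Subgroup.closure {qi, qj} := Subgroup.subset_closure (by simp)
  induction g using Γ₃_induction with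
  | h1 => simp
  | hs g hg =>
    rw [map_mul, retr_s₁]
    have := s₁_conj_mem_closure hg
    convert this using 1
    simp only [Subgroup.coe_mul, c₁, mul_inv_rev, mul_assoc]
  | ht g hg =>
    rw [map_mul, retr_s₂]
    have := mul_mem (inv_mem hi) (s₁_conj_mem_closure hg)
    convert this using 1
    simp only [Subgroup.coe_mul, c₁, mul_inv_rev, mul_assoc, s₂_eq]

theorem closure_eq : Subgroup.closure {qi, qj} = Q := by
  apply le_antisymm
  · rw [Subgroup.closure_le]
    rintro _ (rfl | rfl)
    · exact qi_mem
    · exact qj_mem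
  · intro g hg
    have := mul_retr_inv_mem_closure g
    rwa [(retr_eq_one_iff g).2 hg, Subgroup.coe_one, inv_one, mul_one] at this

/-- The generators `i`, `j` as elements of `Q`. -/
def Qi : Q := ⟨qi, qi_mem⟩

/-- The generators `i`, `j` as elements of `Q`. -/
def Qj : Q := ⟨qj, qj_mem⟩

theorem closure_Qi_Qj : Subgroup.closure {Qi, Qj} = ⊤ := by
  apply Subgroup.map_injective Q.subtype_injective
  rw [MonoidHom.map_closure, Set.image_pair, ← MonoidHom.range_eq_map, Subgroup.range_subtype,
    Subgroup.subtype_apply, Subgroup.subtype_apply]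
  exact closure_eq

theorem natCard_C₃ : Nat.card C₃ = 3 := by
  rw [Nat.card_zpowers]
  refine orderOf_eq_prime (s₁_cube 3 le_rfl) fun h => ?_
  have := congrArg (len 3) h
  rw [len_s₁, MonoidHom.map_one] at this
  exact absurd this (by decide)

/-- The image of `s₁` in `SL₂(𝔽₃)`. -/
def slS : Matrix.SpecialLinearGroup (Fin 2) (ZMod 3) := ⟨!![1, 1; 0, 1], by decide⟩

/-- The image of `s₂` in `SL₂(𝔽₃)`. -/
def slT : Matrix.SpecialLinearGroup (Fin 2) (ZMod 3) := ⟨!![1, 0; 2, 1], by decide⟩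

/-- The morphism from `Γ 3` to `SL₂(𝔽₃)`. -/
def toSL : Γ 3 →* Matrix.SpecialLinearGroup (Fin 2) (ZMod 3) :=
  PresentedGroup.toGroup (f := ![slS, slT]) (by
    rintro r ((⟨i, j, h, rfl⟩ | ⟨i, j, h, rfl⟩) | ⟨i, rfl⟩)
    · fin_cases i <;> fin_cases j <;> simp at h
      rw [map_mul, map_inv, mul_inv_eq_one]
      simp only [map_mul, FreeGroup.lift_apply_of]
      decide
    · fin_cases i <;> fin_cases j <;> simp at h
    · rw [map_pow, FreeGroup.lift_apply_of]
      fin_cases i <;> decide)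

theorem toSL_s₁ : toSL (s₁ 3 le_rfl) = slS := PresentedGroup.toGroup.of _

theorem toSL_s₂ : toSL (s₂ 3 le_rfl) = slT := PresentedGroup.toGroup.of _

/-! ### The group algebras of `Γ 3` and of `Q` -/

variable (k : Type*) [Field k]

/-- The element `1 - g` of a group algebra. -/
noncomputable def om {G : Type*} [Group G] (g : G) : MonoidAlgebra k G := 1 - MonoidAlgebra.of k G g

theorem coeff_mapDomain_of {G H : Type*} [Group G] [Group H] (f : G →* H) (g : G)
    [Decidable (f g = 1)] :
    (MonoidAlgebra.mapDomainRingHom k f (MonoidAlgebra.of k G g)).coeff 1 =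
      if f g = 1 then 1 else 0 := by
  classical
  rw [mapDomainRingHom_of, MonoidAlgebra.of_apply, MonoidAlgebra.coeff_single, Finsupp.single_apply]

/-- In SL₂(𝔽₃) the seven terms of q other than 1 have nontrivial images, so the image of q has
coefficient 1 at the identity. -/
theorem q_ne_zero : q k 3 le_rfl ≠ 0 := by
  intro h
  have h1 := congrArg (fun x => (MonoidAlgebra.mapDomainRingHom k toSL x).coeff 1) h
  simp only [q] at h1
  rw [RingHom.map_add, RingHom.map_add, RingHom.map_add, RingHom.map_add, RingHom.map_add,
    RingHom.map_add, RingHom.map_add] at h1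
  simp only [MonoidAlgebra.coeff_add, Finsupp.add_apply, coeff_mapDomain_of] at h1
  simp only [map_mul, map_pow, toSL_s₁, toSL_s₂, map_one, if_true] at h1
  rw [if_neg (by decide), if_neg (by decide), if_neg (by decide), if_neg (by decide),
    if_neg (by decide), if_neg (by decide), if_neg (by decide)] at h1
  simp at h1

variable [CharP k 2]

theorem two_eq_zero_monoidAlgebra (G : Type*) [Monoid G] : (2 : MonoidAlgebra k G) = 0 := by
  rw [← map_ofNat (algebraMap k (MonoidAlgebra k G)) 2, CharTwo.two_eq_zero, map_zero]

theorem quatRel_Γ₃ : QuatRel (om k qi) (om k qj) (om k (qi * qi)) :=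
  .of_units (two_eq_zero_monoidAlgebra k _) (by rw [map_mul]) (by rw [← map_mul, qi_mul_qi])
    (by rw [← map_mul, qj_mul_qi]; simp only [map_mul]) (by rw [← map_mul, qi_fourth, map_one])

theorem quatRel_Q : QuatRel (om k Qi) (om k Qj) (om k (Qi * Qi)) :=
  .of_units (two_eq_zero_monoidAlgebra k _) (by rw [map_mul])
    (by rw [← map_mul, show Qi * Qi = Qj * Qj from Subtype.ext qi_mul_qi])
    (by rw [← map_mul, show Qj * Qi = Qi * Qj * (Qi * Qi) from Subtype.ext qj_mul_qi]
        simp only [map_mul])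
    (by rw [← map_mul, show Qi * Qi * (Qi * Qi) = 1 from Subtype.ext qi_fourth, map_one])

theorem three_ne_zero_of_charTwo : (3 : k) ≠ 0 := by
  rw [show (3 : k) = 2 + 1 by norm_num, CharTwo.two_eq_zero, zero_add]
  exact one_ne_zero

theorem jacobson_Γ₃ :
    Ring.jacobson (MonoidAlgebra k (Γ 3)) = Ideal.span {om k qi, om k qj} := by
  have : Finite C₃ := Nat.finite_of_card_ne_zero (by rw [natCard_C₃]; norm_num)
  refine jacobson_eq_span k retr C₃.subtype retr_coe retr_qi retr_qj (fun g hg => ?_) ?_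
    (quatRel_Γ₃ k)
  · rw [closure_eq]; exact (retr_eq_one_iff g).1 hg
  · rw [natCard_C₃]; exact three_ne_zero_of_charTwo k

theorem jacobson_Q : Ring.jacobson (MonoidAlgebra k Q) = Ideal.span {om k Qi, om k Qj} := by
  -- The quotient is taken trivial here: i and j generate all of Q.
  refine jacobson_eq_span k (1 : Q →* Unit) 1 (fun _ => rfl) rfl rfl (fun g _ => ?_) ?_
    (quatRel_Q k)
  · rw [closure_Qi_Qj]; trivial
  · simp

theorem isTwoSided_Γ₃ : (Ideal.span {om k qi, om k qj}).IsTwoSided := by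
  rw [← jacobson_Γ₃]; infer_instance

theorem isTwoSided_Q : (Ideal.span {om k Qi, om k Qj}).IsTwoSided := by
  rw [← jacobson_Q]; infer_instance

theorem inv_eq_sq_of_cube {G : Type*} [Group G] {s : G} (h : s ^ 3 = 1) : s⁻¹ = s ^ 2 := by
  rw [inv_eq_iff_mul_eq_one, ← pow_succ', h]

theorem qi_inv : qi⁻¹ = qi * (qi * qi) := by
  rw [inv_eq_iff_mul_eq_one, ← mul_assoc, qi_fourth]

theorem qj_inv : qj⁻¹ = qj * (qi * qi) := by
  rw [inv_eq_iff_mul_eq_one, ← mul_assoc, ← qi_mul_qi, qi_fourth]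

theorem s₁_mul_s₂_mul_s₁ : s₁ 3 le_rfl * s₂ 3 le_rfl * s₁ 3 le_rfl = qi * qj * (qi * qi) := by
  have h : qj * qi = (s₁ 3 le_rfl)⁻¹ * (s₂ 3 le_rfl * s₁ 3 le_rfl * s₂ 3 le_rfl) *
      (s₂ 3 le_rfl ^ 2)⁻¹ := by
    simp only [qi, qj, pow_two, mul_inv_rev, mul_assoc, mul_inv_cancel_left]
  rw [← qj_mul_qi, h, ← braid₁₂, ← inv_eq_sq_of_cube (s₂_cube 3 le_rfl), inv_inv, braid₁₂,
    ← braid₁₂]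
  simp only [mul_assoc, inv_mul_cancel_left]
  simpa only [mul_assoc] using braid₁₂ 3 le_rfl

theorem sq_mul_sq_mul_sq : s₁ 3 le_rfl ^ 2 * s₂ 3 le_rfl ^ 2 * s₁ 3 le_rfl ^ 2 = qi * qj := by
  have h : qi * qj * (qj * qi) = 1 := by
    rw [mul_assoc, ← mul_assoc qj, ← qi_mul_qi, ← mul_assoc, ← mul_assoc, mul_assoc _ qi qi, qi_fourth]
  rw [← mul_eq_one_iff_eq_inv.1 h |>.symm, qj_mul_qi, ← s₁_mul_s₂_mul_s₁,
    ← inv_eq_sq_of_cube (s₁_cube 3 le_rfl), ← inv_eq_sq_of_cube (s₂_cube 3 le_rfl)]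
  group

/-- In characteristic 2 the product (1 - i)(1 - j)(1 - i²) is the sum of the elements 1, i, j, ij
and their multiples by i². The work is to match these with the eight words in s₁ and s₂. -/
theorem q_eq : q k 3 le_rfl = om k qi * (om k qj * om k (qi * qi)) := by
  have h1 : s₁ 3 le_rfl * s₂ 3 le_rfl ^ 2 = qi := by
    rw [← inv_eq_sq_of_cube (s₂_cube 3 le_rfl)]; rfl
  have h2 : s₂ 3 le_rfl * s₁ 3 le_rfl ^ 2 = qi * (qi * qi) := by
    rw [← inv_eq_sq_of_cube (s₁_cube 3 le_rfl), ← qi_inv, qi]; group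
  have h3 : s₁ 3 le_rfl ^ 2 * s₂ 3 le_rfl = qj := by
    rw [← inv_eq_sq_of_cube (s₁_cube 3 le_rfl)]; rfl
  have h4 : s₂ 3 le_rfl ^ 2 * s₁ 3 le_rfl = qj * (qi * qi) := by
    rw [← inv_eq_sq_of_cube (s₂_cube 3 le_rfl), ← qj_inv, qj]; group
  have h5 : qi * s₁ 3 le_rfl * s₂ 3 le_rfl ^ 2 = qi * qi := by rw [mul_assoc, h1]
  rw [om, om, om, expand_q (quatRel_Γ₃ k).neg_eq]
  simp only [q, h1, h2, h3, h4, h5, s₁_mul_s₂_mul_s₁, sq_mul_sq_mul_sq, map_one, ← map_mul]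

theorem b_eq : b k 3 le_rfl = om k qi * om k (qi * qi) + om k qj * om k (qi * qi) := by
  have h1 : s₁ 3 le_rfl * (s₂ 3 le_rfl)⁻¹ = qi := rfl
  have h2 : s₂ 3 le_rfl * (s₁ 3 le_rfl)⁻¹ = qi * (qi * qi) := by
    rw [← qi_inv, qi]; group
  have h3 : (s₁ 3 le_rfl)⁻¹ * s₂ 3 le_rfl = qj := rfl
  have h4 : (s₂ 3 le_rfl)⁻¹ * s₁ 3 le_rfl = qj * (qi * qi) := by
    rw [← qj_inv, qj]; group
  rw [om, om, om, expand_b (quatRel_Γ₃ k).neg_eq]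
  simp only [b, h1, h2, h3, h4, ← map_mul]

end CubicBraid

/-! ### The ideals generated by q and b in kΓ₃ -/

namespace CubicBraid

/-- Conjugation by s sends XZ to XZ + YZ and YZ to XZ modulo XYZ, hence b = XZ + YZ to YZ modulo
XYZ; the term X * b = XYZ is the exact correction. So the ideal generated by b contains YZ, then XZ.
-/
theorem QuatRel.conj_add_mul {R : Type*} [Ring R] {X Y Z S S' : R} (H : QuatRel X Y Z)
    (hS : S * S' = 1) (hX : S * X = (X + Y + X * Y) * S) (hY : S * Y = (X + Z + X * Z) * S)
    (hZ : S * Z = Z * S) :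
    X * (X * Z + Y * Z) + S * (X * Z + Y * Z) * S' = Y * Z := by
  have h1 : S * (X * Z) * S' = X * Z + Y * Z + X * (Y * Z) := by
    rw [← mul_assoc, hX, mul_assoc _ S, hZ, ← mul_assoc, mul_assoc _ S, hS]
    simp only [add_mul, mul_one, mul_assoc]
  have h2 : S * (Y * Z) * S' = X * Z := by
    rw [← mul_assoc, hY, mul_assoc _ S, hZ, ← mul_assoc, mul_assoc _ S, hS]
    simp only [add_mul, mul_one, mul_assoc, H.zz, mul_zero, add_zero]
  rw [mul_add S, add_mul _ _ S', h1, h2, mul_add, H.xx', H.zz, zero_add,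
    show X * (Y * Z) + (X * Z + Y * Z + X * (Y * Z) + X * Z) =
      (X * (Y * Z) + X * (Y * Z)) + (X * Z + X * Z) + Y * Z by abel,
    H.add_self, H.add_self, add_zero, zero_add]

section Part1

variable (k : Type*) [Field k]

theorem s₁_mul_om_qi : MonoidAlgebra.of k _ (s₁ 3 le_rfl) * om k qi =
    om k (qi * qj) * MonoidAlgebra.of k _ (s₁ 3 le_rfl) := by
  rw [om, om, mul_sub, sub_mul, ← map_mul, ← map_mul, ← s₁_conj_qi, inv_mul_cancel_right, mul_one,
    one_mul]

theorem s₁_mul_om_qj : MonoidAlgebra.of k _ (s₁ 3 le_rfl) * om k qj =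
    om k qi⁻¹ * MonoidAlgebra.of k _ (s₁ 3 le_rfl) := by
  rw [om, om, mul_sub, sub_mul, ← map_mul, ← map_mul, ← s₁_conj_qj, inv_mul_cancel_right, mul_one,
    one_mul]

theorem s₁_mul_Z : MonoidAlgebra.of k _ (s₁ 3 le_rfl) * om k (qi * qi) =
    om k (qi * qi) * MonoidAlgebra.of k _ (s₁ 3 le_rfl) := by
  have h : s₁ 3 le_rfl * (qi * qi) = qi * qi * s₁ 3 le_rfl := by
    have h1 : s₁ 3 le_rfl * (qj * qj) * (s₁ 3 le_rfl)⁻¹ = (qi * qi)⁻¹ := by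
      have : s₁ 3 le_rfl * (qj * qj) * (s₁ 3 le_rfl)⁻¹ =
        (s₁ 3 le_rfl * qj * (s₁ 3 le_rfl)⁻¹) * (s₁ 3 le_rfl * qj * (s₁ 3 le_rfl)⁻¹) := by group
      rw [this, s₁_conj_qj]; group
    rw [← qi_mul_qi, mul_inv_eq_iff_eq_mul, ← mul_eq_one_iff_eq_inv.1 qi_fourth] at h1
    exact h1
  rw [om, mul_sub, sub_mul, ← map_mul, ← map_mul, h, mul_one, one_mul]

variable [CharP k 2]

theorem om_mul {G : Type*} [Group G] (g h : G) :
    om k (g * h) = om k g + om k h + om k g * om k h := by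
  have h2 : ∀ r : MonoidAlgebra k G, -r = r := fun r => by
    rw [neg_eq_iff_add_eq_zero, ← two_mul, two_eq_zero_monoidAlgebra, zero_mul]
  have : om k (g * h) = om k g + om k h + -(om k g * om k h) := by
    simp only [om, map_mul]; noncomm_ring
  rw [this, h2]

theorem s₁_mul_X : MonoidAlgebra.of k _ (s₁ 3 le_rfl) * om k qi =
    (om k qi + om k qj + om k qi * om k qj) * MonoidAlgebra.of k _ (s₁ 3 le_rfl) := by
  rw [s₁_mul_om_qi, om_mul]

theorem s₁_mul_Y : MonoidAlgebra.of k _ (s₁ 3 le_rfl) * om k qj =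
    (om k qi + om k (qi * qi) + om k qi * om k (qi * qi)) *
      MonoidAlgebra.of k _ (s₁ 3 le_rfl) := by
  rw [s₁_mul_om_qj, qi_inv, om_mul]

theorem J_Γ₃_pow_three : J (MonoidAlgebra k (Γ 3)) 3 =
    Ideal.span {om k qi * om k (qi * qi), om k qj * om k (qi * qi)} := by
  rw [J, jacobson_Γ₃, (quatRel_Γ₃ k).span_cube (isTwoSided_Γ₃ k)]

theorem J_Γ₃_pow_four : J (MonoidAlgebra k (Γ 3)) 4 = Ideal.span {q k 3 le_rfl} := by
  rw [J, jacobson_Γ₃, (quatRel_Γ₃ k).span_fourth (isTwoSided_Γ₃ k), q_eq]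

theorem gen_le {A : Type*} [Ring A] {x : A} {I : Ideal A} [I.IsTwoSided] :
    gen x ≤ I ↔ x ∈ I := by
  constructor
  · exact fun h => h (TwoSidedIdeal.subset_span rfl)
  · intro h
    have : TwoSidedIdeal.span {x} ≤ I.toTwoSided := by
      rw [TwoSidedIdeal.span_le]
      rintro _ rfl
      exact Ideal.mem_toTwoSided.2 h
    exact fun y hy => Ideal.mem_toTwoSided.1 (this hy)

theorem mem_gen {A : Type*} [Ring A] (x : A) : x ∈ gen x := TwoSidedIdeal.subset_span rfl

theorem J_Γ₃_four_eq : J (MonoidAlgebra k (Γ 3)) 4 = gen (q k 3 le_rfl) := by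
  apply le_antisymm
  · rw [J_Γ₃_pow_four, Ideal.span_le]
    rintro _ rfl
    exact mem_gen _
  · rw [gen_le, J_Γ₃_pow_four]
    exact Ideal.subset_span rfl

theorem J_Γ₃_three_eq : gen (b k 3 le_rfl) = J (MonoidAlgebra k (Γ 3)) 3 := by
  have H := quatRel_Γ₃ k
  apply le_antisymm
  · rw [gen_le, J_Γ₃_pow_three, b_eq]
    exact add_mem (Ideal.subset_span (by simp)) (Ideal.subset_span (by simp))
  · have hb := mem_gen (b k 3 le_rfl)
    have h1 := Ideal.mul_mem_left _ (om k qi) hb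
    have hs : MonoidAlgebra.of k _ (s₁ 3 le_rfl) * MonoidAlgebra.of k _ (s₁ 3 le_rfl)⁻¹ = 1 := by
      rw [← map_mul, mul_inv_cancel, map_one]
    have h2 := Ideal.mul_mem_right (MonoidAlgebra.of k _ (s₁ 3 le_rfl)⁻¹) _
      (Ideal.mul_mem_left _ (MonoidAlgebra.of k _ (s₁ 3 le_rfl)) hb)
    have h3 : om k qj * om k (qi * qi) ∈ gen (b k 3 le_rfl) := by
      convert add_mem h1 h2 using 1
      rw [b_eq, H.conj_add_mul hs (s₁_mul_X k) (s₁_mul_Y k) (s₁_mul_Z k)]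
    rw [J_Γ₃_pow_three, Ideal.span_le]
    rintro _ (rfl | rfl)
    · have := sub_mem hb h3
      rw [b_eq, add_sub_cancel_right, ← b_eq] at this
      exact this
    · exact h3

/-- If b were in J⁴, then X * b would lie in J⁵ = 0, whereas X * b = XYZ = q is nonzero. -/
theorem gen_q_lt : gen (q k 3 le_rfl) < gen (b k 3 le_rfl) := by
  have H := quatRel_Γ₃ k
  refine lt_of_le_of_ne ?_ fun h => ?_
  · rw [← J_Γ₃_four_eq, J_Γ₃_three_eq]
    exact (Submodule.pow_succ' _ three_ne_zero).trans_le Ideal.mul_le_right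
  · have hb := mem_gen (b k 3 le_rfl)
    rw [← h, ← J_Γ₃_four_eq] at hb
    have h5 := Ideal.mul_mem_mul (I := Ring.jacobson (MonoidAlgebra k (Γ 3))) (J := J (MonoidAlgebra k (Γ 3)) 4) (by rw [jacobson_Γ₃]; exact QuatRel.X_mem) hb
    rw [← Submodule.pow_succ' _ four_ne_zero, jacobson_Γ₃, H.span_fifth (isTwoSided_Γ₃ k), b_eq,
      mul_add, H.xx', H.zz, zero_add, ← q_eq] at h5
    exact q_ne_zero k h5

end Part1
end CubicBraid

/-! ### The quotient of kΓ₃ as a skew group algebra -/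

namespace CubicBraid

section SkewProduct

variable (k : Type*) [Field k]

/-- The inclusion of `kQ` in `kΓ₃`. -/
noncomputable abbrev incl : MonoidAlgebra k Q →+* MonoidAlgebra k (Γ 3) :=
  MonoidAlgebra.mapDomainRingHom k Q.subtype

theorem incl_of (x : Q) : incl k (MonoidAlgebra.of k Q x) = MonoidAlgebra.of k (Γ 3) x :=
  mapDomainRingHom_of k Q.subtype x

theorem incl_smul (a : k) (x : MonoidAlgebra k Q) : incl k (a • x) = a • incl k x :=
  MonoidAlgebra.mapDomain_smul _ _ _

theorem incl_om (x : Q) : incl k (om k x) = om k (x : Γ 3) := by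
  rw [om, om, map_sub, map_one, incl_of]

theorem mul_retr_inv_mem (g : Γ 3) : g * (retr g : Γ 3)⁻¹ ∈ Q := by
  rw [← closure_eq]; exact mul_retr_inv_mem_closure g

theorem smul_mk_of (c : C₃) (x : Q) :
    c • (Ideal.Quotient.mk (J (MonoidAlgebra k Q) 4) (MonoidAlgebra.of k Q x)) =
      Ideal.Quotient.mk _ (MonoidAlgebra.of k Q (MulAut.conjNormal (c : Γ 3) x)) := by
  change Ideal.Quotient.mk _ (conjAut k c (MonoidAlgebra.of k Q x)) = _
  congr 1
  exact MonoidAlgebra.domCongr_single _ _ _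

/-- The morphism of `Γ 3` to the group of units of the skew group algebra. -/
noncomputable def toSkewHom : Γ 3 →* SkewMonoidAlgebra (kQJ4 k) C₃ where
  toFun g := SkewMonoidAlgebra.single (retr g)
    (Ideal.Quotient.mk _ (MonoidAlgebra.of k Q ⟨_, mul_retr_inv_mem g⟩))
  map_one' := by
    refine congrArg₂ SkewMonoidAlgebra.single (map_one retr) ?_
    rw [show (⟨_, mul_retr_inv_mem 1⟩ : Q) = 1 from Subtype.ext (by simp), map_one, map_one]
  map_mul' g h := by
    rw [SkewMonoidAlgebra.single_mul_single, smul_mk_of]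
    refine congrArg₂ SkewMonoidAlgebra.single (map_mul retr g h) ?_
    rw [← map_mul (Ideal.Quotient.mk _), ← map_mul (MonoidAlgebra.of k Q)]
    congr 2
    apply Subtype.ext
    simp [mul_assoc]

/-- The algebra morphism from `kΓ₃` to the skew group algebra. -/
noncomputable def toSkew : MonoidAlgebra k (Γ 3) →ₐ[k] SkewMonoidAlgebra (kQJ4 k) C₃ :=
  MonoidAlgebra.lift k _ _ (toSkewHom k)

theorem toSkew_of_mul_of (x : Q) (c : C₃) :
    toSkew k (MonoidAlgebra.of k _ (x : Γ 3) * MonoidAlgebra.of k _ (c : Γ 3)) =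
      SkewMonoidAlgebra.single c (Ideal.Quotient.mk _ (MonoidAlgebra.of k Q x)) := by
  have hx : retr x = 1 := (retr_eq_one_iff _).2 x.2
  rw [← map_mul, toSkew, MonoidAlgebra.lift_of]
  change SkewMonoidAlgebra.single (retr _) _ = _
  have h : retr (x * c) = c := by rw [map_mul, hx, retr_coe, one_mul]
  refine congrArg₂ SkewMonoidAlgebra.single h ?_
  congr 2
  apply Subtype.ext
  simp [hx, retr_coe]

theorem toSkew_incl_mul_of (x : MonoidAlgebra k Q) (c : C₃) :
    toSkew k (incl k x * MonoidAlgebra.of k _ (c : Γ 3)) =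
      SkewMonoidAlgebra.single c (Ideal.Quotient.mk _ x) := by
  induction x using MonoidAlgebra.induction_linear with
  | zero => simp
  | add x y hx hy =>
    rw [map_add, add_mul, map_add, hx, hy, map_add, SkewMonoidAlgebra.single_add]
  | single x a =>
    rw [← MonoidAlgebra.smul_of, incl_smul, smul_mul_assoc, map_smul, incl_of, toSkew_of_mul_of,
      SkewMonoidAlgebra.smul_single]
    rfl

theorem toSkew_surjective : Function.Surjective (toSkew k) := by
  intro y
  induction y using SkewMonoidAlgebra.induction_on with
  | zero => exact ⟨0, map_zero _⟩
  | single c a =>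
    obtain ⟨x, rfl⟩ := Ideal.Quotient.mk_surjective a
    exact ⟨_, toSkew_incl_mul_of k x c⟩
  | add x y hx hy =>
    obtain ⟨x, rfl⟩ := hx
    obtain ⟨y, rfl⟩ := hy
    exact ⟨x + y, map_add _ _ _⟩

theorem eq_mul_retr (g : Γ 3) : ∃ (x : Q) (c : C₃), g = x * c :=
  ⟨⟨_, mul_retr_inv_mem g⟩, retr g, by simp⟩

instance : Finite C₃ := Nat.finite_of_card_ne_zero (by rw [natCard_C₃]; norm_num)

theorem exists_eq_sum [Fintype C₃] (x : MonoidAlgebra k (Γ 3)) : ∃ a : C₃ → MonoidAlgebra k Q,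
    x = ∑ c, incl k (a c) * MonoidAlgebra.of k _ (c : Γ 3) := by
  classical
  induction x using MonoidAlgebra.induction_linear with
  | zero => exact ⟨0, by simp⟩
  | add x y hx hy =>
    obtain ⟨a, rfl⟩ := hx
    obtain ⟨a', rfl⟩ := hy
    exact ⟨a + a', by simp only [Pi.add_apply, map_add, add_mul, Finset.sum_add_distrib]⟩
  | single g r =>
    obtain ⟨x, c, rfl⟩ := eq_mul_retr g
    refine ⟨Pi.single c (r • MonoidAlgebra.of k Q x), ?_⟩
    rw [Finset.sum_eq_single c]
    · rw [Pi.single_eq_same, incl_smul, incl_of, smul_mul_assoc, ← map_mul,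
        MonoidAlgebra.of_apply, MonoidAlgebra.smul_single, smul_eq_mul, mul_one]
    · intro d _ hd
      rw [Pi.single_eq_of_ne hd, map_zero, zero_mul]
    · simp

variable [CharP k 2]

theorem J_Q_pow_four : J (MonoidAlgebra k Q) 4 =
    Ideal.span {om k Qi * (om k Qj * om k (Qi * Qi))} := by
  rw [J, jacobson_Q, (quatRel_Q k).span_fourth (isTwoSided_Q k)]

theorem incl_q : incl k (om k Qi * (om k Qj * om k (Qi * Qi))) = q k 3 le_rfl := by
  rw [map_mul, map_mul, incl_om, incl_om, incl_om, q_eq]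
  rfl

/-- Written as a sum of a_c · c with a_c in kQ, an element is sent to the family of classes of the
a_c. It is killed exactly when each a_c lies in J(kQ)⁴, which is generated by the element that
becomes q in kΓ₃. -/
theorem ker_toSkew : RingHom.ker (toSkew k) = J (MonoidAlgebra k (Γ 3)) 4 := by
  have := Fintype.ofFinite C₃
  rw [J_Γ₃_four_eq]
  apply le_antisymm
  · intro x hx
    obtain ⟨a, rfl⟩ := exists_eq_sum k x
    rw [RingHom.mem_ker, map_sum] at hx
    simp only [toSkew_incl_mul_of] at hx
    refine sum_mem fun c _ => Ideal.mul_mem_right _ _ ?_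
    have hc : Ideal.Quotient.mk (J (MonoidAlgebra k Q) 4) (a c) = 0 := by
      classical
      have := congrArg (fun y => SkewMonoidAlgebra.coeffAddEquiv y c) hx
      simpa [Finsupp.single_apply] using this
    rw [Ideal.Quotient.eq_zero_iff_mem, J_Q_pow_four, Ideal.mem_span_singleton'] at hc
    obtain ⟨y, hy⟩ := hc
    rw [← hy, map_mul, incl_q]
    exact Ideal.mul_mem_left _ _ (mem_gen _)
  · rw [gen_le, RingHom.mem_ker, ← incl_q, ← mul_one (incl k _)]
    have := toSkew_incl_mul_of k (om k Qi * (om k Qj * om k (Qi * Qi))) 1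
    rw [Subgroup.coe_one, map_one] at this
    rw [this, Ideal.Quotient.eq_zero_iff_mem.2, SkewMonoidAlgebra.single_zero]
    rw [J_Q_pow_four]
    exact Ideal.subset_span rfl

theorem nonempty_equiv_skew :
    Nonempty ((MonoidAlgebra k (Γ 3) ⧸ J (MonoidAlgebra k (Γ 3)) 4) ≃ₐ[k]
      SkewMonoidAlgebra (kQJ4 k) C₃) :=
  ⟨(Ideal.quotientEquivAlgOfEq k (ker_toSkew k).symm).trans
    (Ideal.quotientKerAlgEquivOfSurjective (toSkew_surjective k))⟩

end SkewProduct
end CubicBraid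

namespace CubicBraid

/-! ### The group `Γ 4` -/

section Group

variable {G : Type*} [Group G] {s t u a b : G}

theorem conj_mul_conj (s x y : G) : s * (x * y) * s⁻¹ = (s * x * s⁻¹) * (s * y * s⁻¹) := by group

theorem conj_commutator_gen (h : s * t * s = t * s * t) (h' : t * u * t = u * t * u) :
    s * (t * (s * u⁻¹) * t⁻¹) * s⁻¹ = t * (s * u⁻¹) * t⁻¹ * (s * u⁻¹)⁻¹ := by
  have e1 : s * (t * (s * u⁻¹) * t⁻¹) * s⁻¹ = (s * t * s) * (u⁻¹ * t⁻¹) * s⁻¹ := by group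
  have e2 : t * u⁻¹ * t⁻¹ = u⁻¹ * t⁻¹ * u := by
    rw [← mul_inv_eq_one]
    have : t * u⁻¹ * t⁻¹ * (u⁻¹ * t⁻¹ * u)⁻¹ = t * u⁻¹ * t⁻¹ * u⁻¹ * (t * u * t) * t⁻¹ := by group
    rw [this, h']; group
  rw [e1, h]
  calc t * s * t * (u⁻¹ * t⁻¹) * s⁻¹ = t * s * (t * u⁻¹ * t⁻¹) * s⁻¹ := by group
    _ = _ := by rw [e2]; group

/-- Letting both sides of sts = tst act on a by conjugation determines t b t⁻¹. -/
theorem conj_b_of_braid (h : s * t * s = t * s * t) (hsa : s * a * s⁻¹ = a) (hta : t * a * t⁻¹ = b)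
    (hsb : s * b * s⁻¹ = b * a⁻¹) : t * b * t⁻¹ = b * a⁻¹ * b := by
  have e : (s * t * s) * a * (s * t * s)⁻¹ = (t * s * t) * a * (t * s * t)⁻¹ := by rw [h]
  have e1 : (s * t * s) * a * (s * t * s)⁻¹ = s * (t * (s * a * s⁻¹) * t⁻¹) * s⁻¹ := by group
  have e2 : (t * s * t) * a * (t * s * t)⁻¹ = t * (s * (t * a * t⁻¹) * s⁻¹) * t⁻¹ := by group
  have e3 : t * (b * a⁻¹) * t⁻¹ = (t * b * t⁻¹) * (t * a * t⁻¹)⁻¹ := by group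
  rw [e1, e2, hsa, hta, hsb, e3, hta] at e
  rw [e]; group

/-- A two-generator group of exponent 3 is nilpotent of class at most 2; the four cubes listed
suffice for this half of the statement. -/
theorem commute_commutator (ha : a ^ 3 = 1) (hb : b ^ 3 = 1) (hab : (a * b) ^ 3 = 1)
    (hab' : (a * b⁻¹) ^ 3 = 1) : Commute (a * b * a⁻¹ * b⁻¹) a := by
  have ha' : a * a = a⁻¹ := by rw [inv_eq_sq_of_cube ha, pow_two]
  have hb' : b * b = b⁻¹ := by rw [inv_eq_sq_of_cube hb, pow_two]
  have h1 : a⁻¹ * b⁻¹ = b * a * b * a := by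
    have := inv_eq_sq_of_cube hab
    have e : a⁻¹ * b⁻¹ = (b * a)⁻¹ := by group
    have : (b * a) ^ 3 = 1 := by
      have : (b * a) = b * (a * b) * b⁻¹ := by group
      rw [this, conj_pow, hab]; group
    rw [e, inv_eq_sq_of_cube this, pow_two]; group
  have h2 : a⁻¹ * b⁻¹ * a⁻¹ = b * a * b := by rw [h1]; group
  have h3 : b * a⁻¹ = a * b⁻¹ * a * b⁻¹ := by
    have := inv_eq_sq_of_cube hab'
    rw [mul_inv_rev, inv_inv, pow_two] at this
    rw [this]; group
  have h4 : b⁻¹ * a * b⁻¹ = a⁻¹ * b * a⁻¹ := by rw [mul_assoc a⁻¹, h3]; group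
  have e1 : b * a⁻¹ * b⁻¹ * a = a⁻¹ * b⁻¹ * a * b := by
    calc b * a⁻¹ * b⁻¹ * a = b * (a⁻¹ * b⁻¹) * a := by group
      _ = (b * b) * a * b * (a * a) := by rw [h1]; group
      _ = (b⁻¹ * a * b⁻¹) * (b * b) * a⁻¹ := by conv_lhs => rw [hb', ha']
                                                group
      _ = a⁻¹ * b * (a⁻¹ * b⁻¹ * a⁻¹) := by rw [h4, hb']; group
      _ = a⁻¹ * (b * b) * a * b := by rw [h2]; group
      _ = _ := by rw [hb']
  have e2 : a * b * a⁻¹ * b⁻¹ = a⁻¹ * b⁻¹ * a * b := by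
    calc a * b * a⁻¹ * b⁻¹ = a * (b * a⁻¹) * b⁻¹ := by group
      _ = (a * a) * b⁻¹ * a * (b * b)⁻¹ := by rw [h3]; group
      _ = _ := by rw [ha', hb', inv_inv]
  change a * b * a⁻¹ * b⁻¹ * a = a * (a * b * a⁻¹ * b⁻¹)
  calc a * b * a⁻¹ * b⁻¹ * a = a * (b * a⁻¹ * b⁻¹ * a) := by group
    _ = _ := by rw [e1, e2]

end Group

/-- The generator `s₃` of `Γ 4`. -/
def s₃ : Γ 4 := PresentedGroup.of ⟨2, by norm_num⟩

theorem three_le_four : 3 ≤ 4 := by norm_num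

/-- The generator `s₁` of `Γ 4`. -/
abbrev gs : Γ 4 := s₁ 4 three_le_four

/-- The generator `s₂` of `Γ 4`. -/
abbrev gt : Γ 4 := s₂ 4 three_le_four

theorem s₃_cube : s₃ ^ 3 = 1 :=
  PresentedGroup.one_of_mem (rels := rels 4) (Or.inr ⟨_, rfl⟩)

theorem braid₂₃ : gt * s₃ * gt = s₃ * gt * s₃ :=
  PresentedGroup.mk_eq_mk_of_mul_inv_mem (rels := rels 4) (Or.inl (Or.inl ⟨_, _, rfl, rfl⟩))

theorem s₁_mul_s₃ : gs * s₃ = s₃ * gs :=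
  PresentedGroup.mk_eq_mk_of_mul_inv_mem (rels := rels 4) (Or.inl (Or.inr ⟨_, _, by simp, rfl⟩))

/-- The element `s₁ s₃⁻¹` of `Γ 4`. -/
def ea : Γ 4 := gs * s₃⁻¹

/-- The element `s₂ s₁ s₃⁻¹ s₂⁻¹` of `Γ 4`. -/
def eb : Γ 4 := gt * ea * gt⁻¹

/-- The commutator of `ea` and `eb`, a central element of `Γ 4`. -/
def ez : Γ 4 := ea * eb * ea⁻¹ * eb⁻¹

theorem conj_s_a : gs * ea * gs⁻¹ = ea := by
  rw [ea, mul_inv_eq_iff_eq_mul, mul_assoc gs s₃⁻¹, mul_right_inj, eq_inv_mul_iff_mul_eq,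
    ← mul_assoc, ← s₁_mul_s₃, mul_inv_cancel_right]

theorem conj_t_a : gt * ea * gt⁻¹ = eb := rfl

theorem conj_s_b : gs * eb * gs⁻¹ = eb * ea⁻¹ :=
  conj_commutator_gen (braid₁₂ 4 three_le_four) braid₂₃

theorem conj_t_b : gt * eb * gt⁻¹ = eb * ea⁻¹ * eb :=
  conj_b_of_braid (braid₁₂ 4 three_le_four) conj_s_a conj_t_a conj_s_b

theorem ea_cube : ea ^ 3 = 1 := by
  have h : Commute gs s₃⁻¹ := (show Commute gs s₃ from s₁_mul_s₃).inv_right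
  rw [ea, h.mul_pow, inv_pow, s₃_cube, s₁_cube, inv_one, mul_one]

theorem eb_cube : eb ^ 3 = 1 := by rw [eb, conj_pow, ea_cube, mul_one, mul_inv_cancel]

/-- The inverse of `ea * eb` is conjugate to `eb * ea⁻¹ * eb`, which is itself a conjugate of `eb`.
-/
theorem ea_mul_eb_cube : (ea * eb) ^ 3 = 1 := by
  have h : (eb * ea⁻¹ * eb) ^ 3 = 1 := by
    rw [← conj_t_b, conj_pow, eb_cube, mul_one, mul_inv_cancel]
  have h' : eb * (eb * ea⁻¹ * eb) * eb⁻¹ = (ea * eb)⁻¹ := by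
    calc eb * (eb * ea⁻¹ * eb) * eb⁻¹ = (eb * eb) * ea⁻¹ := by group
      _ = _ := by rw [← pow_two, ← inv_eq_sq_of_cube eb_cube, mul_inv_rev]
  have := congrArg (fun x => eb * x * eb⁻¹) h
  simp only [← conj_pow, h', mul_one, mul_inv_cancel] at this
  rwa [inv_pow, inv_eq_one] at this

/-- This is the relation s₂³ = 1 applied to `ea` by conjugation. -/
theorem ea_mul_eb_inv_cube : (ea * eb⁻¹) ^ 3 = 1 := by
  have h := conj_conj_conj (s₂_cube 4 three_le_four) ea
  rw [conj_t_a, conj_t_b, conj_mul_conj, conj_mul_conj, conj_t_b,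
    show gt * ea⁻¹ * gt⁻¹ = (gt * ea * gt⁻¹)⁻¹ by group, conj_t_a] at h
  have h' : (ea * eb⁻¹)⁻¹ ^ 3 = 1 := by
    calc (ea * eb⁻¹)⁻¹ ^ 3 = eb * ea⁻¹ * eb * eb⁻¹ * (eb * ea⁻¹ * eb) * ea⁻¹ := by
          simp only [pow_succ, pow_zero]; group
      _ = 1 := by rw [h, mul_inv_cancel]
  rwa [inv_pow, inv_eq_one] at h'

theorem ez_comm_a : Commute ez ea :=
  commute_commutator ea_cube eb_cube ea_mul_eb_cube ea_mul_eb_inv_cube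

theorem ez_comm_b : Commute ez eb := by
  have h : Commute (eb * ea * eb⁻¹ * ea⁻¹) eb := by
    refine commute_commutator eb_cube ea_cube ?_ ?_
    · have : eb * ea = eb * (ea * eb) * eb⁻¹ := by group
      rw [this, conj_pow, ea_mul_eb_cube, mul_one, mul_inv_cancel]
    · have : eb * ea⁻¹ = (ea * eb⁻¹)⁻¹ := by group
      rw [this, inv_pow, ea_mul_eb_inv_cube, inv_one]
  have e : ez = (eb * ea * eb⁻¹ * ea⁻¹)⁻¹ := by rw [ez]; group
  rw [e]
  exact h.inv_left

theorem ez_comm_s : Commute ez gs := by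
  have : gs * ez * gs⁻¹ = ez := by
    have : gs * ez * gs⁻¹ = (gs * ea * gs⁻¹) * (gs * eb * gs⁻¹) * (gs * ea * gs⁻¹)⁻¹ *
      (gs * eb * gs⁻¹)⁻¹ := by rw [ez]; group
    rw [this, conj_s_a, conj_s_b, ez]; group
  exact (mul_inv_eq_iff_eq_mul.1 this).symm

theorem ez_comm_t : Commute ez gt := by
  have : gt * ez * gt⁻¹ = ez := by
    have : gt * ez * gt⁻¹ = (gt * ea * gt⁻¹) * (gt * eb * gt⁻¹) * (gt * ea * gt⁻¹)⁻¹ *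
      (gt * eb * gt⁻¹)⁻¹ := by rw [ez]; group
    rw [this, conj_t_a, conj_t_b]
    have e : eb * (eb * ea⁻¹ * eb) * eb⁻¹ * (eb * ea⁻¹ * eb)⁻¹ = eb * (ea⁻¹ * ez * ea) * eb⁻¹ := by
      rw [ez]; group
    rw [e, mul_assoc ea⁻¹, ez_comm_a.eq, inv_mul_cancel_left, ← ez_comm_b.eq, mul_inv_cancel_right]
  exact (mul_inv_eq_iff_eq_mul.1 this).symm

theorem s₃_eq : s₃ = ea⁻¹ * gs := by
  rw [ea, mul_inv_rev, inv_inv, inv_mul_cancel_right]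

/-- The product `ez * eb` is the conjugate of `eb` by `ea`, so its cube is 1; as `ez` commutes with
`eb`, the cube of `ez` is 1 as well. -/
theorem ez_cube : ez ^ 3 = 1 := by
  have h : ez * eb = ea * eb * ea⁻¹ := by rw [ez]; group
  have h' : (ez * eb) ^ 3 = 1 := by rw [h, conj_pow, eb_cube, mul_one, mul_inv_cancel]
  rwa [ez_comm_b.mul_pow, eb_cube, mul_one] at h'

theorem Γ₄_induction {P : Γ 4 → Prop} (h1 : P 1) (hs : ∀ g, P g → P (gs * g))
    (ht : ∀ g, P g → P (gt * g)) (hu : ∀ g, P g → P (s₃ * g)) (g : Γ 4) : P g := by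
  have hg : g ∈ Subgroup.closure (Set.range (PresentedGroup.of (rels := rels 4))) := by
    rw [PresentedGroup.closure_range_of]; trivial
  induction hg using Subgroup.closure_induction_left with
  | one => exact h1
  | mul_left x hx y _ hy =>
    obtain ⟨a, rfl⟩ := hx
    fin_cases a
    · exact hs _ hy
    · exact ht _ hy
    · exact hu _ hy
  | inv_mul_cancel x hx y _ hy =>
    obtain ⟨a, rfl⟩ := hx
    fin_cases a
    · change P (gs⁻¹ * y)
      rw [inv_eq_sq_of_cube (s₁_cube 4 _), pow_two, mul_assoc]
      exact hs _ (hs _ hy)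
    · change P (gt⁻¹ * y)
      rw [inv_eq_sq_of_cube (s₂_cube 4 _), pow_two, mul_assoc]
      exact ht _ (ht _ hy)
    · change P (s₃⁻¹ * y)
      rw [inv_eq_sq_of_cube s₃_cube, pow_two, mul_assoc]
      exact hu _ (hu _ hy)

theorem ez_comm (g : Γ 4) : Commute ez g := by
  induction g using Γ₄_induction with
  | h1 => exact Commute.one_right _
  | hs g hg => exact ez_comm_s.mul_right hg
  | ht g hg => exact ez_comm_t.mul_right hg
  | hu g hg =>
    rw [s₃_eq]
    exact (ez_comm_a.inv_right.mul_right ez_comm_s).mul_right hg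

/-- The morphism `Γ 3 → Γ 4` which maps `s₁` to `s₁` and `s₂` to `s₂`. -/
def inj₃₄ : Γ 3 →* Γ 4 :=
  PresentedGroup.toGroup (f := ![gs, gt]) (by
    rintro r ((⟨i, j, h, rfl⟩ | ⟨i, j, h, rfl⟩) | ⟨i, rfl⟩)
    · fin_cases i <;> fin_cases j <;> simp at h
      rw [map_mul, map_inv, mul_inv_eq_one]
      simp only [map_mul, FreeGroup.lift_apply_of]
      exact braid₁₂ 4 three_le_four
    · fin_cases i <;> fin_cases j <;> simp at h
    · rw [map_pow, FreeGroup.lift_apply_of]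
      fin_cases i
      · exact s₁_cube 4 three_le_four
      · exact s₂_cube 4 three_le_four)

theorem inj₃₄_s₁ : inj₃₄ (s₁ 3 le_rfl) = gs := PresentedGroup.toGroup.of _

theorem inj₃₄_s₂ : inj₃₄ (s₂ 3 le_rfl) = gt := PresentedGroup.toGroup.of _

/-- A morphism from `Γ 4` is given by the images of the generators. -/
def liftΓ₄ {G : Type*} [Group G] (x y w : G) (hxy : x * y * x = y * x * y)
    (hyw : y * w * y = w * y * w) (hxw : x * w = w * x) (hx : x ^ 3 = 1) (hy : y ^ 3 = 1)
    (hw : w ^ 3 = 1) : Γ 4 →* G :=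
  PresentedGroup.toGroup (f := ![x, y, w]) (by
    rintro r ((⟨i, j, h, rfl⟩ | ⟨i, j, h, rfl⟩) | ⟨i, rfl⟩)
    · rw [map_mul, map_inv, mul_inv_eq_one]
      simp only [map_mul, FreeGroup.lift_apply_of]
      fin_cases i <;> fin_cases j <;> simp at h
      · exact hxy
      · exact hyw
    · rw [map_mul, map_inv, mul_inv_eq_one]
      simp only [map_mul, FreeGroup.lift_apply_of]
      fin_cases i <;> fin_cases j <;> simp at h
      exact hxw
    · rw [map_pow, FreeGroup.lift_apply_of]
      fin_cases i
      · exact hx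
      · exact hy
      · exact hw)

section LiftΓ₄

variable {G : Type*} [Group G] {x y w : G} (hxy : x * y * x = y * x * y)
    (hyw : y * w * y = w * y * w) (hxw : x * w = w * x) (hx : x ^ 3 = 1) (hy : y ^ 3 = 1)
    (hw : w ^ 3 = 1)

theorem liftΓ₄_s₁ : liftΓ₄ x y w hxy hyw hxw hx hy hw gs = x := PresentedGroup.toGroup.of _

theorem liftΓ₄_s₂ : liftΓ₄ x y w hxy hyw hxw hx hy hw gt = y := PresentedGroup.toGroup.of _

theorem liftΓ₄_s₃ : liftΓ₄ x y w hxy hyw hxw hx hy hw s₃ = w := PresentedGroup.toGroup.of _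

end LiftΓ₄

/-- The morphism `Γ 4 → Γ 3` which maps `s₁`, `s₂`, `s₃` to `s₁`, `s₂`, `s₁`. -/
def proj₄₃ : Γ 4 →* Γ 3 :=
  liftΓ₄ (s₁ 3 le_rfl) (s₂ 3 le_rfl) (s₁ 3 le_rfl) (braid₁₂ 3 _) (braid₁₂ 3 _).symm rfl
    (s₁_cube 3 _) (s₂_cube 3 _) (s₁_cube 3 _)

theorem proj₄₃_s₁ : proj₄₃ gs = s₁ 3 le_rfl := liftΓ₄_s₁ _ _ _ _ _ _

theorem proj₄₃_s₂ : proj₄₃ gt = s₂ 3 le_rfl := liftΓ₄_s₂ _ _ _ _ _ _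

theorem proj₄₃_s₃ : proj₄₃ s₃ = s₁ 3 le_rfl := liftΓ₄_s₃ _ _ _ _ _ _

theorem proj₄₃_a : proj₄₃ ea = 1 := by rw [ea, map_mul, map_inv, proj₄₃_s₁, proj₄₃_s₃, mul_inv_cancel]

theorem proj₄₃_b : proj₄₃ eb = 1 := by rw [eb, map_mul, map_mul, map_inv, proj₄₃_a, mul_one, mul_inv_cancel]

theorem proj₄₃_z : proj₄₃ ez = 1 := by simp [ez, proj₄₃_a, proj₄₃_b]

theorem proj₄₃_inj₃₄ (g : Γ 3) : proj₄₃ (inj₃₄ g) = g := by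
  induction g using Γ₃_induction with
  | h1 => simp
  | hs g hg => rw [map_mul, map_mul, hg, inj₃₄_s₁, proj₄₃_s₁]
  | ht g hg => rw [map_mul, map_mul, hg, inj₃₄_s₂, proj₄₃_s₂]

/-- The kernel of `Γ 4 → Γ 3`, an extraspecial group of order `27`. -/
abbrev E : Subgroup (Γ 4) := Subgroup.closure {ea, eb}

theorem ea_mem : ea ∈ E := Subgroup.subset_closure (by simp)

theorem eb_mem : eb ∈ E := Subgroup.subset_closure (by simp)

theorem conj_mem_E {g x : Γ 4} (ha : g * ea * g⁻¹ ∈ E) (hb : g * eb * g⁻¹ ∈ E) (hx : x ∈ E) :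
    g * x * g⁻¹ ∈ E := by
  induction hx using Subgroup.closure_induction with
  | mem x hx => rcases hx with rfl | rfl <;> assumption
  | one => simp
  | mul x y _ _ hx hy => rw [conj_mul_conj]; exact mul_mem hx hy
  | inv x _ hx =>
    rw [show g * x⁻¹ * g⁻¹ = (g * x * g⁻¹)⁻¹ by group]; exact inv_mem hx

/-- The decomposition Γ₄ = E · Γ₃: conjugation by s₁ and s₂ preserves E, and s₃ differs from s₁ by
an element of E. -/
theorem mul_inv_mem_E (g : Γ 4) : g * (inj₃₄ (proj₄₃ g))⁻¹ ∈ E := by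
  have hs : ∀ x ∈ E, gs * x * gs⁻¹ ∈ E := fun x hx => conj_mem_E (by rw [conj_s_a]; exact ea_mem)
    (by rw [conj_s_b]; exact mul_mem eb_mem (inv_mem ea_mem)) hx
  have ht : ∀ x ∈ E, gt * x * gt⁻¹ ∈ E := fun x hx => conj_mem_E (by rw [conj_t_a]; exact eb_mem)
    (by rw [conj_t_b]; exact mul_mem (mul_mem eb_mem (inv_mem ea_mem)) eb_mem) hx
  induction g using Γ₄_induction with
  | h1 => simp
  | hs g hg =>
    have := hs _ hg
    simpa only [map_mul, proj₄₃_s₁, inj₃₄_s₁, mul_inv_rev, mul_assoc] using this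
  | ht g hg =>
    have := ht _ hg
    simpa only [map_mul, proj₄₃_s₂, inj₃₄_s₂, mul_inv_rev, mul_assoc] using this
  | hu g hg =>
    have := mul_mem (inv_mem ea_mem) (hs _ hg)
    rw [map_mul, map_mul, proj₄₃_s₃, inj₃₄_s₁, s₃_eq]
    simpa only [mul_inv_rev, mul_assoc] using this

end CubicBraid

namespace CubicBraid

/-! ### The three-dimensional representation of `Γ 4` -/

section Rep

theorem fin_three_congr {A : Type*} {a b c d e f g h i a' b' c' d' e' f' g' h' i' : A}
    (ha : a = a') (hb : b = b') (hc : c = c') (hd : d = d') (he : e = e') (hf : f = f')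
    (hg : g = g') (hh : h = h') (hi : i = i') :
    !![a, b, c; d, e, f; g, h, i] = !![a', b', c'; d', e', f'; g', h', i'] := by
  subst ha hb hc hd he hf hg hh hi; rfl

variable {k : Type*} [Field k] {ω : k}

/-- An invertible matrix whose cube is the identity. -/
def unitOfCube {A : Type*} [Monoid A] (x : A) (hx : x ^ 3 = 1) : Aˣ :=
  ⟨x, x ^ 2, by rw [← pow_succ', hx], by rw [← pow_succ, hx]⟩

theorem unitOfCube_pow {A : Type*} [Monoid A] (x : A) (hx : x ^ 3 = 1) :
    unitOfCube x hx ^ 3 = 1 := Units.ext hx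

/-- The image of `s₁`. -/
def matS (ω : k) : Matrix (Fin 3) (Fin 3) k := !![ω, 0, 0; 0, 1, 0; 0, 0, 1]

/-- The image of `s₂`. -/
def matT (ω : k) : Matrix (Fin 3) (Fin 3) k := !![ω, ω, ω + 1; 1, ω, 1; ω + 1, ω, ω]

/-- The image of `s₃`. -/
def matU (ω : k) : Matrix (Fin 3) (Fin 3) k := !![1, 0, 0; 0, 1, 0; 0, 0, ω]

theorem matS_mul_matU : matS ω * matU ω = matU ω * matS ω := by
  rw [matS, matU, Matrix.mul_fin_three, Matrix.mul_fin_three]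
  simp

theorem cube_eq_one_of_root (hω : ω ^ 2 + ω + 1 = 0) : ω ^ 3 = 1 := by linear_combination (ω - 1) * hω

theorem matS_cube (hω : ω ^ 2 + ω + 1 = 0) : matS ω ^ 3 = 1 := by
  have := cube_eq_one_of_root hω
  rw [pow_succ, pow_two, matS, Matrix.mul_fin_three, Matrix.mul_fin_three, Matrix.one_fin_three]
  refine fin_three_congr ?_ ?_ ?_ ?_ ?_ ?_ ?_ ?_ ?_ <;> grind

theorem matU_cube (hω : ω ^ 2 + ω + 1 = 0) : matU ω ^ 3 = 1 := by
  have := cube_eq_one_of_root hω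
  rw [pow_succ, pow_two, matU, Matrix.mul_fin_three, Matrix.mul_fin_three, Matrix.one_fin_three]
  refine fin_three_congr ?_ ?_ ?_ ?_ ?_ ?_ ?_ ?_ ?_ <;> grind

variable [CharP k 2]

theorem matT_cube (hω : ω ^ 2 + ω + 1 = 0) : matT ω ^ 3 = 1 := by
  have h2 := CharTwo.two_eq_zero (R := k)
  rw [pow_succ, pow_two, matT, Matrix.mul_fin_three, Matrix.mul_fin_three, Matrix.one_fin_three]
  refine fin_three_congr ?_ ?_ ?_ ?_ ?_ ?_ ?_ ?_ ?_ <;> grind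

theorem matS_matT (hω : ω ^ 2 + ω + 1 = 0) : matS ω * matT ω * matS ω = matT ω * matS ω * matT ω := by
  have h2 := CharTwo.two_eq_zero (R := k)
  simp only [matS, matT, Matrix.mul_fin_three]
  refine fin_three_congr ?_ ?_ ?_ ?_ ?_ ?_ ?_ ?_ ?_ <;> grind

theorem matT_matU (hω : ω ^ 2 + ω + 1 = 0) : matT ω * matU ω * matT ω = matU ω * matT ω * matU ω := by
  have h2 := CharTwo.two_eq_zero (R := k)
  simp only [matU, matT, Matrix.mul_fin_three]
  refine fin_three_congr ?_ ?_ ?_ ?_ ?_ ?_ ?_ ?_ ?_ <;> grind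

/-- The representation of `Γ 4` in `GL₃(k)` attached to a primitive cube root of unity `ω`. -/
def rhoUnits (hω : ω ^ 2 + ω + 1 = 0) : Γ 4 →* (Matrix (Fin 3) (Fin 3) k)ˣ :=
  liftΓ₄ (unitOfCube _ (matS_cube hω)) (unitOfCube _ (matT_cube hω)) (unitOfCube _ (matU_cube hω))
    (Units.ext (matS_matT hω)) (Units.ext (matT_matU hω)) (Units.ext matS_mul_matU)
    (unitOfCube_pow _ _) (unitOfCube_pow _ _) (unitOfCube_pow _ _)

/-- The representation of `Γ 4` on `k³` attached to a primitive cube root of unity `ω`. -/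
def rho (hω : ω ^ 2 + ω + 1 = 0) : Γ 4 →* Matrix (Fin 3) (Fin 3) k := (Units.coeHom _).comp (rhoUnits hω)

theorem rho_s₁ (hω : ω ^ 2 + ω + 1 = 0) : rho hω gs = matS ω := by
  change ((rhoUnits hω gs : (Matrix (Fin 3) (Fin 3) k)ˣ) : Matrix (Fin 3) (Fin 3) k) = _
  rw [rhoUnits, liftΓ₄_s₁]; rfl

theorem rho_s₂ (hω : ω ^ 2 + ω + 1 = 0) : rho hω gt = matT ω := by
  change ((rhoUnits hω gt : (Matrix (Fin 3) (Fin 3) k)ˣ) : Matrix (Fin 3) (Fin 3) k) = _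
  rw [rhoUnits, liftΓ₄_s₂]; rfl

theorem rho_s₃ (hω : ω ^ 2 + ω + 1 = 0) : rho hω s₃ = matU ω := by
  change ((rhoUnits hω s₃ : (Matrix (Fin 3) (Fin 3) k)ˣ) : Matrix (Fin 3) (Fin 3) k) = _
  rw [rhoUnits, liftΓ₄_s₃]; rfl

/-- In the chosen basis `ea` is diagonal with the three cube roots of unity as entries, and `eb`
permutes the basis cyclically: the standard form of the Heisenberg representation. In characteristic
2, ω + 1 = ω² = ω⁻¹. -/
theorem rho_a (hω : ω ^ 2 + ω + 1 = 0) : rho hω ea = !![ω, 0, 0; 0, 1, 0; 0, 0, ω + 1] := by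
  have h2 := CharTwo.two_eq_zero (R := k)
  rw [ea, map_mul, inv_eq_sq_of_cube s₃_cube, map_pow, rho_s₁, rho_s₃, pow_two, matS, matU,
    Matrix.mul_fin_three, Matrix.mul_fin_three]
  refine fin_three_congr ?_ ?_ ?_ ?_ ?_ ?_ ?_ ?_ ?_ <;> grind

theorem rho_b (hω : ω ^ 2 + ω + 1 = 0) : rho hω eb = !![0, 0, 1; 1, 0, 0; 0, 1, 0] := by
  have h2 := CharTwo.two_eq_zero (R := k)
  rw [eb, map_mul, map_mul, inv_eq_sq_of_cube (s₂_cube 4 _), map_pow, rho_a, rho_s₂, pow_two, matT]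
  simp only [Matrix.mul_fin_three]
  refine fin_three_congr ?_ ?_ ?_ ?_ ?_ ?_ ?_ ?_ ?_ <;> grind

theorem rho_z (hω : ω ^ 2 + ω + 1 = 0) : rho hω ez = (ω + 1) • (1 : Matrix (Fin 3) (Fin 3) k) := by
  have h2 := CharTwo.two_eq_zero (R := k)
  rw [ez, map_mul, map_mul, map_mul, inv_eq_sq_of_cube ea_cube, inv_eq_sq_of_cube eb_cube,
    map_pow, map_pow, rho_a, rho_b, pow_two, pow_two, Matrix.one_fin_three]
  simp only [Matrix.mul_fin_three, Matrix.smul_of, Matrix.smul_cons, Matrix.smul_empty, smul_eq_mul]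
  refine fin_three_congr ?_ ?_ ?_ ?_ ?_ ?_ ?_ ?_ ?_ <;> grind

end Rep
end CubicBraid

namespace CubicBraid

/-! ### Matrix units in the group algebra of the Heisenberg group -/

/-- Three elements of order `3` of a ring, the third one a central commutator of the other two. -/
structure HeisRel {R : Type*} [Ring R] (a b z : R) : Prop where
  a_cube : a ^ 3 = 1
  b_cube : b ^ 3 = 1
  z_cube : z ^ 3 = 1
  comm_a : z * a = a * z
  comm_b : z * b = b * z
  comm : z * (b * a) = a * b

section MatrixUnits

variable {k : Type*} [Field k] {R : Type*} [Ring R] [Algebra k R] {a b z : R} {ω : k}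

/-- For `x` with `x ^ 3 = 1` and `ω ^ 3 = 1`, the (unnormalized) idempotent of the eigenvalue
`ω⁻¹` of `x`. -/
def eig (ω : k) (x : R) : R := 1 + ω • x + ω ^ 2 • x ^ 2

theorem mul_eig {x : R} (hx : x ^ 3 = 1) {ω lam : k} (h : lam * ω = 1) (h3 : ω ^ 3 = 1) :
    x * eig ω x = lam • eig ω x := by
  have h' : lam = ω ^ 2 := by linear_combination (-lam) * h3 + ω ^ 2 * h
  subst h'
  simp only [eig, mul_add, mul_smul_comm, mul_one, ← pow_succ', hx, smul_add, smul_smul]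
  rw [← pow_two, ← pow_add, ← pow_succ, h3, show ω ^ (2 + 2) = ω by linear_combination ω * h3]
  simp only [one_smul]
  abel

/-- The coefficients of the idempotents of `a`. -/
def kap (ω : k) : Fin 3 → k := ![ω + 1, 1, ω]

/-- The eigenvalues of `a`. -/
def lam (ω : k) : Fin 3 → k := ![ω, 1, ω + 1]

/-- The matrix units attached to `a`, `b`, `z` and `ω`. -/
def matUnit (ω : k) (a b z : R) (p q : Fin 3) : R :=
  eig ω z * eig (kap ω p) a * b ^ (p - q).val

/-- The linear map on matrices which sends the elementary matrices to the matrix units. -/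
def ofMat (ω : k) (a b z : R) : Matrix (Fin 3) (Fin 3) k →ₗ[k] R where
  toFun X := ∑ p, ∑ q, X p q • matUnit ω a b z p q
  map_add' X Y := by simp only [Matrix.add_apply, add_smul, Finset.sum_add_distrib]
  map_smul' c X := by
    simp only [Matrix.smul_apply, smul_eq_mul, mul_smul, Finset.smul_sum, RingHom.id_apply]

theorem ofMat_apply (X : Matrix (Fin 3) (Fin 3) k) :
    ofMat ω a b z X = ∑ p, ∑ q, X p q • matUnit ω a b z p q := rfl

theorem ofMat_single (p q : Fin 3) : ofMat ω a b z (Matrix.single p q 1) = matUnit ω a b z p q := by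
  rw [ofMat_apply, Finset.sum_eq_single p, Finset.sum_eq_single q]
  · simp
  · intro j _ hj; simp [hj.symm]
  · simp
  · intro i _ hi; simp [hi.symm]
  · simp

variable [CharP k 2]

/-- The three eigenvalue idempotents of a add up to 1: the constant terms give 3 = 1, and the
coefficients of a and a² cancel in characteristic 2. -/
theorem ofMat_one : ofMat ω a b z 1 = eig ω z := by
  have h2 := CharTwo.two_eq_zero (R := k)
  have e : ∑ p, eig (kap ω p) a = (1 : R) := by
    simp only [Fin.sum_univ_three, kap, eig, Matrix.cons_val]
    match_scalars <;> grind
  have : ∀ p, ∑ q, (1 : Matrix (Fin 3) (Fin 3) k) p q • matUnit ω a b z p q =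
      eig ω z * eig (kap ω p) a := by
    intro p
    rw [Finset.sum_eq_single p]
    · simp [matUnit]
    · intro q _ hq; simp [Matrix.one_apply_ne hq.symm]
    · simp
  rw [ofMat_apply, Finset.sum_congr rfl fun p _ => this p, ← Finset.mul_sum, e, mul_one]

/-- Each matrix unit with row index p is an eigenvector of left multiplication by a, with eigenvalue
`lam ω p`. -/
theorem HeisRel.ofMat_mul_a (H : HeisRel a b z) (hω : ω ^ 2 + ω + 1 = 0)
    (X : Matrix (Fin 3) (Fin 3) k) :
    ofMat ω a b z (!![ω, 0, 0; 0, 1, 0; 0, 0, ω + 1] * X) = a * ofMat ω a b z X := by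
  have h2 := CharTwo.two_eq_zero (R := k)
  have e : (!![ω, 0, 0; 0, 1, 0; 0, 0, ω + 1] : Matrix (Fin 3) (Fin 3) k) =
      Matrix.diagonal (lam ω) := by
    ext p q; fin_cases p <;> fin_cases q <;> simp [lam]
  have hz : Commute a (eig ω z) := by
    have : Commute a z := H.comm_a.symm
    exact ((Commute.one_right _).add_right (this.smul_right _)).add_right
      ((this.pow_right 2).smul_right _)
  rw [e, ofMat_apply, ofMat_apply, Finset.mul_sum]
  refine Finset.sum_congr rfl fun p _ => ?_
  rw [Finset.mul_sum]
  refine Finset.sum_congr rfl fun q _ => ?_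
  have h1 : lam ω p * kap ω p = 1 := by
    fin_cases p
    · simp [lam, kap]; grind
    · simp [lam, kap]
    · simp [lam, kap]; grind
  have h3 : kap ω p ^ 3 = 1 := by
    fin_cases p
    · simp [kap]; grind
    · simp [kap]
    · simp [kap]; grind
  rw [Matrix.diagonal_mul, mul_comm, mul_smul, mul_smul_comm, matUnit, ← mul_assoc, ← mul_assoc,
    hz.eq, mul_assoc _ a, mul_eig H.a_cube h1 h3, mul_smul_comm, smul_mul_assoc]

/-- On the chosen eigencomponent of z, moving b past a costs a factor ω, so b carries the idempotent
of index p to that of index p + 1. -/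
theorem HeisRel.ofMat_mul_b (H : HeisRel a b z) (hω : ω ^ 2 + ω + 1 = 0)
    (X : Matrix (Fin 3) (Fin 3) k) :
    ofMat ω a b z (!![0, 0, 1; 1, 0, 0; 0, 1, 0] * X) = b * ofMat ω a b z X := by
  have h2 := CharTwo.two_eq_zero (R := k)
  have hz : Commute b (eig ω z) := by
    have : Commute b z := H.comm_b.symm
    exact ((Commute.one_right _).add_right (this.smul_right _)).add_right
      ((this.pow_right 2).smul_right _)
  have hzz : eig ω z * z = (ω + 1) • eig ω z := by
    have : Commute z (eig ω z) := ((Commute.one_right _).add_right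
      ((Commute.refl z).smul_right _)).add_right (((Commute.refl z).pow_right 2).smul_right _)
    rw [← this.eq]
    exact mul_eig H.z_cube (by grind) (by grind)
  -- Here z acts as ω + 1 = ω⁻¹, so the relation z(ba) = ab becomes ba = ω ab.
  have hba : eig ω z * (b * a) = ω • (eig ω z * (a * b)) := by
    rw [← H.comm, ← mul_assoc _ z, hzz, smul_mul_assoc, smul_smul,
      show ω * (ω + 1) = 1 by grind, one_smul]
  have hbaa : eig ω z * (b * a ^ 2) = ω ^ 2 • (eig ω z * (a ^ 2 * b)) := by
    have hza : Commute a (eig ω z) := by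
      have : Commute a z := H.comm_a.symm
      exact ((Commute.one_right _).add_right (this.smul_right _)).add_right
        ((this.pow_right 2).smul_right _)
    calc eig ω z * (b * a ^ 2) = eig ω z * (b * a) * a := by rw [pow_two]; noncomm_ring
      _ = ω • (a * (eig ω z * (b * a))) := by
        rw [← mul_assoc a, hza.eq, hba, smul_mul_assoc]; simp only [mul_assoc]
      _ = ω ^ 2 • (eig ω z * (a ^ 2 * b)) := by
        rw [hba, mul_smul_comm, smul_smul, ← pow_two, ← mul_assoc, hza.eq, pow_two a]
        simp only [mul_assoc]
  have key : ∀ c : k, eig ω z * (b * eig c a) = eig ω z * (eig (ω * c) a * b) := by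
    intro c
    simp only [show eig c a = 1 + c • a + c ^ 2 • a ^ 2 from rfl,
      show eig (ω * c) a = 1 + (ω * c) • a + (ω * c) ^ 2 • a ^ 2 from rfl, mul_add, add_mul, mul_smul_comm,
      smul_mul_assoc, hba, hbaa, smul_smul, mul_one, one_mul]
    congr 2
    · rw [mul_comm]
    · ring
  have hk : ∀ p, ω * kap ω p = kap ω (p + 1) := by
    intro p
    fin_cases p
    · simp [kap]; grind
    · simp [kap]
    · simp [kap]; grind
  have hu : ∀ p q, b * matUnit ω a b z p q = matUnit ω a b z (p + 1) q := by
    intro p q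
    have hb : b * b ^ (p - q).val = b ^ (p + 1 - q).val := by
      have hb3 := H.b_cube
      obtain h | h | h : (p - q = 0 ∧ p + 1 - q = 1) ∨ (p - q = 1 ∧ p + 1 - q = 2) ∨
          (p - q = 2 ∧ p + 1 - q = 0) := by
        revert p q; decide
      all_goals rw [h.1, h.2, ← pow_succ']
      exacts [rfl, rfl, hb3.trans (pow_zero b).symm]
    calc b * matUnit ω a b z p q = eig ω z * (b * eig (kap ω p) a) * b ^ (p - q).val := by
          rw [matUnit, ← mul_assoc, ← mul_assoc, hz.eq]; simp only [mul_assoc]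
      _ = eig ω z * eig (kap ω (p + 1)) a * (b * b ^ (p - q).val) := by
          rw [key, hk]; simp only [mul_assoc]
      _ = _ := by rw [hb, matUnit]
  have hX : ∀ p q, ((!![0, 0, 1; 1, 0, 0; 0, 1, 0] : Matrix (Fin 3) (Fin 3) k) * X) (p + 1) q =
      X p q := by
    intro p q
    rw [Matrix.mul_apply, Fin.sum_univ_three]
    fin_cases p <;> simp
  rw [ofMat_apply, ofMat_apply, Finset.mul_sum, ← Equiv.sum_comp (Equiv.addRight (1 : Fin 3))]
  refine Finset.sum_congr rfl fun p _ => ?_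
  rw [Finset.mul_sum]
  refine Finset.sum_congr rfl fun q _ => ?_
  rw [Equiv.coe_addRight, hX, mul_smul_comm, hu]

end MatrixUnits
end CubicBraid

namespace CubicBraid

open MonoidAlgebra in
theorem heisRel (k : Type*) [Field k] :
    HeisRel (of k (Γ 4) ea) (of k (Γ 4) eb) (of k (Γ 4) ez) where
  a_cube := by rw [← map_pow, ea_cube, map_one]
  b_cube := by rw [← map_pow, eb_cube, map_one]
  z_cube := by rw [← map_pow, ez_cube, map_one]
  comm_a := by rw [← map_mul, ← map_mul, ez_comm_a.eq]
  comm_b := by rw [← map_mul, ← map_mul, ez_comm_b.eq]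
  comm := by
    rw [← map_mul, ← map_mul, ← map_mul, ez]
    congr 1; group

variable {k : Type*} [Field k] {ω : k}

/-! ### The morphism from `kΓ₄` to the matrices over `kΓ₃` -/

section Phi

/-- The extension of scalars of matrices from `k` to the group algebra of `Γ 3`. -/
noncomputable abbrev matMap : Matrix (Fin 3) (Fin 3) k →ₐ[k] Matrix (Fin 3) (Fin 3) (MonoidAlgebra k (Γ 3)) :=
  (Algebra.ofId k (MonoidAlgebra k (Γ 3))).mapMatrix

/-- The idempotent of `kΓ₄` corresponding to the representation `rho` attached to `ω`. -/
noncomputable abbrev idem (ω : k) : MonoidAlgebra k (Γ 4) := eig ω (MonoidAlgebra.of k (Γ 4) ez)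

/-- The linear map from matrices to `kΓ₄` whose values on elementary matrices are the matrix
units. -/
noncomputable abbrev matLift (ω : k) : Matrix (Fin 3) (Fin 3) k →ₗ[k] MonoidAlgebra k (Γ 4) :=
  ofMat ω (MonoidAlgebra.of k (Γ 4) ea) (MonoidAlgebra.of k (Γ 4) eb) (MonoidAlgebra.of k (Γ 4) ez)

theorem matMap_mul_scalar (X : Matrix (Fin 3) (Fin 3) k) (y : MonoidAlgebra k (Γ 3)) :
    Matrix.scalar (Fin 3) y * matMap X = matMap X * Matrix.scalar (Fin 3) y := by
  refine Matrix.ext fun p q => ?_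
  simp only [Matrix.scalar_apply, Matrix.diagonal_mul, Matrix.mul_diagonal, AlgHom.mapMatrix_apply,
    Matrix.map_apply, Algebra.ofId_apply]
  exact (Algebra.commutes _ _).symm

theorem idem_comm (ω : k) (x : MonoidAlgebra k (Γ 4)) : idem ω * x = x * idem ω := by
  have hz : Commute (MonoidAlgebra.of k (Γ 4) ez) x := by
    induction x using MonoidAlgebra.induction_on with
    | of g => exact (ez_comm g).map (MonoidAlgebra.of k (Γ 4))
    | add x y hx hy => exact hx.add_right hy
    | smul r x hx => exact hx.smul_right r
  exact ((Commute.one_left _).add_left (hz.smul_left _)).add_left ((hz.pow_left 2).smul_left _)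

variable [CharP k 2] (hω : ω ^ 2 + ω + 1 = 0)

/-- The tensor product of the representation `rho` and of the projection `Γ 4 → Γ 3`. -/
noncomputable def PhiHom : Γ 4 →* Matrix (Fin 3) (Fin 3) (MonoidAlgebra k (Γ 3)) where
  toFun g := matMap (rho hω g) * Matrix.scalar (Fin 3) (MonoidAlgebra.of k (Γ 3) (proj₄₃ g))
  map_one' := by simp only [map_one, mul_one]
  map_mul' g h := by
    simp only [map_mul]
    rw [mul_assoc (matMap (rho hω g)), ← mul_assoc (matMap (rho hω h)), ← matMap_mul_scalar]
    simp only [mul_assoc]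

/-- The linear extension of `PhiHom`. -/
noncomputable def Phi : MonoidAlgebra k (Γ 4) →ₐ[k] Matrix (Fin 3) (Fin 3) (MonoidAlgebra k (Γ 3)) :=
  MonoidAlgebra.lift k _ _ (PhiHom hω)

theorem Phi_of (g : Γ 4) : Phi hω (MonoidAlgebra.of k _ g) =
    matMap (rho hω g) * Matrix.scalar (Fin 3) (MonoidAlgebra.of k (Γ 3) (proj₄₃ g)) :=
  MonoidAlgebra.lift_of _ _

theorem Phi_of_of_proj {g : Γ 4} (hg : proj₄₃ g = 1) : Phi hω (MonoidAlgebra.of k _ g) =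
    matMap (rho hω g) := by rw [Phi_of, hg, map_one, map_one, mul_one]

theorem Phi_eig {g : Γ 4} (hg : proj₄₃ g = 1) (c : k) :
    Phi hω (eig c (MonoidAlgebra.of k _ g)) = matMap (eig c (rho hω g)) := by
  simp only [eig, map_add, map_one, map_smul, map_pow, Phi_of_of_proj hω hg]

theorem Phi_idem : Phi hω (idem ω) = 1 := by
  have h2 := CharTwo.two_eq_zero (R := k)
  rw [Phi_eig hω proj₄₃_z, ← map_one matMap, rho_z]
  congr 1
  simp only [eig, smul_pow, one_pow]
  match_scalars
  grind

theorem Phi_idem_conj : Phi hω (idem (ω + 1)) = 0 := by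
  have h2 := CharTwo.two_eq_zero (R := k)
  rw [Phi_eig hω proj₄₃_z, ← map_zero matMap, rho_z]
  congr 1
  simp only [eig, smul_pow, one_pow]
  match_scalars
  grind

theorem Phi_eig_one : Phi hω (idem 1) = 0 := by
  have h2 := CharTwo.two_eq_zero (R := k)
  rw [Phi_eig hω proj₄₃_z, ← map_zero matMap, rho_z]
  congr 1
  simp only [eig, smul_pow, one_pow]
  match_scalars
  grind

theorem eig_kap (p : Fin 3) : eig (kap ω p) (rho hω ea) = Matrix.single p p 1 := by
  have h2 := CharTwo.two_eq_zero (R := k)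
  have e : rho hω ea = Matrix.diagonal (lam ω) := by
    rw [rho_a]
    ext p q; fin_cases p <;> fin_cases q <;> simp [lam]
  have e1 : eig (kap ω p) (rho hω ea) =
      Matrix.diagonal (fun i => 1 + kap ω p * lam ω i + kap ω p ^ 2 * lam ω i ^ 2) := by
    rw [e, eig, Matrix.diagonal_pow, ← Matrix.diagonal_one, ← Matrix.diagonal_smul,
      ← Matrix.diagonal_smul, Matrix.diagonal_add, Matrix.diagonal_add]
    rfl
  rw [e1, ← Matrix.diagonal_single]
  congr 1
  ext i
  fin_cases p <;> fin_cases i <;> simp [kap, lam] <;> grind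

theorem single_mul_rho_b (p q : Fin 3) :
    Matrix.single p p 1 * rho hω eb ^ (p - q).val = Matrix.single p q 1 := by
  have h : ∀ p q, Matrix.single p q 1 * rho hω eb = Matrix.single p (q - 1) 1 := by
    intro p q
    rw [rho_b]
    ext i j
    rw [Matrix.mul_apply, Fin.sum_univ_three]
    fin_cases p <;> fin_cases q <;> fin_cases i <;> fin_cases j <;> simp [Matrix.single_apply] <;>
      decide
  obtain ⟨e, e'⟩ | ⟨e, e'⟩ | ⟨e, e'⟩ : ((p - q).val = 0 ∧ p = q) ∨ ((p - q).val = 1 ∧ p - 1 = q) ∨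
      ((p - q).val = 2 ∧ p - 1 - 1 = q) := by
    revert p q; decide
  · rw [e, e', pow_zero, mul_one]
  · rw [e, pow_one, h, e']
  · rw [e, pow_two, ← mul_assoc, h, h, e']

theorem Phi_matUnit (p q : Fin 3) :
    Phi hω (matUnit ω (MonoidAlgebra.of k (Γ 4) ea) (MonoidAlgebra.of k (Γ 4) eb)
      (MonoidAlgebra.of k (Γ 4) ez) p q) = matMap (Matrix.single p q 1) := by
  rw [matUnit, map_mul, map_mul, Phi_idem, one_mul, Phi_eig hω proj₄₃_a, map_pow,
    Phi_of_of_proj hω proj₄₃_b, ← map_pow, ← map_mul, eig_kap, single_mul_rho_b]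

theorem Phi_matLift (X : Matrix (Fin 3) (Fin 3) k) : Phi hω (matLift ω X) = matMap X := by
  rw [Matrix.matrix_eq_sum_single X]
  simp only [map_sum]
  refine Finset.sum_congr rfl fun p _ => Finset.sum_congr rfl fun q _ => ?_
  rw [show Matrix.single p q (X p q) = X p q • Matrix.single p q 1 by simp, map_smul, map_smul,
    map_smul, ofMat_single, Phi_matUnit]

/-- `matLift` is compatible with left multiplication by E: it suffices to check the two generators.
-/
theorem matLift_rho_mul {v : Γ 4} (hv : v ∈ E) (X : Matrix (Fin 3) (Fin 3) k) :
    matLift ω (rho hω v * X) = MonoidAlgebra.of k _ v * matLift ω X := by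
  induction hv using Subgroup.closure_induction generalizing X with
  | mem v hv =>
    rcases hv with rfl | rfl
    · rw [rho_a, (heisRel k).ofMat_mul_a hω]
    · rw [rho_b, (heisRel k).ofMat_mul_b hω]
  | one => rw [map_one, map_one, one_mul, one_mul]
  | mul v w _ _ hv hw => rw [map_mul (rho hω), map_mul (MonoidAlgebra.of k _), mul_assoc, hv, hw, mul_assoc]
  | inv v _ hv =>
    have := hv (rho hω v⁻¹ * X)
    rw [← mul_assoc, ← map_mul, mul_inv_cancel, map_one, one_mul] at this
    rw [this, ← mul_assoc, ← map_mul, inv_mul_cancel, map_one, one_mul]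

theorem matLift_rho {v : Γ 4} (hv : v ∈ E) :
    matLift ω (rho hω v) = MonoidAlgebra.of k _ v * idem ω := by
  have := matLift_rho_mul hω hv 1
  rwa [mul_one, ofMat_one] at this

/-- The map `kΓ₃ → kΓ₄` which corresponds to the inclusion of `kΓ₃` as the set of matrices with
only one nonzero entry. -/
noncomputable def coeffLift (p q : Fin 3) : MonoidAlgebra k (Γ 3) →ₗ[k] MonoidAlgebra k (Γ 4) :=
  (Finsupp.linearCombination k fun h : Γ 3 =>
    -- The factor at h⁻¹ cancels the matrix `rho hω (inj₃₄ h)` that `Phi` attaches to h.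
    matLift ω (Matrix.single p q 1 * rho hω (inj₃₄ h⁻¹)) * MonoidAlgebra.of k _ (inj₃₄ h)) ∘ₗ
    (MonoidAlgebra.coeffLinearEquiv k).toLinearMap

theorem coeffLift_of (p q : Fin 3) (h : Γ 3) : coeffLift hω p q (MonoidAlgebra.of k _ h) =
    matLift ω (Matrix.single p q 1 * rho hω (inj₃₄ h⁻¹)) * MonoidAlgebra.of k _ (inj₃₄ h) := by
  rw [coeffLift, LinearMap.comp_apply]
  change Finsupp.linearCombination k _ (Finsupp.single h 1) = _
  rw [Finsupp.linearCombination_single, one_smul]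

theorem Phi_coeffLift (p q : Fin 3) (y : MonoidAlgebra k (Γ 3)) :
    Phi hω (coeffLift hω p q y) = Matrix.single p q y := by
  induction y using MonoidAlgebra.induction_on with
  | of h =>
    rw [coeffLift_of, map_mul, Phi_matLift, Phi_of, proj₄₃_inj₃₄, ← mul_assoc, ← map_mul, mul_assoc,
      ← map_mul (rho hω), ← map_mul inj₃₄, inv_mul_cancel, map_one, map_one, mul_one]
    refine Matrix.ext fun i j => ?_
    rw [Matrix.scalar_apply, Matrix.mul_diagonal, AlgHom.mapMatrix_apply, Matrix.map_apply,
      Matrix.single_apply, Matrix.single_apply]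
    split_ifs <;> simp
  | add x y hx hy => rw [map_add, map_add, hx, hy, Matrix.single_add]
  | smul r x hx => rw [map_smul, map_smul, hx, Matrix.smul_single]

theorem Phi_surjective : Function.Surjective (Phi hω) := fun Y =>
  ⟨∑ p, ∑ q, coeffLift hω p q (Y p q), by
    simp only [map_sum, Phi_coeffLift]
    exact (Matrix.matrix_eq_sum_single Y).symm⟩

/-- Multiplication by `idem ω` factors through `Phi`, which makes `Phi` injective on this component.
For g = v h with v in E and h from Γ₃, the sum reassembles to `matLift` of `rho hω v` times h, that
is v · `idem ω` · h, and `idem ω` is central. -/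
theorem sum_coeffLift_Phi (x : MonoidAlgebra k (Γ 4)) :
    ∑ p, ∑ q, coeffLift hω p q (Phi hω x p q) = x * idem ω := by
  induction x using MonoidAlgebra.induction_on with
  | of g =>
    have h : ∀ p q, Phi hω (MonoidAlgebra.of k _ g) p q =
        rho hω g p q • MonoidAlgebra.of k (Γ 3) (proj₄₃ g) := by
      intro p q
      rw [Phi_of, Matrix.scalar_apply, Matrix.mul_diagonal, AlgHom.mapMatrix_apply,
        Matrix.map_apply, Algebra.ofId_apply, Algebra.smul_def]
    have h' : ∀ p q, coeffLift hω p q (Phi hω (MonoidAlgebra.of k _ g) p q) =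
        matLift ω (Matrix.single p q (rho hω g p q) * rho hω (inj₃₄ (proj₄₃ g)⁻¹)) *
          MonoidAlgebra.of k _ (inj₃₄ (proj₄₃ g)) := by
      intro p q
      rw [h, map_smul, coeffLift_of, ← smul_mul_assoc, ← map_smul, ← smul_mul_assoc,
        Matrix.smul_single, smul_eq_mul, mul_one]
    simp only [h', ← Finset.sum_mul, ← map_sum]
    rw [← Matrix.matrix_eq_sum_single, ← map_mul, map_inv, matLift_rho hω (mul_inv_mem_E g),
      mul_assoc, idem_comm, ← mul_assoc, ← map_mul, inv_mul_cancel_right]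
  | add x y hx hy => simp only [map_add, Matrix.add_apply, Finset.sum_add_distrib, hx, hy, add_mul]
  | smul r x hx =>
    simp only [map_smul, Matrix.smul_apply, ← Finset.smul_sum, hx, smul_mul_assoc]

theorem mul_idem_eq_zero {x : MonoidAlgebra k (Γ 4)} (hx : Phi hω x = 0) : x * idem ω = 0 := by
  rw [← sum_coeffLift_Phi hω, hx]
  simp

end Phi
end CubicBraid

namespace CubicBraid

/-! ### The idempotent of the trivial representation of `E` -/

section Trivial

variable (k : Type*) [Field k]

/-- The product of a generator of `E` and of the idempotent `idem 1`. -/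
noncomputable abbrev idA : MonoidAlgebra k (Γ 4) := idem 1 * MonoidAlgebra.of k _ ea

/-- The product of a generator of `E` and of the idempotent `idem 1`. -/
noncomputable abbrev idB : MonoidAlgebra k (Γ 4) := idem 1 * MonoidAlgebra.of k _ eb

/-- The image in `kΓ₄` of the elements of `E / ⟨ez⟩`. -/
noncomputable def mu (v : ZMod 3 × ZMod 3) : MonoidAlgebra k (Γ 4) :=
  idem 1 * (idA k ^ v.1.val * idB k ^ v.2.val)

/-- The idempotent of the trivial representation of `E`. -/
noncomputable def idemE : MonoidAlgebra k (Γ 4) := ∑ v, mu k v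

variable {k}

theorem idem_one_mul_of_z : idem (1 : k) * MonoidAlgebra.of k _ ez = idem 1 := by
  rw [idem_comm, mul_eig (heisRel k).z_cube (lam := 1) (by simp) (by simp), one_smul]

theorem idem_one_mul_b_mul_a : idem (1 : k) * (MonoidAlgebra.of k _ eb * MonoidAlgebra.of k _ ea) =
    idem 1 * (MonoidAlgebra.of k _ ea * MonoidAlgebra.of k _ eb) := by
  rw [← (heisRel k).comm, ← mul_assoc _ (MonoidAlgebra.of k _ ez), idem_one_mul_of_z]

theorem mu_zero : mu k 0 = idem 1 := by simp [mu]

/-- The condition that the conjugation by `g` acts on the image of `E / ⟨ez⟩` by `T`. -/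
def ActsBy (k : Type*) [Field k] (g : Γ 4) (T : ZMod 3 × ZMod 3 → ZMod 3 × ZMod 3) : Prop :=
  ∀ v, MonoidAlgebra.of k _ g * mu k v = mu k (T v) * MonoidAlgebra.of k _ g

theorem ActsBy.mul {g h : Γ 4} {T U : ZMod 3 × ZMod 3 → ZMod 3 × ZMod 3} (hg : ActsBy k g T)
    (hh : ActsBy k h U) : ActsBy k (g * h) (T ∘ U) := fun v => by
  rw [map_mul, mul_assoc, hh, ← mul_assoc, hg, mul_assoc, Function.comp_apply]

theorem semiconj_idem {g x y : Γ 4} (h : g * x * g⁻¹ = y) :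
    SemiconjBy (MonoidAlgebra.of k _ g) (idem 1 * MonoidAlgebra.of k _ x)
      (idem 1 * MonoidAlgebra.of k _ y) := by
  change _ * (_ * _) = _ * _ * _
  rw [← mul_assoc, ← idem_comm, mul_assoc, mul_assoc, ← map_mul, ← map_mul, ← h,
    inv_mul_cancel_right]

theorem semiconj_mu_aux {g : Γ 4} {x y : MonoidAlgebra k (Γ 4)}
    (hx : SemiconjBy (MonoidAlgebra.of k _ g) (idA k) x)
    (hy : SemiconjBy (MonoidAlgebra.of k _ g) (idB k) y) (v : ZMod 3 × ZMod 3) :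
    MonoidAlgebra.of k _ g * mu k v =
      idem 1 * (x ^ v.1.val * y ^ v.2.val) * MonoidAlgebra.of k _ g := by
  rw [mu, ← mul_assoc, ← idem_comm, mul_assoc, mul_assoc,
    ((hx.pow_right _).mul_right (hy.pow_right _)).eq]

variable [CharP k 2]

theorem idem_one_mul_self : idem (1 : k) * idem 1 = idem 1 := by
  have h : ∀ x : MonoidAlgebra k (Γ 4), x * (1 + (1 : k) • MonoidAlgebra.of k _ ez + (1 : k) ^ 2 •
      MonoidAlgebra.of k _ ez ^ 2) = x + x * MonoidAlgebra.of k _ ez + x * MonoidAlgebra.of k _ ez *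
      MonoidAlgebra.of k _ ez := by
    intro x
    rw [one_pow, one_smul, one_smul, pow_two, mul_add, mul_add, mul_one, mul_assoc]
  calc idem (1 : k) * idem 1 = _ := h _
    _ = idem 1 := by
      rw [idem_one_mul_of_z, idem_one_mul_of_z]
      rw [add_assoc, ← two_mul, two_eq_zero_monoidAlgebra, zero_mul, add_zero]

theorem idem_one_mul_mul (x y : MonoidAlgebra k (Γ 4)) :
    idem (1 : k) * x * (idem 1 * y) = idem 1 * (x * y) := by
  rw [idem_comm, mul_assoc, ← mul_assoc (idem 1) (idem 1), idem_one_mul_self, ← mul_assoc,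
    ← idem_comm, mul_assoc]

theorem idem_one_mul_pow (x : MonoidAlgebra k (Γ 4)) (n : ℕ) :
    idem (1 : k) * (idem 1 * x) ^ n = idem 1 * x ^ n := by
  induction n with
  | zero => simp
  | succ n ih => rw [pow_succ, ← mul_assoc, ih, idem_one_mul_mul, pow_succ]

theorem idA_commute : Commute (idA k) (idB k) := by
  change idem (1 : k) * _ * (idem 1 * _) = idem (1 : k) * _ * (idem 1 * _)
  rw [idem_one_mul_mul, idem_one_mul_mul, idem_one_mul_b_mul_a]

theorem idem_one_mul_pow_mod {x : MonoidAlgebra k (Γ 4)} (hx : x ^ 3 = 1) (n : ℕ) :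
    idem (1 : k) * (idem 1 * x) ^ (n % 3) = idem 1 * (idem 1 * x) ^ n := by
  rw [idem_one_mul_pow, idem_one_mul_pow]
  conv_rhs => rw [← Nat.div_add_mod n 3, pow_add, pow_mul, hx, one_pow, one_mul]

theorem mu_natCast (n m : ℕ) : mu k ((n : ZMod 3), (m : ZMod 3)) =
    idem 1 * (idA k ^ n * idB k ^ m) := by
  have h : ∀ x y : MonoidAlgebra k (Γ 4), idem (1 : k) * (x * y) =
      (idem (1 : k) * x) * (idem 1 * y) := fun x y => (idem_one_mul_mul x y).symm
  simp only [mu, ZMod.val_natCast]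
  rw [h, h, idem_one_mul_pow_mod (heisRel k).a_cube, idem_one_mul_pow_mod (heisRel k).b_cube]

theorem mu_mul (v w : ZMod 3 × ZMod 3) : mu k v * mu k w = mu k (v + w) := by
  have e : v + w = (((v.1.val + w.1.val : ℕ) : ZMod 3), ((v.2.val + w.2.val : ℕ) : ZMod 3)) := by
    ext <;> simp
  rw [e, mu_natCast, mu, mu, idem_one_mul_mul, pow_add, pow_add]
  congr 1
  rw [mul_assoc, mul_assoc, ← mul_assoc (idB k ^ _), ← mul_assoc (idA k ^ _) (idB k ^ _),
    (idA_commute.pow_pow _ _).eq]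

theorem mu_mul_a (v : ZMod 3 × ZMod 3) : mu k v * MonoidAlgebra.of k _ ea = mu k (v + (1, 0)) := by
  have h : mu k (1, 0) = idem 1 * MonoidAlgebra.of k _ ea := by
    have := mu_natCast (k := k) 1 0
    rw [pow_one, pow_zero, mul_one, ← mul_assoc, idem_one_mul_self] at this
    simpa using this
  rw [← mu_mul, h, mu, idem_one_mul_mul, mul_assoc]

theorem mu_mul_b (v : ZMod 3 × ZMod 3) : mu k v * MonoidAlgebra.of k _ eb = mu k (v + (0, 1)) := by
  have h : mu k (0, 1) = idem 1 * MonoidAlgebra.of k _ eb := by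
    have := mu_natCast (k := k) 0 1
    rw [pow_one, pow_zero, one_mul, ← mul_assoc, idem_one_mul_self] at this
    simpa using this
  rw [← mu_mul, h, mu, idem_one_mul_mul, mul_assoc]

theorem idemE_mul_of_mem {v : Γ 4} (hv : v ∈ E) : idemE k * MonoidAlgebra.of k _ v = idemE k := by
  induction hv using Subgroup.closure_induction with
  | mem v hv =>
    rcases hv with rfl | rfl
    · simp only [idemE, Finset.sum_mul, mu_mul_a]
      exact Equiv.sum_comp (Equiv.addRight ((1, 0) : ZMod 3 × ZMod 3)) (mu k)
    · simp only [idemE, Finset.sum_mul, mu_mul_b]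
      exact Equiv.sum_comp (Equiv.addRight ((0, 1) : ZMod 3 × ZMod 3)) (mu k)
  | one => rw [map_one, mul_one]
  | mul v w _ _ hv hw => rw [map_mul, ← mul_assoc, hv, hw]
  | inv v _ hv =>
    conv_lhs => rw [← hv, mul_assoc, ← map_mul, mul_inv_cancel, map_one, mul_one]

theorem idem_mul_conj_b : idem 1 * MonoidAlgebra.of k _ (eb * ea⁻¹) = idB k * idA k ^ 2 := by
  rw [inv_eq_sq_of_cube ea_cube, map_mul, map_pow, pow_two, pow_two, ← mul_assoc (idB k),
    idem_one_mul_mul, idem_one_mul_mul, mul_assoc]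

theorem idem_mul_conj_b' :
    idem 1 * MonoidAlgebra.of k _ (eb * ea⁻¹ * eb) = idB k * idA k ^ 2 * idB k := by
  rw [← idem_mul_conj_b, idem_one_mul_mul, ← map_mul]

theorem actsBy_s : ActsBy k gs fun v => (v.1 + 2 * v.2, v.2) := fun v => by
  have h := semiconj_mu_aux (semiconj_idem (k := k) conj_s_a) (semiconj_idem conj_s_b) v
  have e : (v.1 + 2 * v.2, v.2) =
      (((v.1.val + 2 * v.2.val : ℕ) : ZMod 3), ((v.2.val : ℕ) : ZMod 3)) := by
    ext <;> simp
  change _ = mu k (v.1 + 2 * v.2, v.2) * _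
  rw [h, idem_mul_conj_b, e, mu_natCast, pow_add, pow_mul,
    (idA_commute.symm.pow_right 2).mul_pow, (idA_commute.symm.pow_right 2 |>.pow_pow _ _).eq,
    ← mul_assoc (idA k ^ _)]

theorem actsBy_t : ActsBy k gt fun v => (2 * v.2, v.1 + 2 * v.2) := fun v => by
  have h := semiconj_mu_aux (semiconj_idem (k := k) conj_t_a) (semiconj_idem conj_t_b) v
  have e : (2 * v.2, v.1 + 2 * v.2) =
      (((2 * v.2.val : ℕ) : ZMod 3), ((v.1.val + 2 * v.2.val : ℕ) : ZMod 3)) := by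
    ext <;> simp
  have c : Commute (idB k) (idA k ^ 2) := idA_commute.symm.pow_right 2
  change _ = mu k (2 * v.2, v.1 + 2 * v.2) * _
  rw [h, idem_mul_conj_b', e, mu_natCast, pow_add, pow_mul, pow_mul, c.eq, mul_assoc (idA k ^ 2),
    (c.symm.mul_right c.symm).mul_pow, ← mul_assoc _ ((idA k ^ 2) ^ _), (c.pow_pow _ _).eq,
    ← pow_two, mul_assoc ((idA k ^ 2) ^ _)]

/-- Moving g to the right turns the v-th term into `mu k (v + T (-v))` times g. If v ↦ v + T(-v) is
a bijection, the sum runs once over E/⟨ez⟩. -/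
theorem ActsBy.sum {g : Γ 4} {T : ZMod 3 × ZMod 3 → ZMod 3 × ZMod 3} (h : ActsBy k g T)
    (hT : Function.Injective fun v => v + T (-v)) :
    ∑ v, mu k v * MonoidAlgebra.of k _ g * mu k (-v) = idemE k * MonoidAlgebra.of k _ g := by
  have : ∀ v, mu k v * MonoidAlgebra.of k _ g * mu k (-v) =
      mu k (v + T (-v)) * MonoidAlgebra.of k _ g := fun v => by
    rw [mul_assoc, h, ← mul_assoc, mu_mul]
  rw [Finset.sum_congr rfl fun v _ => this v, ← Finset.sum_mul, idemE,
    ← Function.Bijective.sum_comp (Finite.injective_iff_bijective.1 hT) (mu k)]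

theorem sum_mu_mul_mu_neg : ∑ v, mu k v * MonoidAlgebra.of k _ 1 * mu k (-v) = idem 1 := by
  have h2 := CharTwo.two_eq_zero (R := k)
  have : ∀ v, mu k v * MonoidAlgebra.of k _ 1 * mu k (-v) = idem 1 := fun v => by
    rw [map_one, mul_one, mu_mul, add_neg_cancel, mu_zero]
  rw [Finset.sum_congr rfl fun v _ => this v, Finset.sum_const, Finset.card_univ, Fintype.card_prod,
    ZMod.card, ← Nat.cast_smul_eq_nsmul k, show ((3 * 3 : ℕ) : k) = 1 by push_cast; grind, one_smul]

/-- The sum of the `mu k v * q * mu k (-v)` lies in the ideal of q. Its term for 1 contributes 9 ·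
`idem 1` = `idem 1`, and each of the other seven terms g contributes `idemE k` · g, since g has no
nonzero fixed vector on 𝔽₃². Subtracting `idemE k * q` leaves the difference of the two idempotents.
-/
theorem idem_one_sub_idemE_mem : idem 1 - idemE k ∈ gen (q k 4 three_le_four) := by
  have e : ∑ v, mu k v * q k 4 three_le_four * mu k (-v) =
      idem 1 + idemE k * (q k 4 three_le_four - 1) := by
    have hs := actsBy_s (k := k)
    have ht := actsBy_t (k := k)
    simp only [q, mul_add, add_mul, Finset.sum_add_distrib, pow_two, sum_mu_mul_mu_neg]
    -- Each `decide` verifies over the nine vectors that v ↦ v + T(-v) is injective.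
    rw [(hs.mul (ht.mul ht)).sum (by decide), (ht.mul (hs.mul hs)).sum (by decide),
      ((hs.mul hs).mul ht).sum (by decide), ((ht.mul ht).mul hs).sum (by decide),
      ((hs.mul ht).mul hs).sum (by decide), (((hs.mul hs).mul (ht.mul ht)).mul (hs.mul hs)).sum (by decide),
      (((hs.mul (ht.mul ht)).mul hs).mul (ht.mul ht)).sum (by decide)]
    rw [map_one]
    noncomm_ring
  have e' : idem 1 - idemE k = ∑ v, mu k v * q k 4 three_le_four * mu k (-v) -
      idemE k * q k 4 three_le_four := by
    rw [e]; noncomm_ring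
  rw [e']
  refine sub_mem (sum_mem fun v _ => ?_) (Ideal.mul_mem_left _ _ (mem_gen _))
  exact Ideal.mul_mem_right _ _ (Ideal.mul_mem_left _ _ (mem_gen _))

end Trivial
end CubicBraid

namespace CubicBraid

/-! ### The ideals `M_q` of `kQ` -/

section QuatSpan

variable {k : Type*} [Field k] {R : Type*} [Ring R] [Algebra k R] {X Y Z : R} {ω : k}

/-- The generators of the subspace `M_q`. -/
def quatGen (ω : k) (X Y Z : R) : Fin 4 → R := ![X * Y + ω ^ 2 • Z, X * Z, Y * Z, X * (Y * Z)]

/-- The subspace `M_q` attached to a cube root of unity. -/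
def quatSpan (ω : k) (X Y Z : R) : Submodule k R := Submodule.span k (Set.range (quatGen ω X Y Z))

theorem mem_quatSpan₀ : X * Y + ω ^ 2 • Z ∈ quatSpan ω X Y Z := Submodule.subset_span ⟨0, rfl⟩

theorem mem_quatSpan₁ : X * Z ∈ quatSpan ω X Y Z := Submodule.subset_span ⟨1, rfl⟩

theorem mem_quatSpan₂ : Y * Z ∈ quatSpan ω X Y Z := Submodule.subset_span ⟨2, rfl⟩

theorem mem_quatSpan₃ : X * (Y * Z) ∈ quatSpan ω X Y Z := Submodule.subset_span ⟨3, rfl⟩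

theorem quatSpan_le {W : Submodule k R} (h0 : X * Y + ω ^ 2 • Z ∈ W) (h1 : X * Z ∈ W)
    (h2 : Y * Z ∈ W) (h3 : X * (Y * Z) ∈ W) : quatSpan ω X Y Z ≤ W := by
  rw [quatSpan, Submodule.span_le]
  rintro _ ⟨i, rfl⟩
  fin_cases i <;> assumption

namespace QuatRel

variable {w : R}

/-- Multiplication by X or Y on either side sends the first generator into the span of XZ, YZ, XYZ,
and that span is itself stable. So any line spanned by XY + ω²Z modulo this span yields an ideal,
for every scalar ω. -/
theorem X_mul_mem (h : QuatRel X Y Z) (hw : w ∈ quatSpan ω X Y Z) : X * w ∈ quatSpan ω X Y Z := by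
  refine quatSpan_le (W := (quatSpan ω X Y Z).comap (LinearMap.mulLeft k X)) ?_ ?_ ?_ ?_ hw <;>
    simp only [Submodule.mem_comap, LinearMap.mulLeft_apply]
  · rw [mul_add, h.xx', h.zy, mul_smul_comm]
    exact add_mem mem_quatSpan₂ (Submodule.smul_mem _ _ mem_quatSpan₁)
  · rw [h.xx', h.zz]; exact zero_mem _
  · exact mem_quatSpan₃
  · rw [h.xx', h.zy', h.zz, mul_zero]; exact zero_mem _

theorem Y_mul_mem (h : QuatRel X Y Z) (hw : w ∈ quatSpan ω X Y Z) : Y * w ∈ quatSpan ω X Y Z := by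
  refine quatSpan_le (W := (quatSpan ω X Y Z).comap (LinearMap.mulLeft k Y)) ?_ ?_ ?_ ?_ hw <;>
    simp only [Submodule.mem_comap, LinearMap.mulLeft_apply]
  · rw [mul_add, h.yx', h.yy, h.zy, h.yy', h.zz, mul_zero, add_zero, add_zero, mul_smul_comm]
    exact add_mem (add_mem (add_mem mem_quatSpan₁ mem_quatSpan₂) mem_quatSpan₃)
      (Submodule.smul_mem _ _ mem_quatSpan₂)
  · rw [h.yxz]; exact mem_quatSpan₃
  · rw [h.yy', h.zz]; exact zero_mem _
  · rw [h.yx']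
    simp only [h.yy', h.zy', h.zz, mul_zero, add_zero]
    exact zero_mem _

theorem mul_X_mem (h : QuatRel X Y Z) (hw : w ∈ quatSpan ω X Y Z) : w * X ∈ quatSpan ω X Y Z := by
  refine quatSpan_le (W := (quatSpan ω X Y Z).comap (LinearMap.mulRight k X)) ?_ ?_ ?_ ?_ hw <;>
    simp only [Submodule.mem_comap, LinearMap.mulRight_apply]
  · rw [add_mul, mul_assoc, h.xyx, smul_mul_assoc, h.zx]
    exact add_mem (add_mem (add_mem mem_quatSpan₁ mem_quatSpan₂) mem_quatSpan₃)
      (Submodule.smul_mem _ _ mem_quatSpan₁)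
  · rw [mul_assoc, h.zx, h.xx', h.zz]; exact zero_mem _
  · rw [mul_assoc, h.zx, h.yxz]; exact mem_quatSpan₃
  · rw [mul_assoc, mul_assoc, h.zx, h.yxz, h.xx', h.zy', h.zz, mul_zero]; exact zero_mem _

theorem mul_Y_mem (h : QuatRel X Y Z) (hw : w ∈ quatSpan ω X Y Z) : w * Y ∈ quatSpan ω X Y Z := by
  refine quatSpan_le (W := (quatSpan ω X Y Z).comap (LinearMap.mulRight k Y)) ?_ ?_ ?_ ?_ hw <;>
    simp only [Submodule.mem_comap, LinearMap.mulRight_apply]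
  · rw [add_mul, mul_assoc, h.yy, smul_mul_assoc, h.zy]
    exact add_mem mem_quatSpan₁ (Submodule.smul_mem _ _ mem_quatSpan₂)
  · rw [mul_assoc, h.zy]; exact mem_quatSpan₃
  · rw [mul_assoc, h.zy, h.yy', h.zz]; exact zero_mem _
  · rw [mul_assoc, mul_assoc, h.zy, h.yy', h.zz, mul_zero]; exact zero_mem _

theorem Z_mul_quatGen_zero (h : QuatRel X Y Z) : Z * (X * Y + ω ^ 2 • Z) = X * (Y * Z) := by
  rw [mul_add, h.zx', h.zy, mul_smul_comm, h.zz, smul_zero, add_zero]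

/-- Left multiplication by Z kills XZ, YZ and XYZ, so it reads off the coefficient of the first
generator. -/
theorem Z_mul_mem (h : QuatRel X Y Z) (hw : w ∈ quatSpan ω X Y Z) :
    ∃ c : k, Z * w = c • (X * (Y * Z)) ∧ w - c • (X * Y + ω ^ 2 • Z) ∈
      Submodule.span k {X * Z, Y * Z, X * (Y * Z)} := by
  induction hw using Submodule.span_induction with
  | mem w hw =>
    obtain ⟨i, rfl⟩ := hw
    fin_cases i
    · exact ⟨1, by rw [one_smul]; exact h.Z_mul_quatGen_zero, by simp [quatGen]⟩
    · exact ⟨0, by simp [quatGen, h.zx', h.zz], by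
        rw [zero_smul, sub_zero]; exact Submodule.subset_span (by simp [quatGen])⟩
    · exact ⟨0, by simp [quatGen, h.zy', h.zz], by
        rw [zero_smul, sub_zero]; exact Submodule.subset_span (by simp [quatGen])⟩
    · exact ⟨0, by simp [quatGen, h.zx', h.zy', h.zz], by
        rw [zero_smul, sub_zero]; exact Submodule.subset_span (by simp [quatGen])⟩
  | zero => exact ⟨0, by simp, by simp⟩
  | add v w _ _ hv hw =>
    obtain ⟨c, hc, hc'⟩ := hv
    obtain ⟨d, hd, hd'⟩ := hw
    refine ⟨c + d, by rw [mul_add, hc, hd, add_smul], ?_⟩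
    rw [add_smul, add_sub_add_comm]
    exact add_mem hc' hd'
  | smul r v _ hv =>
    obtain ⟨c, hc, hc'⟩ := hv
    refine ⟨r * c, by rw [mul_smul_comm, hc, smul_smul], ?_⟩
    rw [mul_smul, ← smul_sub]
    exact Submodule.smul_mem _ _ hc'

/-- Left multiplication by Z, then X, then Y isolates the coefficients of the first, third and
second generators as multiples of XYZ. -/
theorem linearIndependent (h : QuatRel X Y Z) (h0 : X * (Y * Z) ≠ 0) :
    LinearIndependent k (quatGen ω X Y Z) := by
  rw [Fintype.linearIndependent_iff]
  intro g hg
  simp only [Fin.sum_univ_four, quatGen, Matrix.cons_val] at hg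
  have g0 : g 0 = 0 := by
    have := congrArg (Z * ·) hg
    simp only [mul_add, mul_smul_comm, h.zx', h.zy', h.zz, h.zy, mul_zero, smul_zero, add_zero,
      smul_eq_zero, h0, or_false] at this
    exact this
  rw [g0, zero_smul, zero_add] at hg
  have g2 : g 2 = 0 := by
    have := congrArg (X * ·) hg
    simp only [mul_add, mul_smul_comm, h.xx', h.zy', h.zz, mul_zero, smul_zero, add_zero, zero_add,
      smul_eq_zero, h0, or_false] at this
    exact this
  have g1 : g 1 = 0 := by
    have := congrArg (Y * ·) hg
    simp only [g2, mul_add, mul_smul_comm, h.yx', h.yy', h.zy', h.zz, mul_zero, smul_zero, add_zero,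
      smul_eq_zero, h0, or_false] at this
    exact this
  rw [g1, g2, zero_smul, zero_smul, zero_add, zero_add, smul_eq_zero, or_iff_left h0] at hg
  intro i
  fin_cases i <;> assumption

end QuatRel

end QuatSpan

theorem Q_induction {P : Q → Prop} (h1 : P 1) (hi : ∀ x, P x → P (Qi * x))
    (hj : ∀ x, P x → P (Qj * x)) (x : Q) : P x := by
  have hx : x ∈ Subgroup.closure {Qi, Qj} := closure_Qi_Qj ▸ Subgroup.mem_top x
  have ei : Qi⁻¹ = Qi * (Qi * Qi) := Subtype.ext qi_inv
  have ej : Qj⁻¹ = Qj * (Qi * Qi) := Subtype.ext qj_inv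
  induction hx using Subgroup.closure_induction_left with
  | one => exact h1
  | mul_left x hx y _ hy =>
    rcases hx with rfl | rfl
    · exact hi _ hy
    · exact hj _ hy
  | inv_mul_cancel x hx y _ hy =>
    rcases hx with rfl | rfl
    · rw [ei, mul_assoc, mul_assoc]; exact hi _ (hi _ (hi _ hy))
    · rw [ej, mul_assoc, mul_assoc]; exact hj _ (hi _ (hi _ hy))

theorem of_eq_one_sub {k : Type*} [Field k] {G : Type*} [Group G] (g : G) :
    MonoidAlgebra.of k G g = 1 - om k g := by rw [om, sub_sub_cancel]

section IdealM

variable {k : Type*} [Field k]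

/-- The underlying subspace of the ideal `M_q`. -/
noncomputable abbrev mSpan (ω : k) : Submodule k (MonoidAlgebra k Q) :=
  quatSpan ω (om k Qi) (om k Qj) (om k (Qi * Qi))

theorem om_Q_ne_zero [CharP k 2] : om k Qi * (om k Qj * om k (Qi * Qi)) ≠ 0 := fun h => by
  have := congrArg (incl k) h
  rw [incl_q, map_zero] at this
  exact q_ne_zero k this

variable [CharP k 2] {ω : k}

theorem mul_mem_mSpan (x : MonoidAlgebra k Q) {w : MonoidAlgebra k Q} (hw : w ∈ mSpan ω) :
    x * w ∈ mSpan ω := by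
  induction x using MonoidAlgebra.induction_on with
  | of x =>
    induction x using Q_induction with
    | h1 => rwa [map_one, one_mul]
    | hi x hx =>
      rw [map_mul, mul_assoc, of_eq_one_sub Qi, sub_mul, one_mul]
      exact sub_mem hx ((quatRel_Q k).X_mul_mem hx)
    | hj x hx =>
      rw [map_mul, mul_assoc, of_eq_one_sub Qj, sub_mul, one_mul]
      exact sub_mem hx ((quatRel_Q k).Y_mul_mem hx)
  | add x y hx hy => rw [add_mul]; exact add_mem hx hy
  | smul r x hx => rw [smul_mul_assoc]; exact Submodule.smul_mem _ _ hx

theorem mSpan_mul_mem (x : MonoidAlgebra k Q) {w : MonoidAlgebra k Q} (hw : w ∈ mSpan ω) :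
    w * x ∈ mSpan ω := by
  induction x using MonoidAlgebra.induction_on with
  | of x =>
    induction x using Q_induction generalizing w with
    | h1 => rwa [map_one, mul_one]
    | hi x hx =>
      rw [map_mul, ← mul_assoc, of_eq_one_sub Qi, mul_sub, mul_one]
      exact hx (sub_mem hw ((quatRel_Q k).mul_X_mem hw))
    | hj x hx =>
      rw [map_mul, ← mul_assoc, of_eq_one_sub Qj, mul_sub, mul_one]
      exact hx (sub_mem hw ((quatRel_Q k).mul_Y_mem hw))
  | add x y hx hy => rw [mul_add]; exact add_mem hx hy
  | smul r x hx => rw [mul_smul_comm]; exact Submodule.smul_mem _ _ hx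

/-- The ideal `M_q` of `kQ`. -/
noncomputable def mIdeal (ω : k) : TwoSidedIdeal (MonoidAlgebra k Q) :=
  .mk' (mSpan ω) (zero_mem _) add_mem neg_mem (mul_mem_mSpan _) (mSpan_mul_mem _)

theorem mem_mIdeal {x : MonoidAlgebra k Q} : x ∈ mIdeal ω ↔ x ∈ mSpan ω :=
  TwoSidedIdeal.mem_mk' ..

theorem coe_mIdeal : (mIdeal ω : Set (MonoidAlgebra k Q)) = mSpan ω :=
  Set.ext fun _ => mem_mIdeal

theorem finrank_mIdeal : Module.finrank k ((mIdeal ω).asIdeal.restrictScalars k) = 4 := by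
  have : (mIdeal ω).asIdeal.restrictScalars k = mSpan ω := by
    ext x
    rw [Submodule.restrictScalars_mem, TwoSidedIdeal.mem_asIdeal, mem_mIdeal]
  rw [this, mSpan, quatSpan,
    finrank_span_eq_card ((quatRel_Q k).linearIndependent om_Q_ne_zero), Fintype.card_fin]

theorem J_Q_pow_two : J (MonoidAlgebra k Q) 2 = Ideal.span {om k Qi * om k Qj, om k (Qi * Qi)} := by
  rw [J, jacobson_Q, (quatRel_Q k).span_sq (isTwoSided_Q k)]

theorem J_Q_pow_three : J (MonoidAlgebra k Q) 3 =
    Ideal.span {om k Qi * om k (Qi * Qi), om k Qj * om k (Qi * Qi)} := by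
  rw [J, jacobson_Q, (quatRel_Q k).span_cube (isTwoSided_Q k)]

/-- The element Z is central with square zero, so it annihilates J³ = (XZ, YZ); but its product with
XY + ω²Z is XYZ ≠ 0. -/
theorem J_Q_lt_mIdeal : J (MonoidAlgebra k Q) 3 < (mIdeal ω).asIdeal := by
  rw [J_Q_pow_three]
  refine lt_of_le_of_ne (Ideal.span_le.2 ?_) fun h => ?_
  · rintro _ (rfl | rfl)
    · exact mem_mIdeal.2 mem_quatSpan₁
    · exact mem_mIdeal.2 mem_quatSpan₂
  · have hm : om k Qi * om k Qj + ω ^ 2 • om k (Qi * Qi) ∈ (mIdeal ω).asIdeal :=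
      mem_mIdeal.2 mem_quatSpan₀
    rw [← h] at hm
    obtain ⟨c, d, h⟩ := Ideal.mem_span_pair.1 hm
    apply om_Q_ne_zero (k := k)
    have H := quatRel_Q k
    have hz : ∀ x, om k (Qi * Qi) * x = x * om k (Qi * Qi) := fun x => by
      induction x using MonoidAlgebra.induction_on with
      | of x =>
        induction x using Q_induction with
        | h1 => rw [map_one, one_mul, mul_one]
        | hi x hx =>
          rw [map_mul, of_eq_one_sub Qi, ← mul_assoc, mul_sub, H.zx, mul_one, sub_mul, mul_assoc,
            hx, sub_mul, sub_mul, mul_assoc, one_mul, mul_assoc (om k Qi)]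
        | hj x hx =>
          rw [map_mul, of_eq_one_sub Qj, ← mul_assoc, mul_sub, H.zy, mul_one, sub_mul, mul_assoc,
            hx, sub_mul, sub_mul, mul_assoc, one_mul, mul_assoc (om k Qj)]
      | add x y hx hy => rw [mul_add, add_mul, hx, hy]
      | smul r x hx => rw [mul_smul_comm, smul_mul_assoc, hx]
    rw [← H.Z_mul_quatGen_zero (ω := ω), ← h, hz]
    simp only [add_mul, mul_assoc, H.zz, mul_zero, add_zero]

/-- If XY were in M_q, comparing products with Z would give coefficient 1 on the first generator,
hence ω²Z in the span of XZ, YZ, XYZ. Left multiplication by XY kills that span but sends ω²Z to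
ω²XYZ ≠ 0. -/
theorem mIdeal_lt_J_Q (hω : ω ≠ 0) : (mIdeal ω).asIdeal < J (MonoidAlgebra k Q) 2 := by
  have H := quatRel_Q k
  have hXY : om k Qi * om k Qj ∈ Ideal.span {om k Qi * om k Qj, om k (Qi * Qi)} :=
    Ideal.subset_span (by simp)
  have hZ : om k (Qi * Qi) ∈ Ideal.span {om k Qi * om k Qj, om k (Qi * Qi)} :=
    Ideal.subset_span (by simp)
  rw [J_Q_pow_two]
  refine lt_of_le_of_ne ?_ fun h => ?_
  · intro x hx
    refine quatSpan_le (W := (Ideal.span _).restrictScalars k) ?_ ?_ ?_ ?_ (mem_mIdeal.1 hx)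
    · exact add_mem hXY (Submodule.smul_of_tower_mem _ _ hZ)
    · exact Ideal.mul_mem_left _ _ hZ
    · exact Ideal.mul_mem_left _ _ hZ
    · exact Ideal.mul_mem_left _ _ (Ideal.mul_mem_left _ _ hZ)
  · rw [← h, TwoSidedIdeal.mem_asIdeal, mem_mIdeal] at hXY
    obtain ⟨c, hc, hc'⟩ := H.Z_mul_mem hXY
    have hc1 : c = 1 := by
      rw [H.zx', H.zy] at hc
      have : (c - 1) • (om k Qi * (om k Qj * om k (Qi * Qi))) = 0 := by
        rw [sub_smul, one_smul, ← hc, sub_self]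
      exact sub_eq_zero.1 ((smul_eq_zero.1 this).resolve_right om_Q_ne_zero)
    rw [hc1, one_smul, sub_add_cancel_left] at hc'
    have hker : ∀ u ∈ Submodule.span k {om k Qi * om k (Qi * Qi), om k Qj * om k (Qi * Qi),
        om k Qi * (om k Qj * om k (Qi * Qi))}, om k Qi * (om k Qj * u) = 0 := by
      intro u hu
      induction hu using Submodule.span_induction with
      | mem u hu =>
        rcases hu with rfl | rfl | rfl
        · simp only [H.yx', H.xx', H.zy', H.zz, mul_zero, add_zero]
        · simp only [H.yy', H.zz, mul_zero]
        · simp only [H.yx', H.yy', H.zy', H.zz, mul_zero, add_zero]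
      | zero => simp
      | add u v _ _ hu hv => rw [mul_add, mul_add, hu, hv, add_zero]
      | smul r u _ hu => rw [mul_smul_comm, mul_smul_comm, hu, smul_zero]
    have := hker _ hc'
    rw [mul_neg, mul_neg, neg_eq_zero, mul_smul_comm, mul_smul_comm, smul_eq_zero] at this
    exact this.elim (pow_ne_zero 2 hω) om_Q_ne_zero

theorem mIdeal_sup (hω : ω ^ 2 + ω + 1 = 0) :
    (mIdeal ω).asIdeal ⊔ (mIdeal (ω + 1)).asIdeal = J (MonoidAlgebra k Q) 2 := by
  have h2 := CharTwo.two_eq_zero (R := k)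
  have h0 : ω ≠ 0 := by rintro rfl; simp at hω
  have h0' : ω + 1 ≠ 0 := by intro h; rw [add_eq_zero_iff_eq_neg.1 h] at hω; norm_num at hω
  refine le_antisymm (sup_le (mIdeal_lt_J_Q h0).le (mIdeal_lt_J_Q h0').le) ?_
  have hm : om k Qi * om k Qj + ω ^ 2 • om k (Qi * Qi) ∈ (mIdeal ω).asIdeal :=
    mem_mIdeal.2 mem_quatSpan₀
  have hm' : om k Qi * om k Qj + (ω + 1) ^ 2 • om k (Qi * Qi) ∈ (mIdeal (ω + 1)).asIdeal :=
    mem_mIdeal.2 mem_quatSpan₀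
  -- In characteristic 2, (ω + 1)² - ω² = 1, so the first generators of the two ideals differ by Z.
  have hZ : om k (Qi * Qi) ∈ (mIdeal ω).asIdeal ⊔ (mIdeal (ω + 1)).asIdeal := by
    have := sub_mem (Ideal.mem_sup_right hm') (Ideal.mem_sup_left hm)
    rwa [add_sub_add_left_eq_sub, ← sub_smul, show (ω + 1) ^ 2 - ω ^ 2 = 1 by grind, one_smul] at this
  rw [J_Q_pow_two, Ideal.span_le]
  rintro _ (rfl | rfl)
  · have := sub_mem (Ideal.mem_sup_left hm : _ ∈ (mIdeal ω).asIdeal ⊔ (mIdeal (ω + 1)).asIdeal)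
      (Submodule.smul_of_tower_mem _ (ω ^ 2) hZ)
    rwa [add_sub_cancel_right] at this
  · exact hZ

end IdealM

end CubicBraid

namespace CubicBraid

/-! ### Extension of scalars from the field with four elements -/

section ScalarExt

theorem exists_root_F₄ : ∃ ω : F₄, ω ^ 2 + ω + 1 = 0 := by
  have hc : Nat.card F₄ = 4 := by rw [GaloisField.card 2 2 two_ne_zero]; norm_num
  classical
  have : Fintype F₄ := Fintype.ofFinite _
  have : ∃ ω : F₄, ω ∉ ({0, 1} : Finset F₄) := by
    by_contra! h
    have := Finset.card_le_card (Finset.eq_univ_iff_forall.2 h).ge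
    rw [Finset.card_univ, ← Nat.card_eq_fintype_card, hc] at this
    exact absurd (this.trans Finset.card_le_two) (by norm_num)
  obtain ⟨ω, hω⟩ := this
  simp only [Finset.mem_insert, Finset.mem_singleton, not_or] at hω
  have h4 : ω ^ 4 = ω := by
    have := FiniteField.pow_card ω
    rwa [← Nat.card_eq_fintype_card, hc] at this
  refine ⟨ω, ?_⟩
  have : ω * (ω - 1) * (ω ^ 2 + ω + 1) = 0 := by linear_combination h4
  exact (mul_eq_zero.1 this).resolve_left (mul_ne_zero hω.1 (sub_ne_zero.2 hω.2))

variable {k : Type*} [Field k]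

theorem mapRingHom_om (φ : F₄ →+* k) (x : Q) :
    MonoidAlgebra.mapRingHom Q φ (om F₄ x) = om k x := by
  rw [om, om, map_sub, map_one, MonoidAlgebra.of_apply, MonoidAlgebra.mapRingHom_single, map_one]
  rfl

theorem mapRingHom_smul (φ : F₄ →+* k) (c : F₄) (x : MonoidAlgebra F₄ Q) :
    MonoidAlgebra.mapRingHom Q φ (c • x) = φ c • MonoidAlgebra.mapRingHom Q φ x := by
  rw [← mul_one x, ← mul_smul_comm, map_mul, map_mul, ← mul_smul_comm]
  congr 1
  rw [MonoidAlgebra.one_def, MonoidAlgebra.smul_single, MonoidAlgebra.mapRingHom_single,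
    MonoidAlgebra.mapRingHom_single, MonoidAlgebra.smul_single, map_one, smul_eq_mul, smul_eq_mul,
    mul_one, mul_one]

theorem scalarExt_mIdeal (φ : F₄ →+* k) (ω : F₄) : scalarExt φ (mIdeal ω) = mSpan (φ ω) := by
  rw [scalarExt, coe_mIdeal]
  have hg : ∀ i, MonoidAlgebra.mapRingHom Q φ (quatGen ω (om F₄ Qi) (om F₄ Qj) (om F₄ (Qi * Qi)) i)
      = quatGen (φ ω) (om k Qi) (om k Qj) (om k (Qi * Qi)) i := by
    intro i
    fin_cases i <;> simp [quatGen, mapRingHom_om, mapRingHom_smul]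
  apply le_antisymm
  · rw [Submodule.span_le]
    rintro _ ⟨x, hx, rfl⟩
    induction hx using Submodule.span_induction with
    | mem x hx =>
      obtain ⟨i, rfl⟩ := hx
      rw [hg]
      exact Submodule.subset_span ⟨i, rfl⟩
    | zero => rw [map_zero]; exact zero_mem _
    | add x y _ _ hx hy => rw [map_add]; exact add_mem hx hy
    | smul r x _ hx => rw [mapRingHom_smul]; exact Submodule.smul_mem _ _ hx
  · rw [mSpan, quatSpan, Submodule.span_le]
    rintro _ ⟨i, rfl⟩
    rw [← hg]
    exact Submodule.subset_span ⟨_, Submodule.subset_span ⟨i, rfl⟩, rfl⟩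

/-- Conjugating and then extending scalars is extension along the composite with Frobenius, so the
conjugate ideal is again given by `scalarExt_mIdeal`, with the square of the root. -/
theorem scalarExt_galoisConj (φ : F₄ →+* k) (S : Set (MonoidAlgebra F₄ Q)) :
    scalarExt φ (galoisConj S) = scalarExt (φ.comp (frobenius F₄ 2)) S := by
  rw [scalarExt, scalarExt, galoisConj, Set.image_image]
  congr 2
  ext x
  rw [MonoidAlgebra.mapRingHom_comp]
  rfl

end ScalarExt

/-! ### The ideals `I_q` of `kΓ₃` -/

section IdealI

variable {k : Type*} [Field k] {ω : k}

theorem s₁_mul_incl (w : MonoidAlgebra k Q) : MonoidAlgebra.of k _ (s₁ 3 le_rfl) * incl k w =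
    incl k (conjAut k c₁ w) * MonoidAlgebra.of k _ (s₁ 3 le_rfl) := by
  induction w using MonoidAlgebra.induction_on with
  | of x =>
    have : conjAut k c₁ (MonoidAlgebra.of k Q x) =
      MonoidAlgebra.of k Q (MulAut.conjNormal (s₁ 3 le_rfl) x) := MonoidAlgebra.domCongr_single ..
    rw [this, incl_of, incl_of, ← map_mul, ← map_mul, MulAut.conjNormal_apply,
      inv_mul_cancel_right]
  | add x y hx hy => simp only [map_add, mul_add, add_mul, hx, hy]
  | smul r x hx => rw [map_smul (conjAut k c₁), incl_smul, incl_smul, mul_smul_comm, hx, smul_mul_assoc]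

theorem conjAut_om (x : Q) : conjAut k c₁ (om k x) =
    om k (MulAut.conjNormal (s₁ 3 le_rfl) x) := by
  rw [om, om, map_sub, map_one]
  congr 1
  exact MonoidAlgebra.domCongr_single ..

theorem incl_X : incl k (om k Qi) = om k qi := incl_om k Qi

theorem incl_Y : incl k (om k Qj) = om k qj := incl_om k Qj

theorem incl_Z : incl k (om k (Qi * Qi)) = om k (qi * qi) := incl_om k (Qi * Qi)

theorem mem_mulC₃ {w : MonoidAlgebra k Q} (hw : w ∈ mSpan ω) {c : Γ 3} (hc : c ∈ C₃) :
    incl k w * MonoidAlgebra.of k (Γ 3) c ∈ mulC₃ (mSpan ω : Set (MonoidAlgebra k Q)) :=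
  Submodule.subset_span ⟨w, hw, c, hc, rfl⟩

theorem mulC₃_le {W : Submodule k (MonoidAlgebra k (Γ 3))}
    (h : ∀ w ∈ mSpan ω, ∀ c ∈ C₃, incl k w * MonoidAlgebra.of k (Γ 3) c ∈ W) :
    mulC₃ (mSpan ω : Set (MonoidAlgebra k Q)) ≤ W :=
  Submodule.span_le.2 (by rintro _ ⟨w, hw, c, hc, rfl⟩; exact h w hw c hc)

variable [CharP k 2]

theorem conjAut_X : conjAut k c₁ (om k Qi) = om k Qi + om k Qj + om k Qi * om k Qj := by
  rw [conjAut_om, ← om_mul]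
  congr 1
  exact Subtype.ext s₁_conj_qi

theorem conjAut_Y : conjAut k c₁ (om k Qj) =
    om k Qi + om k (Qi * Qi) + om k Qi * om k (Qi * Qi) := by
  rw [conjAut_om, ← om_mul]
  congr 1
  exact Subtype.ext (s₁_conj_qj.trans qi_inv)

theorem conjAut_Z : conjAut k c₁ (om k (Qi * Qi)) = om k (Qi * Qi) := by
  have H := quatRel_Q k
  rw [← H.yy, map_mul, conjAut_Y]
  simp only [mul_add, add_mul, mul_assoc, H.xx, H.xx', H.zx, H.zx', H.zz, mul_zero, add_zero, H.yy]
  rw [add_assoc, H.add_self, add_zero]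

/-- Conjugation by s₁ fixes XY + ω²Z up to XZ + YZ and preserves the span of XZ, YZ, XYZ. This is
what makes M_q C₃ a left ideal of kΓ₃. -/
theorem conjAut_mem_mSpan {w : MonoidAlgebra k Q} (hw : w ∈ mSpan ω) :
    conjAut k c₁ w ∈ mSpan ω := by
  have H := quatRel_Q k
  refine quatSpan_le (W := (mSpan ω).comap (conjAut k c₁).toLinearMap) ?_ ?_ ?_ ?_ hw <;>
    simp only [Submodule.mem_comap, AlgEquiv.toLinearMap_apply, map_add, map_mul, map_smul,
      conjAut_X, conjAut_Y, conjAut_Z]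
  · have e : (om k Qi + om k Qj + om k Qi * om k Qj) *
        (om k Qi + om k (Qi * Qi) + om k Qi * om k (Qi * Qi)) + ω ^ 2 • om k (Qi * Qi) =
        om k Qi * om k Qj + ω ^ 2 • om k (Qi * Qi) + om k Qi * om k (Qi * Qi) +
          om k Qj * om k (Qi * Qi) := by
      simp only [mul_add, add_mul, mul_assoc, H.xx, H.xx', H.yx, H.yx', H.zz, mul_zero, add_zero,
        H.zy, H.zy']
      match_scalars <;> grind [CharTwo.two_eq_zero (R := k)]
    rw [e]
    exact add_mem (add_mem mem_quatSpan₀ mem_quatSpan₁) mem_quatSpan₂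
  · simp only [add_mul, mul_assoc]
    exact add_mem (add_mem mem_quatSpan₁ mem_quatSpan₂) mem_quatSpan₃
  · simp only [add_mul, mul_assoc, H.zz, mul_zero, add_zero]
    exact mem_quatSpan₁
  · simp only [add_mul, mul_assoc, H.zz, mul_zero, add_zero, H.xx', H.yxz, H.zy', zero_add]
    exact mem_quatSpan₃

theorem mulC₃_mul_mem (x : MonoidAlgebra k (Γ 3)) {y : MonoidAlgebra k (Γ 3)}
    (hy : y ∈ mulC₃ (mSpan ω : Set (MonoidAlgebra k Q))) :
    y * x ∈ mulC₃ (mSpan ω : Set (MonoidAlgebra k Q)) := by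
  induction x using MonoidAlgebra.induction_on with
  | of g =>
    refine mulC₃_le (W := (mulC₃ _).comap
      (LinearMap.mulRight k (MonoidAlgebra.of k _ g))) ?_ hy
    intro w hw c _
    obtain ⟨x, d, hx⟩ := eq_mul_retr (c * g)
    rw [Submodule.mem_comap, LinearMap.mulRight_apply, mul_assoc, ← map_mul, hx,
      map_mul, ← incl_of, ← mul_assoc, ← map_mul]
    exact mem_mulC₃ (mSpan_mul_mem _ hw) d.2
  | add x x' hx hx' => rw [mul_add]; exact add_mem hx hx'
  | smul r x hx => rw [mul_smul_comm]; exact Submodule.smul_mem _ _ hx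

theorem mul_mem_mulC₃ (x : MonoidAlgebra k (Γ 3)) {y : MonoidAlgebra k (Γ 3)}
    (hy : y ∈ mulC₃ (mSpan ω : Set (MonoidAlgebra k Q))) :
    x * y ∈ mulC₃ (mSpan ω : Set (MonoidAlgebra k Q)) := by
  have hQ : ∀ (x : Q) (y), y ∈ mulC₃ (mSpan ω : Set (MonoidAlgebra k Q)) →
      MonoidAlgebra.of k _ (x : Γ 3) * y ∈ mulC₃ (mSpan ω : Set (MonoidAlgebra k Q)) := by
    intro x y hy
    refine mulC₃_le (W := (mulC₃ _).comap
      (LinearMap.mulLeft k (MonoidAlgebra.of k _ (x : Γ 3)))) ?_ hy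
    intro w hw c hc
    rw [Submodule.mem_comap, LinearMap.mulLeft_apply, ← incl_of, ← mul_assoc,
      ← map_mul]
    exact mem_mulC₃ (mul_mem_mSpan _ hw) hc
  have hs : ∀ y, y ∈ mulC₃ (mSpan ω : Set (MonoidAlgebra k Q)) →
      MonoidAlgebra.of k _ (s₁ 3 le_rfl) * y ∈ mulC₃ (mSpan ω : Set (MonoidAlgebra k Q)) := by
    intro y hy
    refine mulC₃_le (W := (mulC₃ _).comap
      (LinearMap.mulLeft k (MonoidAlgebra.of k _ (s₁ 3 le_rfl)))) ?_ hy
    intro w hw c hc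
    rw [Submodule.mem_comap, LinearMap.mulLeft_apply, ← mul_assoc, s₁_mul_incl,
      mul_assoc, ← map_mul]
    exact mem_mulC₃ (conjAut_mem_mSpan hw) (mul_mem (Subgroup.mem_zpowers _) hc)
  induction x using MonoidAlgebra.induction_on with
  | of g =>
    induction g using Γ₃_induction with
    | h1 => rwa [map_one, one_mul]
    | hs g hg => rw [map_mul, mul_assoc]; exact hs _ hg
    | ht g hg =>
      rw [map_mul, mul_assoc, s₂_eq, map_mul, mul_assoc,
        show qi⁻¹ = ((Qi⁻¹ : Q) : Γ 3) from rfl]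
      exact hQ _ _ (hs _ hg)
  | add x x' hx hx' => rw [add_mul]; exact add_mem hx hx'
  | smul r x hx => rw [smul_mul_assoc]; exact Submodule.smul_mem _ _ hx

/-- The ideal `I_q` of `kΓ₃`. -/
noncomputable def iIdeal (ω : k) : TwoSidedIdeal (MonoidAlgebra k (Γ 3)) :=
  .mk' (mulC₃ (mSpan ω : Set (MonoidAlgebra k Q))) (zero_mem _) add_mem neg_mem (mul_mem_mulC₃ _)
    (mulC₃_mul_mem _)

theorem mem_iIdeal {x : MonoidAlgebra k (Γ 3)} :
    x ∈ iIdeal ω ↔ x ∈ mulC₃ (mSpan ω : Set (MonoidAlgebra k Q)) :=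
  TwoSidedIdeal.mem_mk' ..

theorem coe_iIdeal : (iIdeal ω : Set (MonoidAlgebra k (Γ 3))) =
    mulC₃ (mIdeal ω : Set (MonoidAlgebra k Q)) := by
  rw [coe_mIdeal]
  exact Set.ext fun _ => mem_iIdeal

theorem mem_iIdeal_of_mem {x : MonoidAlgebra k (Γ 3)}
    (hx : x ∈ quatSpan ω (om k qi) (om k qj) (om k (qi * qi))) : x ∈ iIdeal ω := by
  have h : ∀ w ∈ mSpan ω, incl k w ∈ (iIdeal ω).asIdeal.restrictScalars k := fun w hw => by
    have := mem_mulC₃ hw (one_mem C₃)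
    rw [map_one, mul_one] at this
    exact mem_iIdeal.2 this
  refine quatSpan_le (W := (iIdeal ω).asIdeal.restrictScalars k) ?_ ?_ ?_ ?_ hx
  · simpa only [map_add, map_mul, incl_smul, incl_X, incl_Y, incl_Z] using h _ mem_quatSpan₀
  · simpa only [map_mul, incl_X, incl_Y, incl_Z] using h _ mem_quatSpan₁
  · simpa only [map_mul, incl_X, incl_Y, incl_Z] using h _ mem_quatSpan₂
  · simpa only [map_mul, incl_X, incl_Y, incl_Z] using h _ mem_quatSpan₃

theorem iIdeal_le {I : TwoSidedIdeal (MonoidAlgebra k (Γ 3))}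
    (h0 : om k qi * om k qj + ω ^ 2 • om k (qi * qi) ∈ I) (h1 : om k qi * om k (qi * qi) ∈ I)
    (h2 : om k qj * om k (qi * qi) ∈ I) (h3 : om k qi * (om k qj * om k (qi * qi)) ∈ I) :
    iIdeal ω ≤ I := by
  intro x hx
  refine mulC₃_le (W := I.asIdeal.restrictScalars k) ?_ (mem_iIdeal.1 hx)
  intro w hw c _
  refine I.mul_mem_right _ _ ?_
  induction hw using Submodule.span_induction with
  | mem w hw =>
    obtain ⟨i, rfl⟩ := hw
    fin_cases i
    · change incl k (om k Qi * om k Qj + ω ^ 2 • om k (Qi * Qi)) ∈ I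
      simpa only [map_add, map_mul, incl_smul, incl_X, incl_Y, incl_Z] using h0
    · change incl k (om k Qi * om k (Qi * Qi)) ∈ I
      simpa only [map_mul, incl_X, incl_Y, incl_Z] using h1
    · change incl k (om k Qj * om k (Qi * Qi)) ∈ I
      simpa only [map_mul, incl_X, incl_Y, incl_Z] using h2
    · change incl k (om k Qi * (om k Qj * om k (Qi * Qi))) ∈ I
      simpa only [map_mul, incl_X, incl_Y, incl_Z] using h3
  | zero => rw [map_zero]; exact zero_mem _
  | add x y _ _ hx hy => rw [map_add]; exact add_mem hx hy
  | smul r x _ hx =>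
    have := Submodule.smul_of_tower_mem I.asIdeal r hx
    rwa [← incl_smul] at this

end IdealI

end CubicBraid

namespace CubicBraid

/-! ### The image of `q` in the matrices over `kΓ₃` -/

section PhiQ

variable {k : Type*} [Field k] {ω : k}

theorem mapDomain_q :
    MonoidAlgebra.mapDomainRingHom k inj₃₄ (q k 3 le_rfl) = q k 4 three_le_four := by
  simp only [q, map_add, mapDomainRingHom_of, map_mul, map_pow, map_one, inj₃₄_s₁, inj₃₄_s₂]

/-- The hypotheses compare coefficients on 1, X, Y, Z, XY, XZ, YZ, XYZ after expansion, signs being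
irrelevant in characteristic 2. Membership in M_q forces those of 1, X, Y to vanish and that of Z to
be ω² times that of XY. -/
theorem combination_eq [CharP k 2] {R : Type*} [Ring R] [Algebra k R] (X Y Z : R)
    {c ci ciz cj cjz cijz cij cz : k} {d : Fin 4 → k}
    (h : c + ci + cj + cz + cij + ciz + cjz + cijz = 0) (hX : ci + ciz + cij + cijz = 0)
    (hY : cj + cjz + cij + cijz = 0) (hZ : cz + ciz + cjz + cijz = d 0 * ω ^ 2)
    (hXY : cij + cijz = d 0) (hXZ : ciz + cijz = d 1) (hYZ : cjz + cijz = d 2) (hXYZ : cijz = d 3) :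
    c • 1 + ci • (1 - X) + ciz • ((1 - X) * (1 - Z)) + cj • (1 - Y) + cjz • ((1 - Y) * (1 - Z)) +
      cijz • ((1 - X) * (1 - Y) * (1 - Z)) + cij • ((1 - X) * (1 - Y)) + cz • (1 - Z) =
    ∑ i, d i • quatGen ω X Y Z i := by
  have h2 := CharTwo.two_eq_zero (R := k)
  simp only [Fin.sum_univ_four, quatGen, sub_mul, mul_sub, one_mul, mul_one, mul_assoc,
    Matrix.cons_val]
  match_scalars <;> grind

variable [CharP k 2] (hω : ω ^ 2 + ω + 1 = 0)

theorem rho_qi : rho hω (inj₃₄ qi) = !![1, ω, ω + 1; ω + 1, ω + 1, ω + 1; ω, 1, ω + 1] := by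
  have h2 := CharTwo.two_eq_zero (R := k)
  rw [qi, inv_eq_sq_of_cube (s₂_cube 3 _), map_mul, map_mul, map_pow, map_pow, inj₃₄_s₁, inj₃₄_s₂,
    rho_s₁, rho_s₂, pow_two, matS, matT]
  simp only [Matrix.mul_fin_three]
  refine fin_three_congr ?_ ?_ ?_ ?_ ?_ ?_ ?_ ?_ ?_ <;> grind

theorem rho_qj : rho hω (inj₃₄ qj) = !![1, 1, ω; 1, ω, 1; ω + 1, ω, ω] := by
  have h2 := CharTwo.two_eq_zero (R := k)
  rw [qj, inv_eq_sq_of_cube (s₁_cube 3 _), map_mul, map_mul, map_pow, map_pow, inj₃₄_s₁, inj₃₄_s₂,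
    rho_s₁, rho_s₂, pow_two, matS, matT]
  simp only [Matrix.mul_fin_three]
  refine fin_three_congr ?_ ?_ ?_ ?_ ?_ ?_ ?_ ?_ ?_ <;> grind

theorem rho_qi_qi : rho hω (inj₃₄ (qi * qi)) = !![1, 0, 0; 0, 0, ω; 0, ω + 1, 0] := by
  have h2 := CharTwo.two_eq_zero (R := k)
  rw [map_mul, map_mul, rho_qi]
  simp only [Matrix.mul_fin_three]
  refine fin_three_congr ?_ ?_ ?_ ?_ ?_ ?_ ?_ ?_ ?_ <;> grind

theorem rho_qi_qj : rho hω (inj₃₄ (qi * qj)) =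
    !![1, ω + 1, 1; ω, ω + 1, ω + 1; 1, 1, ω + 1] := by
  have h2 := CharTwo.two_eq_zero (R := k)
  rw [map_mul, map_mul, rho_qi, rho_qj]
  simp only [Matrix.mul_fin_three]
  refine fin_three_congr ?_ ?_ ?_ ?_ ?_ ?_ ?_ ?_ ?_ <;> grind

theorem rho_qi_z : rho hω (inj₃₄ (qi * (qi * qi))) =
    !![1, ω, ω + 1; ω + 1, ω, 1; ω, ω, ω] := by
  have h2 := CharTwo.two_eq_zero (R := k)
  rw [map_mul, map_mul, rho_qi, rho_qi_qi]
  simp only [Matrix.mul_fin_three]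
  refine fin_three_congr ?_ ?_ ?_ ?_ ?_ ?_ ?_ ?_ ?_ <;> grind

theorem rho_qj_z : rho hω (inj₃₄ (qj * (qi * qi))) =
    !![1, 1, ω; 1, ω + 1, ω + 1; ω + 1, 1, ω + 1] := by
  have h2 := CharTwo.two_eq_zero (R := k)
  rw [map_mul, map_mul, rho_qj, rho_qi_qi]
  simp only [Matrix.mul_fin_three]
  refine fin_three_congr ?_ ?_ ?_ ?_ ?_ ?_ ?_ ?_ ?_ <;> grind

theorem rho_qi_qj_z : rho hω (inj₃₄ (qi * qj * (qi * qi))) =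
    !![1, ω + 1, 1; ω, ω, 1; 1, ω, ω] := by
  have h2 := CharTwo.two_eq_zero (R := k)
  rw [map_mul, map_mul, rho_qi_qj, rho_qi_qi]
  simp only [Matrix.mul_fin_three]
  refine fin_three_congr ?_ ?_ ?_ ?_ ?_ ?_ ?_ ?_ ?_ <;> grind

theorem Phi_mapDomain_of (g : Γ 3) (p q : Fin 3) :
    Phi hω (MonoidAlgebra.mapDomainRingHom k inj₃₄ (MonoidAlgebra.of k _ g)) p q =
      rho hω (inj₃₄ g) p q • MonoidAlgebra.of k _ g := by
  rw [mapDomainRingHom_of, Phi_of, proj₄₃_inj₃₄, Matrix.scalar_apply, Matrix.mul_diagonal,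
    AlgHom.mapMatrix_apply, Matrix.map_apply, Algebra.ofId_apply, Algebra.smul_def]

/-- The coefficients of `quatGen` in the entries of the image of `q`. -/
def coeffQ (ω : k) : Fin 4 → Matrix (Fin 3) (Fin 3) k :=
  ![!![0, 0, 0; 0, 1, ω; 0, ω + 1, 1], !![0, 1, ω; 1, 0, 0; ω + 1, 0, 0],
    !![0, ω, ω + 1; ω + 1, 1, ω; ω, ω + 1, 1], !![1, ω + 1, 1; ω, ω, 1; 1, ω, ω]]

/-- The entry at p, q' is the sum over the eight terms g of q of the scalar `rho hω (inj₃₄ g) p q'`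
times g. Expanding in X, Y, Z shows that it lies in the span M_q; the exact coefficients are needed
for the converse, `iIdeal_le_entryIdeal`. -/
theorem Phi_q (p q' : Fin 3) : Phi hω (q k 4 three_le_four) p q' =
    ∑ i, coeffQ ω i p q' • quatGen ω (om k qi) (om k qj) (om k (qi * qi)) i := by
  have h2 := CharTwo.two_eq_zero (R := k)
  have hq : q k 3 le_rfl = MonoidAlgebra.of k _ 1 + MonoidAlgebra.of k _ qi +
      MonoidAlgebra.of k _ (qi * (qi * qi)) + MonoidAlgebra.of k _ qj +
      MonoidAlgebra.of k _ (qj * (qi * qi)) + MonoidAlgebra.of k _ (qi * qj * (qi * qi)) +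
      MonoidAlgebra.of k _ (qi * qj) + MonoidAlgebra.of k _ (qi * qi) := by
    rw [q_eq, om, om, om, expand_q (quatRel_Γ₃ k).neg_eq]
    simp only [map_mul, map_one]
  rw [← mapDomain_q, hq]
  simp only [map_add, Matrix.add_apply, Phi_mapDomain_of]
  rw [rho_qi, rho_qj, rho_qi_qi, rho_qi_qj, rho_qi_z, rho_qj_z, rho_qi_qj_z, map_one inj₃₄,
    map_one (rho hω), Matrix.one_fin_three]
  simp only [map_one, map_mul _ _ qj, map_mul _ _ (qi * qi), of_eq_one_sub]
  clear hq
  apply combination_eq <;> fin_cases p <;> fin_cases q' <;> simp [coeffQ] <;> grind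

end PhiQ
end CubicBraid

namespace CubicBraid

/-! ### The decomposition of `kK₄` -/

section Assembly

theorem exists_mem_gen {A B : Type*} [Ring A] [Ring B] {f : A →+* B} (hf : Function.Surjective f)
    {x : A} {b : B} (hb : b ∈ gen (f x)) : ∃ y ∈ gen x, f y = b := by
  have : (Ideal.map f (gen x)).IsTwoSided := ⟨fun {a} b ha => by
    obtain ⟨y, hy, rfl⟩ := (Ideal.mem_map_iff_of_surjective f hf).1 ha
    obtain ⟨b, rfl⟩ := hf b
    rw [← map_mul]
    exact Ideal.mem_map_of_mem f (Ideal.mul_mem_right _ _ hy)⟩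
  exact (Ideal.mem_map_iff_of_surjective f hf).1
    (gen_le.2 (Ideal.mem_map_of_mem f (mem_gen x)) hb)

/-- The elements e₀, e₁, e₂ need not be central or idempotent in A: it is enough that they lift the
unit idempotents of the product, that they sum to 1 modulo x, and that each eᵢ carries the kernel of
ψᵢ into the ideal of x. -/
theorem nonempty_algEquiv_prod {k A B₀ B₁ B₂ : Type*} [Field k] [Ring A] [Algebra k A] [Ring B₀]
    [Algebra k B₀] [Ring B₁] [Algebra k B₁] [Ring B₂] [Algebra k B₂] {x : A} {ψ₀ : A →ₐ[k] B₀}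
    {ψ₁ : A →ₐ[k] B₁} {ψ₂ : A →ₐ[k] B₂} (hψ₀ : Function.Surjective ψ₀)
    (hψ₁ : Function.Surjective ψ₁) (hψ₂ : Function.Surjective ψ₂) {e₀ e₁ e₂ : A}
    (h₀ : ψ₀ e₀ = 1 ∧ ψ₀ e₁ = 0 ∧ ψ₀ e₂ = 0) (h₁ : ψ₁ e₀ = 0 ∧ ψ₁ e₁ = 1 ∧ ψ₁ e₂ = 0)
    (h₂ : ψ₂ e₀ = 0 ∧ ψ₂ e₁ = 0 ∧ ψ₂ e₂ = 1) (hx₀ : ψ₀ x = 0) (hx₁ : ψ₁ x = 0) (hx₂ : ψ₂ x = 0)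
    (hk₀ : ∀ y, ψ₀ y = 0 → e₀ * y ∈ gen x) (hk₁ : ∀ y, ψ₁ y = 0 → e₁ * y ∈ gen x)
    (hk₂ : ∀ y, ψ₂ y = 0 → e₂ * y ∈ gen x) (he : 1 - e₀ - e₁ - e₂ ∈ gen x) :
    Nonempty ((A ⧸ gen x) ≃ₐ[k] B₀ × B₁ × B₂) := by
  have hs : Function.Surjective (ψ₀.prod (ψ₁.prod ψ₂)) := by
    rintro ⟨b₀, b₁, b₂⟩
    obtain ⟨a₀, rfl⟩ := hψ₀ b₀
    obtain ⟨a₁, rfl⟩ := hψ₁ b₁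
    obtain ⟨a₂, rfl⟩ := hψ₂ b₂
    refine ⟨e₀ * a₀ + e₁ * a₁ + e₂ * a₂, ?_⟩
    simp [h₀, h₁, h₂]
  have hker : gen x = RingHom.ker (ψ₀.prod (ψ₁.prod ψ₂)) := by
    apply le_antisymm
    · rw [gen_le]
      simp [RingHom.mem_ker, hx₀, hx₁, hx₂]
    · intro y hy
      simp only [RingHom.mem_ker, AlgHom.prod_apply, Prod.mk_eq_zero] at hy
      have : y = (1 - e₀ - e₁ - e₂) * y + e₀ * y + e₁ * y + e₂ * y := by noncomm_ring
      rw [this]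
      exact add_mem (add_mem (add_mem (Ideal.mul_mem_right _ _ he) (hk₀ y hy.1)) (hk₁ y hy.2.1))
        (hk₂ y hy.2.2)
  exact ⟨(Ideal.quotientEquivAlgOfEq k hker).trans (Ideal.quotientKerAlgEquivOfSurjective hs)⟩

/-- The ideal of the elements which are the entries of the elements of a two-sided ideal of a
matrix ring. -/
def entryIdeal {R : Type*} [Ring R] (N : Ideal (Matrix (Fin 3) (Fin 3) R)) [N.IsTwoSided] :
    TwoSidedIdeal R :=
  .mk' {x | ∀ p q, Matrix.single p q x ∈ N} (fun p q => by simp)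
    (fun hx hy p q => by rw [Matrix.single_add]; exact add_mem (hx p q) (hy p q))
    (fun hx p q => by rw [← Matrix.single_neg]; exact neg_mem (hx p q))
    (fun {x y} hy p q => by
      rw [← Matrix.single_mul_single_same x p p q y]; exact N.mul_mem_left _ (hy p q))
    (fun {x y} hx p q => by
      rw [← Matrix.single_mul_single_same x p q q y]; exact Ideal.mul_mem_right _ _ (hx p q))

theorem mem_entryIdeal {R : Type*} [Ring R] (N : Ideal (Matrix (Fin 3) (Fin 3) R)) [N.IsTwoSided]
    {x : R} : x ∈ entryIdeal N ↔ ∀ p q, Matrix.single p q x ∈ N := TwoSidedIdeal.mem_mk' ..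

theorem entry_mem_entryIdeal {R : Type*} [Ring R] (N : Ideal (Matrix (Fin 3) (Fin 3) R))
    [N.IsTwoSided] {X : Matrix (Fin 3) (Fin 3) R} (hX : X ∈ N) (p q : Fin 3) :
    X p q ∈ entryIdeal N := by
  rw [mem_entryIdeal]
  intro i j
  have : Matrix.single i j (X p q) = Matrix.single i p 1 * X * Matrix.single q j 1 := by
    rw [Matrix.single_mul_mul_single, one_mul, mul_one]
  rw [this]
  exact Ideal.mul_mem_right _ _ (N.mul_mem_left _ hX)

variable {k : Type*} [Field k]

/-- The morphism from `kΓ₄` to `kΓ₃` induced by the projection. -/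
noncomputable abbrev proj (k : Type*) [Field k] : MonoidAlgebra k (Γ 4) →ₐ[k] MonoidAlgebra k (Γ 3) :=
  MonoidAlgebra.mapDomainAlgHom k k proj₄₃

theorem proj_of (g : Γ 4) : proj k (MonoidAlgebra.of k _ g) = MonoidAlgebra.of k _ (proj₄₃ g) :=
  mapDomainRingHom_of k proj₄₃ g

theorem proj_mapDomain (x : MonoidAlgebra k (Γ 3)) :
    proj k (MonoidAlgebra.mapDomainRingHom k inj₃₄ x) = x := by
  induction x using MonoidAlgebra.induction_on with
  | of g => rw [mapDomainRingHom_of, proj_of, proj₄₃_inj₃₄]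
  | add x y hx hy => rw [map_add, map_add, hx, hy]
  | smul r x hx =>
    rw [show MonoidAlgebra.mapDomainRingHom k inj₃₄ (r • x) =
      r • MonoidAlgebra.mapDomainRingHom k inj₃₄ x from MonoidAlgebra.mapDomain_smul _ _ _,
      map_smul, hx]

theorem proj_q : proj k (q k 4 three_le_four) = q k 3 le_rfl := by
  rw [← mapDomain_q, proj_mapDomain]

theorem proj_idem (ω : k) : proj k (idem ω) = algebraMap k _ (1 + ω + ω ^ 2) := by
  simp only [eig, map_add, map_smul, map_pow, proj_of, proj₄₃_z, map_one, one_pow, smul_pow,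
    Algebra.algebraMap_eq_smul_one]

variable [CharP k 2]

theorem proj_idemE : proj k (idemE k) = 1 := by
  have h2 := CharTwo.two_eq_zero (R := k)
  have h1 : proj k (idem 1) = 1 := by
    rw [proj_idem, show (1 + 1 + 1 ^ 2 : k) = 1 by grind, map_one]
  have : ∀ v, proj k (mu k v) = 1 := fun v => by
    rw [mu, map_mul, map_mul, map_pow, map_pow, map_mul, map_mul, proj_of, proj_of, proj₄₃_a,
      proj₄₃_b, h1]
    simp only [map_one, mul_one, one_pow]
  rw [idemE, map_sum, Finset.sum_congr rfl fun v _ => this v, Finset.sum_const, Finset.card_univ,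
    Fintype.card_prod, ZMod.card, ← Nat.cast_smul_eq_nsmul k,
    show ((3 * 3 : ℕ) : k) = 1 by push_cast; grind, one_smul]

/-- Since `idemE k` absorbs E on its right, `idemE k * x` depends only on the projection of x to
kΓ₃. -/
theorem idemE_mul (x : MonoidAlgebra k (Γ 4)) :
    idemE k * x = idemE k * MonoidAlgebra.mapDomainRingHom k inj₃₄ (proj k x) := by
  induction x using MonoidAlgebra.induction_on with
  | of g =>
    rw [proj_of, mapDomainRingHom_of]
    conv_lhs => rw [← inv_mul_cancel_right g (inj₃₄ (proj₄₃ g)), map_mul, ← mul_assoc,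
      idemE_mul_of_mem (mul_inv_mem_E g)]
  | add x y hx hy => simp only [map_add, mul_add, hx, hy]
  | smul r x hx =>
    rw [map_smul, show ∀ y, MonoidAlgebra.mapDomainRingHom k inj₃₄ (r • y) =
      r • MonoidAlgebra.mapDomainRingHom k inj₃₄ y from fun y => MonoidAlgebra.mapDomain_smul _ _ _,
      mul_smul_comm, hx, mul_smul_comm]

theorem idemE_mul_mem {x : MonoidAlgebra k (Γ 4)} (hx : proj k x ∈ gen (q k 3 le_rfl)) :
    idemE k * x ∈ gen (q k 4 three_le_four) := by
  have hs : Function.Surjective (proj k : MonoidAlgebra k (Γ 4) →+* MonoidAlgebra k (Γ 3)) :=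
    fun y => ⟨_, proj_mapDomain y⟩
  rw [← proj_q] at hx
  obtain ⟨y, hy, hxy⟩ := exists_mem_gen hs hx
  rw [idemE_mul, ← show proj k y = proj k x from hxy, ← idemE_mul]
  exact Ideal.mul_mem_left _ _ hy

variable {ω : k} (hω : ω ^ 2 + ω + 1 = 0)

theorem Phi_idemE : Phi hω (idemE k) = 0 := by
  rw [idemE, map_sum]
  refine Finset.sum_eq_zero fun v _ => ?_
  rw [mu, map_mul, Phi_eig_one, zero_mul]

theorem iIdeal_entries (p q' : Fin 3) : Phi hω (q k 4 three_le_four) p q' ∈ iIdeal ω := by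
  rw [Phi_q]
  refine mem_iIdeal_of_mem (sum_mem fun i _ => Submodule.smul_mem _ _ ?_)
  exact Submodule.subset_span ⟨i, rfl⟩

theorem iIdeal_le_entryIdeal :
    iIdeal ω ≤ entryIdeal (gen (Phi hω (q k 4 three_le_four))) := by
  have h2 := CharTwo.two_eq_zero (R := k)
  have h : ∀ p q', _ ∈ entryIdeal (gen (Phi hω (q k 4 three_le_four))) :=
    entry_mem_entryIdeal _ (mem_gen (Phi hω (q k 4 three_le_four)))
  have hsm : ∀ (c : k) {x}, x ∈ entryIdeal (gen (Phi hω (q k 4 three_le_four))) →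
      c • x ∈ entryIdeal (gen (Phi hω (q k 4 three_le_four))) := fun c x hx =>
    Submodule.smul_of_tower_mem (entryIdeal (gen (Phi hω (q k 4 three_le_four)))).asIdeal c hx
  -- The four generators come from four entries: (0, 0) is XYZ; modulo it, (0, 1) and (1, 0) are XZ
  -- + ωYZ and XZ + (ω + 1)YZ, whose difference is YZ; and (1, 1) is XY + ω²Z + YZ.
  have h3 : om k qi * (om k qj * om k (qi * qi)) ∈
      entryIdeal (gen (Phi hω (q k 4 three_le_four))) := by
    simpa [Phi_q, Fin.sum_univ_four, coeffQ, quatGen] using h 0 0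
  have h01 := sub_mem (h 0 1) (hsm (ω + 1) h3)
  have h10 := sub_mem (h 1 0) (hsm ω h3)
  have h11 := sub_mem (h 1 1) (hsm ω h3)
  simp only [Phi_q, Fin.sum_univ_four, coeffQ, quatGen, Matrix.cons_val, Matrix.of_apply,
    Matrix.cons_val', zero_smul, one_smul, zero_add, add_zero, add_sub_cancel_right] at h01 h10 h11
  have hYZ : om k qj * om k (qi * qi) ∈ entryIdeal (gen (Phi hω (q k 4 three_le_four))) := by
    have := sub_mem h10 h01
    rwa [add_sub_add_left_eq_sub, ← sub_smul, show ω + 1 - ω = 1 by ring, one_smul] at this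
  have hXZ := sub_mem h01 (hsm ω hYZ)
  have hm := sub_mem h11 hYZ
  rw [add_sub_cancel_right] at hXZ hm
  exact iIdeal_le hm hXZ hYZ h3

/-- The morphism from `kΓ₄` to the matrices over `kΓ₃ / I_q`. -/
noncomputable def PhiQuot : MonoidAlgebra k (Γ 4) →ₐ[k]
    Matrix (Fin 3) (Fin 3) (MonoidAlgebra k (Γ 3) ⧸ (iIdeal ω).asIdeal) :=
  (Ideal.Quotient.mkₐ k (iIdeal ω).asIdeal).mapMatrix.comp (Phi hω)

theorem PhiQuot_eq_zero_iff {x : MonoidAlgebra k (Γ 4)} :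
    PhiQuot hω x = 0 ↔ ∀ p q, Phi hω x p q ∈ iIdeal ω := by
  rw [← Matrix.ext_iff]
  refine forall_congr' fun p => forall_congr' fun q => ?_
  exact Ideal.Quotient.eq_zero_iff_mem

theorem PhiQuot_surjective : Function.Surjective (PhiQuot hω) := by
  intro Y
  choose X hX using fun p q => Ideal.Quotient.mk_surjective (Y p q)
  obtain ⟨x, hx⟩ := Phi_surjective hω (Matrix.of X)
  refine ⟨x, Matrix.ext fun p q => ?_⟩
  rw [← hX, PhiQuot, AlgHom.comp_apply, hx]
  rfl

/-- The image of x lies in the ideal generated by the image of q, so x agrees under `Phi` with some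
y in the ideal of q; as `idem ω` kills the kernel of `Phi`, it takes the same product with x and y.
-/
theorem idem_mul_mem {x : MonoidAlgebra k (Γ 4)} (hx : PhiQuot hω x = 0) :
    idem ω * x ∈ gen (q k 4 three_le_four) := by
  rw [PhiQuot_eq_zero_iff] at hx
  have hx' : Phi hω x ∈ gen (Phi hω (q k 4 three_le_four)) := by
    rw [Matrix.matrix_eq_sum_single (Phi hω x)]
    exact sum_mem fun p _ => sum_mem fun q' _ =>
      (mem_entryIdeal _).1 (iIdeal_le_entryIdeal hω (hx p q')) p q'
  obtain ⟨y, hy, hxy⟩ := exists_mem_gen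
    (f := (Phi hω : MonoidAlgebra k (Γ 4) →+* Matrix (Fin 3) (Fin 3) (MonoidAlgebra k (Γ 3))))
    (Phi_surjective hω) hx'
  have h0 : Phi hω (x - y) = 0 := by
    rw [map_sub, sub_eq_zero]; exact hxy.symm
  have := mul_idem_eq_zero hω h0
  rw [← idem_comm, mul_sub, sub_eq_zero] at this
  rw [this]
  exact Ideal.mul_mem_left _ _ hy

theorem idem_add_idem_add_idem (ω : k) : idem ω + idem (ω + 1) + idem 1 = 1 := by
  have h2 := CharTwo.two_eq_zero (R := k)
  simp only [eig]
  match_scalars <;> grind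

theorem nonempty_K_four_equiv (hω : ω ^ 2 + ω + 1 = 0) (hω' : (ω + 1) ^ 2 + (ω + 1) + 1 = 0) :
    Nonempty (K k 4 three_le_four ≃ₐ[k] K k 3 le_rfl ×
      Matrix (Fin 3) (Fin 3) (MonoidAlgebra k (Γ 3) ⧸ (iIdeal ω).asIdeal) ×
      Matrix (Fin 3) (Fin 3) (MonoidAlgebra k (Γ 3) ⧸ (iIdeal (ω + 1)).asIdeal)) := by
  have h2 := CharTwo.two_eq_zero (R := k)
  have hP : ∀ {c : k}, c ^ 2 + c + 1 = 0 → proj k (idem c) = 0 := fun {c} hc => by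
    rw [proj_idem, show 1 + c + c ^ 2 = 0 by linear_combination hc, map_zero]
  have hPhi : ∀ {c : k} (hc : c ^ 2 + c + 1 = 0), PhiQuot hc (idemE k) = 0 ∧
      PhiQuot hc (idem c) = 1 ∧ PhiQuot hc (idem (c + 1)) = 0 := fun hc => by
    simp only [PhiQuot, AlgHom.comp_apply, Phi_idemE, Phi_idem, Phi_idem_conj, map_zero, map_one,
      and_self]
  have hq : ∀ {c : k} (hc : c ^ 2 + c + 1 = 0), PhiQuot hc (q k 4 three_le_four) = 0 := fun hc =>
    (PhiQuot_eq_zero_iff hc).2 (iIdeal_entries hc)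
  refine nonempty_algEquiv_prod
    (ψ₀ := (Ideal.Quotient.mkₐ k (gen (q k 3 le_rfl))).comp (proj k))
    (ψ₁ := PhiQuot hω) (ψ₂ := PhiQuot hω') (e₀ := idemE k) (e₁ := idem ω) (e₂ := idem (ω + 1))
    ?_ (PhiQuot_surjective hω) (PhiQuot_surjective hω') ⟨?_, ?_, ?_⟩ (hPhi hω) ?_ ?_ (hq hω) (hq hω')
    ?_ (fun y => idem_mul_mem hω) (fun y => idem_mul_mem hω') ?_
  · exact (Ideal.Quotient.mkₐ_surjective k _).comp fun y => ⟨_, proj_mapDomain y⟩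
  · rw [AlgHom.comp_apply, proj_idemE, map_one]
  · rw [AlgHom.comp_apply, hP hω, map_zero]
  · rw [AlgHom.comp_apply, hP hω', map_zero]
  · obtain ⟨h0, h1, h2'⟩ := hPhi hω'
    -- For the root ω + 1 the conjugate root is (ω + 1) + 1 = ω.
    rw [add_assoc, one_add_one_eq_two, h2, add_zero] at h2'
    exact ⟨h0, h2', h1⟩
  · rw [AlgHom.comp_apply, proj_q]
    exact Ideal.Quotient.eq_zero_iff_mem.2 (mem_gen _)
  · intro y hy
    exact idemE_mul_mem (Ideal.Quotient.eq_zero_iff_mem.1 hy)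
  · have : 1 - idemE k - idem ω - idem (ω + 1) = idem 1 - idemE k := by
      rw [← idem_add_idem_add_idem ω]; abel
    rw [this]
    exact idem_one_sub_idemE_mem

end Assembly

end CubicBraid

/-! ### The theorem -/

theorem theorem4p13 (k : Type*) [Field k] [CharP k 2] :
    -- `J(kΓ₃)⁴ = (q) ⊂ (b) = J(kΓ₃)³`
    (J (MonoidAlgebra k (Γ 3)) 4 = gen (q k 3 le_rfl) ∧
      gen (q k 3 le_rfl) < gen (b k 3 le_rfl) ∧
      gen (b k 3 le_rfl) = J (MonoidAlgebra k (Γ 3)) 3) ∧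
    -- `kK₃ ≃ kΓ₃/J(kΓ₃)⁴ ≃ (kQ/J(kQ)⁴) ⋊ C₃`
    (Nonempty (K k 3 le_rfl ≃ₐ[k] MonoidAlgebra k (Γ 3) ⧸ J (MonoidAlgebra k (Γ 3)) 4) ∧
      Nonempty ((MonoidAlgebra k (Γ 3) ⧸ J (MonoidAlgebra k (Γ 3)) 4) ≃ₐ[k]
        SkewMonoidAlgebra (kQJ4 k) C₃)) ∧
    -- when `k` contains `F₄`, the structure of `kK₄`; `M' = M̄` and `I' = Ī`
    (∀ ι : F₄ →+* k,
      ∃ (M₀ : TwoSidedIdeal (MonoidAlgebra F₄ Q)) (M M' : TwoSidedIdeal (MonoidAlgebra k Q))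
        (I I' : TwoSidedIdeal (MonoidAlgebra k (Γ 3))),
        (M : Set (MonoidAlgebra k Q)) = scalarExt ι M₀ ∧
        (M' : Set (MonoidAlgebra k Q)) = scalarExt ι (galoisConj M₀) ∧
        Module.finrank k (M.asIdeal.restrictScalars k) = 4 ∧
        J (MonoidAlgebra k Q) 3 < M.asIdeal ∧
        M.asIdeal < J (MonoidAlgebra k Q) 2 ∧
        M.asIdeal ⊔ M'.asIdeal = J (MonoidAlgebra k Q) 2 ∧
        (I : Set (MonoidAlgebra k (Γ 3))) = mulC₃ (M : Set (MonoidAlgebra k Q)) ∧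
        (I' : Set (MonoidAlgebra k (Γ 3))) = mulC₃ (M' : Set (MonoidAlgebra k Q)) ∧
        Nonempty (K k 4 (by norm_num) ≃ₐ[k]
          K k 3 le_rfl ×
            Matrix (Fin 3) (Fin 3) (MonoidAlgebra k (Γ 3) ⧸ I.asIdeal) ×
            Matrix (Fin 3) (Fin 3) (MonoidAlgebra k (Γ 3) ⧸ I'.asIdeal))) := by
  refine ⟨⟨J_Γ₃_four_eq k, gen_q_lt k, J_Γ₃_three_eq k⟩,
    ⟨⟨Ideal.quotientEquivAlgOfEq k (J_Γ₃_four_eq k).symm⟩, nonempty_equiv_skew k⟩, fun ι => ?_⟩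
  obtain ⟨ω₀, hω₀⟩ := exists_root_F₄
  have h2 := CharTwo.two_eq_zero (R := k)
  have hω : ι ω₀ ^ 2 + ι ω₀ + 1 = 0 := by
    rw [← map_pow, ← map_add, ← map_one ι, ← map_add, hω₀, map_zero]
  have hω' : (ι ω₀ + 1) ^ 2 + (ι ω₀ + 1) + 1 = 0 := by grind
  have h0 : ι ω₀ ≠ 0 := by intro h; simp [h] at hω
  -- Frobenius sends ω₀ to ω₀² = ω₀ + 1, so the conjugate ideal is the one attached to ι ω₀ + 1.
  have hf : (ι.comp (frobenius F₄ 2)) ω₀ = ι ω₀ + 1 := by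
    rw [RingHom.comp_apply, frobenius_def, map_pow]; grind
  refine ⟨mIdeal ω₀, mIdeal (ι ω₀), mIdeal (ι ω₀ + 1), iIdeal (ι ω₀), iIdeal (ι ω₀ + 1), ?_, ?_,
    finrank_mIdeal, J_Q_lt_mIdeal, mIdeal_lt_J_Q h0, mIdeal_sup hω, coe_iIdeal, coe_iIdeal,
    nonempty_K_four_equiv hω hω'⟩
  · rw [scalarExt_mIdeal, coe_mIdeal]
  · rw [scalarExt_galoisConj, scalarExt_mIdeal, hf, coe_mIdeal]
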